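/- Let $\mathbb{H}^3=\{(x,y,z)\in\mathbb{R}^3 : z>0\}$ carry the hyperbolic metric $\langle\cdot,\cdot\rangle=(dx^2+dy^2+dz^2)/z^2$. A surface in $\mathbb{H}^3$ is a smooth immersion $X\colon M\to\mathbb{H}^3$ of a (Hausdorff, second countable) smooth $2$-manifold $M$, possibly with boundary, written $\Sigma=X(M)$. A family of immersions $F_t\colon M\to\mathbb{H}^3$, $t\in[0,\delta)$, smooth in $(t,x)$, with smooth unit normal fields $\eta_t$, is a mean curvature flow (MCF) if $\langle \partial_t F_t,\eta_t\rangle=H_t$, where $H_t$ is half the trace of the shape operator $v\mapsto-\overline\nabla_v\eta_t$. A surface $\Sigma=X(M)$ is a translator to MCF if it is the initial condition of a soliton moving by the hyperbolic translations $\Gamma_t(p)=e^tp$ along the $z$-axis, that is, if there is a MCF $F_t$, $t\in[0,\delta)$, with $\delta>0$, $F_0=X$ and $F_t(M)=\Gamma_t(\Sigma)$ for all $t\in[0,\delta)$. **Theorem (tangency principle for translators).** Let $\Sigma_1=X_1(M_1)$ and $\Sigma_2=X_2(M_2)$ be two translators to MCF in $\mathbb{H}^3$ which are tangent at a point $p=X_1(p_1)=X_2(p_2)$,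 where $p_i$ is an interior point of $M_i$; that is, $dX_1(T_{p_1}M_1)=dX_2(T_{p_2}M_2)$. Suppose that in a neighborhood of $p$ in $\mathbb{H}^3$ the sheet of $\Sigma_1$ through $p_1$ lies on one side of the sheet of $\Sigma_2$ through $p_2$ (touching allowed): in some open neighborhood $W$ of $p$ the latter is the zero set of a smooth function $f$ without critical points, and $f\ge 0$ on the former. Then $\Sigma_1$ and $\Sigma_2$ coincide near $p$: there are open neighborhoods $U_i$ of $p_i$ in $M_i$ with $X_1(U_1)=X_2(U_2)$. Moreover, if $\Sigma_1$ and $\Sigma_2$ are both complete (that is, $M_i$ has no boundary and is complete for the Riemannian distance induced from $\mathbb{H}^3$) and $M_1$, $M_2$ are connected, then $\Sigma_1=\Sigma_2$. -/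

import Mathlib

open Set Filter Topology
open scoped Manifold ContDiff ENNReal

namespace HypTranslator

/-- The Euclidean space `ℝ³` with coordinates `(x, y, z) = (p 0, p 1, p 2)`. -/
abbrev E3 : Type := EuclideanSpace ℝ (Fin 3)

/-- The vertical coordinate vector `∂_z`. -/
noncomputable def e₃ : E3 := EuclideanSpace.single 2 1

/-- The open upper half-space `z > 0`, the underlying set of hyperbolic `3`-space. -/
def upperHalfSpace : Set E3 := {p | 0 < p 2}

/-- The hyperbolic metric `(dx² + dy² + dz²) / z²` at the point `p`. -/
noncomputable def hypInner (p u v : E3) : ℝ := inner ℝ u v / (p 2) ^ 2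

/-- The hyperbolic length of a tangent vector `u` at `p`. -/
noncomputable def hypNorm (p u : E3) : ℝ := Real.sqrt (hypInner p u u)

/-- The Christoffel symbols of the Levi-Civita connection of the hyperbolic metric in the
half-space coordinates, as a bilinear expression: `∇_U V = D_U V + christoffel p U V`.
The next two facts (no torsion, compatibility with the metric) characterize it. -/
noncomputable def christoffel (p u v : E3) : E3 :=
  (p 2)⁻¹ • ((inner ℝ u v : ℝ) • e₃ - u 2 • v - v 2 • u)

theorem christoffel_symm (p u v : E3) : christoffel p u v = christoffel p v u := by
  unfold christoffel
  rw [real_inner_comm u v]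
  congr 1
  abel

/-- Compatibility with the metric, for constant (coordinate) vector fields `v`, `w`. -/
theorem hasDerivAt_hypInner (p : E3) (hp : p ∈ upperHalfSpace) (v w u : E3) :
    HasDerivAt (fun t : ℝ => hypInner (p + t • u) v w)
      (hypInner p (christoffel p u v) w + hypInner p v (christoffel p u w)) 0 := by
  have hp0 : p 2 ≠ 0 := ne_of_gt hp
  have h1 : HasDerivAt (fun t : ℝ => p 2 + t * u 2) (u 2) 0 := by
    simpa using ((hasDerivAt_id (0 : ℝ)).mul_const (u 2)).const_add (p 2)
  have h2 := (hasDerivAt_const (0 : ℝ) (inner ℝ v w : ℝ)).div (h1.pow 2) (by simpa using hp0)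
  have h3 : ∀ x : E3, (inner ℝ e₃ x : ℝ) = x 2 := fun x => by
    simp [e₃, EuclideanSpace.inner_single_left]
  have h4 : ∀ x : E3, (inner ℝ x e₃ : ℝ) = x 2 := fun x => by
    rw [real_inner_comm, h3]
  have h5 : (fun t : ℝ => hypInner (p + t • u) v w) =
      fun t => inner ℝ v w / (p 2 + t * u 2) ^ 2 := by
    funext t
    simp [hypInner]
  rw [h5]
  refine h2.congr_deriv ?_
  simp only [hypInner, christoffel, inner_smul_left, inner_smul_right, inner_sub_left,
    inner_sub_right, h3, h4, conj_trivial, real_inner_comm v u]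
  field_simp
  simp
  ring

section Surface

variable {H : Type*} [TopologicalSpace H]
  (I : ModelWithCorners ℝ (EuclideanSpace ℝ (Fin 2)) H)
  {M : Type*} [TopologicalSpace M] [ChartedSpace H M]

/-- The differential at `x` of a map `X : M → ℝ³`, as a linear map `T_x M → ℝ³`. -/
noncomputable def dmap (X : M → E3) (x : M) : TangentSpace I x →ₗ[ℝ] E3 :=
  (mfderiv I 𝓘(ℝ, E3) X x).toLinearMap

/-- `X` is a smooth immersion of the surface `M` (possibly with boundary) into `ℍ³`. -/
structure IsImmersedSurface (X : M → E3) : Prop where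
  mem : ∀ x, X x ∈ upperHalfSpace
  smooth : ContMDiff I 𝓘(ℝ, E3) ∞ X
  immersive : ∀ x, Function.Injective (dmap I X x)

/-- `η` is a smooth unit normal field along the immersion `X`, for the hyperbolic metric. -/
structure IsUnitNormal (X η : M → E3) : Prop where
  smooth : ContMDiff I 𝓘(ℝ, E3) ∞ η
  unit : ∀ x, hypInner (X x) (η x) (η x) = 1
  normal : ∀ x (v : TangentSpace I x), hypInner (X x) (dmap I X x v) (η x) = 0

/-- The hyperbolic covariant derivative `v ↦ ∇_v V` at `x` of a vector field `V` along `X`. -/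
noncomputable def covDeriv (X V : M → E3) (x : M) : TangentSpace I x →ₗ[ℝ] E3 where
  toFun v := dmap I V x v + christoffel (X x) (dmap I X x v) (V x)
  map_add' v w := by
    simp only [map_add, christoffel, inner_add_left, add_smul, smul_add, PiLp.add_apply]
    module
  map_smul' c v := by
    simp only [map_smul, christoffel, inner_smul_left, PiLp.smul_apply, smul_eq_mul,
      RingHom.id_apply, conj_trivial]
    module

/-- The shape operator `A v = -∇_v η` on `T_x M`. Since `∇_v η` is orthogonal to the unit normal
`η`, it is tangent to the surface, and it is read in `T_x M` through the inverse of the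
(injective) differential of `X`. -/
noncomputable def shapeOperator (X η : M → E3) (x : M) :
    TangentSpace I x →ₗ[ℝ] TangentSpace I x :=
  -((dmap I X x).leftInverse ∘ₗ covDeriv I X η x)

/-- The mean curvature `(k₁ + k₂) / 2`, half the trace of the shape operator. -/
noncomputable def meanCurvature (X η : M → E3) (x : M) : ℝ :=
  LinearMap.trace ℝ (TangentSpace I x) (shapeOperator I X η x) / 2

/-- The family of immersions `X t`, `t ∈ [0, δ)`, with unit normals `η t`, is a mean curvature
flow in `ℍ³`: the normal component of its velocity is `H_t η_t`. -/
structure IsMeanCurvatureFlow (δ : ℝ) (X η : ℝ → M → E3) : Prop where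
  smooth : ContMDiffOn (𝓘(ℝ, ℝ).prod I) 𝓘(ℝ, E3) ∞
    (fun q : ℝ × M => X q.1 q.2) (Ico 0 δ ×ˢ univ)
  immersed : ∀ t ∈ Ico 0 δ, IsImmersedSurface I (X t)
  normal : ∀ t ∈ Ico 0 δ, IsUnitNormal I (X t) (η t)
  evolution : ∀ t ∈ Ico 0 δ, ∀ x,
    hypInner (X t x) (derivWithin (fun s => X s x) (Ico 0 δ) t) (η t x) =
      meanCurvature I (X t) (η t) x

/-- The immersed surface `X` is a translator: it is the initial condition of a mean curvature
flow whose surface at time `t` is the image of the initial one under the hyperbolic translation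
`Γ_t(p) = e^t p` along the `z`-axis. -/
def IsTranslator (X : M → E3) : Prop :=
  ∃ δ > 0, ∃ F η : ℝ → M → E3, IsMeanCurvatureFlow I δ F η ∧ F 0 = X ∧
    ∀ t ∈ Ico 0 δ, range (F t) = (fun p : E3 => Real.exp t • p) '' range X

/-- The Riemannian distance on `M` of the metric induced by `X` from `ℍ³`: the infimum of the
hyperbolic lengths of `C¹` paths in `M` (infinite between different components). -/
noncomputable def inducedEDist (X : M → E3) (x y : M) : ℝ≥0∞ :=
  letI : ∀ p : M, ENorm (TangentSpace I p) :=
    fun p => ⟨fun v => ENNReal.ofReal (hypNorm (X p) (dmap I X p v))⟩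
  Manifold.riemannianEDist I x y

/-- The immersed surface `X` is complete: it has no boundary, and every Cauchy sequence of the
induced Riemannian distance converges. -/
structure IsCompleteSurface (X : M → E3) : Prop where
  boundaryless : ∀ x : M, I.IsInteriorPoint x
  complete : ∀ u : ℕ → M,
    (∀ ε > 0, ∃ N, ∀ m ≥ N, ∀ n ≥ N, inducedEDist I X (u m) (u n) < ε) →
    ∃ x, Tendsto (fun n => inducedEDist I X (u n) x) atTop (𝓝 0)

end Surface

/-- Near their common point `p = X₁ p₁ = X₂ p₂`, the sheet of `X₁` through `p₁` lies on one side
of the sheet of `X₂` through `p₂`: in an open neighborhood `W` of `p` in `ℍ³`, the latter is the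
regular zero set of a smooth function `f`, so that its two sides are `f > 0` and `f < 0`, and
`f ≥ 0` on the former. -/
def LiesOnOneSide {M₁ M₂ : Type*} [TopologicalSpace M₁] [TopologicalSpace M₂]
    (X₁ : M₁ → E3) (p₁ : M₁) (X₂ : M₂ → E3) (p₂ : M₂) : Prop :=
  ∃ U₁ ∈ 𝓝 p₁, ∃ U₂ ∈ 𝓝 p₂, ∃ W ⊆ upperHalfSpace, IsOpen W ∧ X₂ p₂ ∈ W ∧
    ∃ f : E3 → ℝ, ContDiffOn ℝ ∞ f W ∧ (∀ q ∈ W, fderiv ℝ f q ≠ 0) ∧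
      X₂ '' U₂ ∩ W = {q ∈ W | f q = 0} ∧ ∀ q ∈ X₁ '' U₁ ∩ W, 0 ≤ f q

end HypTranslator

/-!
The tangency principle for translators is the strong maximum principle for a quasilinear elliptic
equation, completed by unique continuation.

*The equation.* If `F_t` is a soliton starting at `X`, the maps `e^{-t} F_t` all take values in
the null set `X(M)`, hence `(t, x) ↦ e^{-t} F_t(x)` has a singular differential; at `t = 0` this
says that `∂_t F - X` is tangent to the surface. So the mean curvature of a translator is the normal
component of the position vector, which is the Killing field of the translations
(`IsTranslator.exists_normal`); no reparametrization of the flow is needed. Written as a graph `u`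
over a plane, with respect to an orthonormal frame, the surface satisfies a quasilinear elliptic
equation (`isTranslatorGraph_of_meanCurvature`), and the difference `w` of two solutions satisfies a
linear elliptic differential inequality `|a₁₁ w₁₁ + 2 a₁₂ w₁₂ + a₂₂ w₂₂| ≤ C (|w| + |∇w|)`
(`IsTranslatorGraph.isEllipticIneq_sub`).

*Local coincidence.* Tangent surfaces are graphs `u₁`, `u₂` over the same plane. One-sidedness with
respect to a regular level set means that `u₁ - u₂` has a constant sign (`eventually_graph_le`), and
it vanishes at the point of tangency, so the strong maximum principle
(`IsEllipticIneq.eventually_eq_zero`, from Hopf's boundary point lemma) gives `u₁ = u₂` near it.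

*Global coincidence.* Consider the set of points of `M₁` at which the germ of the image sheet is
also the germ of a sheet of `X₂`. It is open and nonempty. To see that it is closed, a segment in
a graph of `X₁` starting at a point of the set is lifted to `M₂`: the lift has finite length, so by
completeness it converges at the end of any interval where it is defined; the limit point is tangent
to the graph, and the two sheets coincide there by unique continuation
(`exists_sameSheet_center`). By connectedness `X₁(M₁) ⊆ X₂(M₂)`, and conversely.

*Unique continuation.* A solution of the elliptic differential inequality on a disc that vanishes
near the center vanishes on the disc (`IsEllipticIneq.unique_continuation`). In two variables the
operator is the composition of two first order complex operators `∂₁ + (k ± i m) ∂₂`, up to a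
positive factor and terms of first order. A Carleman estimate for such first order operators
(`carleman_of_weight`) is used with the weights `exp (2 τ exp (-l |s - a|²))` centered at the center
`a` of the disc (`exists_gaussWeight`).
-/

namespace HypTranslator

open MeasureTheory

/-! ### Partial derivatives on the plane -/

/-- The partial derivative in the first real coordinate, the plane `ℝ²` being modelled on `ℂ`. -/
noncomputable def dx (f : ℂ → ℝ) (s : ℂ) : ℝ := fderiv ℝ f s 1

/-- The partial derivative in the second real coordinate. -/
noncomputable def dy (f : ℂ → ℝ) (s : ℂ) : ℝ := fderiv ℝ f s Complex.I

theorem fderiv_apply_eq_dx_dy (f : ℂ → ℝ) (s v : ℂ) :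
    fderiv ℝ f s v = v.re * dx f s + v.im * dy f s := by
  have h : v = v.re • (1 : ℂ) + v.im • Complex.I := by
    apply Complex.ext <;> simp
  conv_lhs => rw [h]
  rw [map_add, map_smul, map_smul]
  rfl

theorem dx_eq_of_hasFDerivAt {f : ℂ → ℝ} {f' : ℂ →L[ℝ] ℝ} {s : ℂ} (h : HasFDerivAt f f' s) :
    dx f s = f' 1 := by rw [dx, h.fderiv]

theorem dy_eq_of_hasFDerivAt {f : ℂ → ℝ} {f' : ℂ →L[ℝ] ℝ} {s : ℂ} (h : HasFDerivAt f f' s) :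
    dy f s = f' Complex.I := by rw [dy, h.fderiv]

section Calculus

variable {f g : ℂ → ℝ} {s : ℂ}

theorem dx_add (hf : DifferentiableAt ℝ f s) (hg : DifferentiableAt ℝ g s) :
    dx (fun s => f s + g s) s = dx f s + dx g s := by
  rw [dx_eq_of_hasFDerivAt (f := fun s => f s + g s) (hf.hasFDerivAt.add hg.hasFDerivAt)]; rfl

theorem dy_add (hf : DifferentiableAt ℝ f s) (hg : DifferentiableAt ℝ g s) :
    dy (fun s => f s + g s) s = dy f s + dy g s := by
  rw [dy_eq_of_hasFDerivAt (f := fun s => f s + g s) (hf.hasFDerivAt.add hg.hasFDerivAt)]; rfl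

theorem dx_sub (hf : DifferentiableAt ℝ f s) (hg : DifferentiableAt ℝ g s) :
    dx (fun s => f s - g s) s = dx f s - dx g s := by
  rw [dx_eq_of_hasFDerivAt (f := fun s => f s - g s) (hf.hasFDerivAt.sub hg.hasFDerivAt)]; rfl

theorem dy_sub (hf : DifferentiableAt ℝ f s) (hg : DifferentiableAt ℝ g s) :
    dy (fun s => f s - g s) s = dy f s - dy g s := by
  rw [dy_eq_of_hasFDerivAt (f := fun s => f s - g s) (hf.hasFDerivAt.sub hg.hasFDerivAt)]; rfl

theorem dx_mul (hf : DifferentiableAt ℝ f s) (hg : DifferentiableAt ℝ g s) :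
    dx (fun s => f s * g s) s = dx f s * g s + f s * dx g s := by
  rw [dx_eq_of_hasFDerivAt (f := fun s => f s * g s) (hf.hasFDerivAt.mul hg.hasFDerivAt)]
  simp [dx]; ring

theorem dy_mul (hf : DifferentiableAt ℝ f s) (hg : DifferentiableAt ℝ g s) :
    dy (fun s => f s * g s) s = dy f s * g s + f s * dy g s := by
  rw [dy_eq_of_hasFDerivAt (f := fun s => f s * g s) (hf.hasFDerivAt.mul hg.hasFDerivAt)]
  simp [dy]; ring

theorem dx_const (c : ℝ) : dx (fun _ => c) s = 0 := by simp [dx]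

theorem dy_const (c : ℝ) : dy (fun _ => c) s = 0 := by simp [dy]

theorem dx_exp (hf : DifferentiableAt ℝ f s) :
    dx (fun s => Real.exp (f s)) s = Real.exp (f s) * dx f s := by
  rw [dx_eq_of_hasFDerivAt hf.hasFDerivAt.exp]; rfl

theorem dy_exp (hf : DifferentiableAt ℝ f s) :
    dy (fun s => Real.exp (f s)) s = Real.exp (f s) * dy f s := by
  rw [dy_eq_of_hasFDerivAt hf.hasFDerivAt.exp]; rfl

theorem dx_re : dx (fun s => s.re) s = 1 := by
  have : HasFDerivAt (fun s : ℂ => s.re) Complex.reCLM s := Complex.reCLM.hasFDerivAt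
  rw [dx_eq_of_hasFDerivAt this]; simp

theorem dy_re : dy (fun s => s.re) s = 0 := by
  have : HasFDerivAt (fun s : ℂ => s.re) Complex.reCLM s := Complex.reCLM.hasFDerivAt
  rw [dy_eq_of_hasFDerivAt this]; simp

theorem dx_im : dx (fun s => s.im) s = 0 := by
  have : HasFDerivAt (fun s : ℂ => s.im) Complex.imCLM s := Complex.imCLM.hasFDerivAt
  rw [dx_eq_of_hasFDerivAt this]; simp

theorem dy_im : dy (fun s => s.im) s = 1 := by
  have : HasFDerivAt (fun s : ℂ => s.im) Complex.imCLM s := Complex.imCLM.hasFDerivAt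
  rw [dy_eq_of_hasFDerivAt this]; simp

theorem dx_congr (h : f =ᶠ[𝓝 s] g) : dx f s = dx g s := by rw [dx, dx, h.fderiv_eq]

theorem dy_congr (h : f =ᶠ[𝓝 s] g) : dy f s = dy g s := by rw [dy, dy, h.fderiv_eq]

theorem contDiffAt_dx (hf : ContDiffAt ℝ ∞ f s) : ContDiffAt ℝ ∞ (dx f) s :=
  (hf.fderiv_right (m := ∞) (by simp)).clm_apply contDiffAt_const

theorem contDiffAt_dy (hf : ContDiffAt ℝ ∞ f s) : ContDiffAt ℝ ∞ (dy f) s :=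
  (hf.fderiv_right (m := ∞) (by simp)).clm_apply contDiffAt_const

theorem contDiff_dx (hf : ContDiff ℝ ∞ f) : ContDiff ℝ ∞ (dx f) :=
  contDiff_iff_contDiffAt.2 fun _ => contDiffAt_dx hf.contDiffAt

theorem contDiff_dy (hf : ContDiff ℝ ∞ f) : ContDiff ℝ ∞ (dy f) :=
  contDiff_iff_contDiffAt.2 fun _ => contDiffAt_dy hf.contDiffAt

theorem dx_dy_comm (hf : ContDiffAt ℝ ∞ f s) : dy (dx f) s = dx (dy f) s := by
  have hs : IsSymmSndFDerivAt ℝ f s :=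
    hf.isSymmSndFDerivAt (by
      rw [minSmoothness_of_isRCLikeNormedField]; exact WithTop.coe_le_coe.2 (le_top : (2 : ℕ∞) ≤ ⊤))
  have hd : DifferentiableAt ℝ (fderiv ℝ f) s :=
    (hf.fderiv_right (m := ∞) (by simp)).differentiableAt (by simp)
  have h1 : ∀ v w : ℂ, fderiv ℝ (fun s => fderiv ℝ f s v) s w = fderiv ℝ (fderiv ℝ f) s w v := by
    intro v w
    rw [fderiv_clm_apply hd (differentiableAt_const v)]
    simp
  change fderiv ℝ (fun s => fderiv ℝ f s 1) s Complex.I =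
    fderiv ℝ (fun s => fderiv ℝ f s Complex.I) s 1
  rw [h1, h1]
  exact hs _ _

end Calculus

theorem integral_fderiv_apply_eq_zero {Z : ℂ → ℝ} (hZ : ContDiff ℝ ∞ Z)
    (hc : HasCompactSupport Z) (v : ℂ) : ∫ s, fderiv ℝ Z s v = 0 := by
  have hi : Integrable (fun s => fderiv ℝ Z s v) := by
    refine Continuous.integrable_of_hasCompactSupport ?_ ?_
    · exact (hZ.continuous_fderiv (by simp)).clm_apply continuous_const
    · exact (hc.fderiv (𝕜 := ℝ)).comp_left (g := fun L : ℂ →L[ℝ] ℝ => L v) (by simp)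
  have := integral_mul_fderiv_eq_neg_fderiv_mul_of_integrable (𝕜 := ℝ) (f := fun _ : ℂ => (1 : ℝ))
    (g := Z) (v := v) (μ := volume) (by simp) (by simpa using hi)
    (by simpa using hZ.continuous.integrable_of_hasCompactSupport hc)
    (fun _ _ => differentiableAt_const _) (fun _ _ => hZ.differentiable (by simp) _)
  simpa using this

/-- The divergence theorem for compactly supported fields. -/
theorem integral_divergence_eq_zero {Z₁ Z₂ : ℂ → ℝ} (h₁ : ContDiff ℝ ∞ Z₁) (h₂ : ContDiff ℝ ∞ Z₂)
    (c₁ : HasCompactSupport Z₁) (c₂ : HasCompactSupport Z₂) :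
    ∫ s, (dx Z₁ s + dy Z₂ s) = 0 := by
  have hi : ∀ {Z : ℂ → ℝ}, ContDiff ℝ ∞ Z → HasCompactSupport Z → ∀ v : ℂ,
      Integrable (fun s => fderiv ℝ Z s v) := by
    intro Z hZ hc v
    refine Continuous.integrable_of_hasCompactSupport ?_ ?_
    · exact (hZ.continuous_fderiv (by simp)).clm_apply continuous_const
    · exact (hc.fderiv (𝕜 := ℝ)).comp_left (g := fun L : ℂ →L[ℝ] ℝ => L v) (by simp)
  have := integral_add (hi h₁ c₁ 1) (hi h₂ c₂ Complex.I)
  rw [integral_fderiv_apply_eq_zero h₁ c₁, integral_fderiv_apply_eq_zero h₂ c₂, add_zero] at this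
  exact this

end HypTranslator

namespace HypTranslator

open MeasureTheory

/-! ### A Carleman estimate in the plane -/

/-- The pointwise part of the Carleman estimate. With `g = p + i q`, and `b + i b'` the derivative
of the weight along `∂₁ + (k + i m) ∂₂`, the numbers `A + i B` and `C + i D` are the conjugated
operator and (up to sign and lower order terms) its adjoint applied to `g`; the first order error
term is absorbed since `A, B, C, D` control the gradient of `g`. -/
theorem carleman_pointwise {p q p₁ p₂ k m m₁ m₂ b b' τ N₀ N₁ G α A B C D : ℝ}
    (hτ : 0 ≤ τ) (hm : 0 < m) (hα : α = (m₁ + m₂ * k) / (2 * m))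
    (hBD : B - D = 2 * m * p₂ - 2 * τ * b * q)
    (hAC : A + C = 2 * (p₁ + k * p₂ + τ * b' * q))
    (hN₀ : 16 * α ^ 2 + 4 * m₂ ^ 2 ≤ N₀)
    (hN₁ : 8 * |α| * |b| + 4 * |m₂| * |b'| ≤ N₁ * G) (hG : 0 ≤ N₁ * G) (hN : 0 ≤ N₀) :
    4 * q * (m₁ * p₂ - m₂ * p₁) ≤ (A ^ 2 + B ^ 2 + C ^ 2 + D ^ 2) / 2 +
      (N₀ + τ * (N₁ * G)) * (p ^ 2 + q ^ 2) := by
  have h2 : p₂ = (B - D + 2 * τ * b * q) / (2 * m) := by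
    rw [hBD]; field_simp; ring
  have h1 : p₁ = (A + C) / 2 - k * p₂ - τ * b' * q := by rw [hAC]; ring
  have key : 4 * q * (m₁ * p₂ - m₂ * p₁) = 4 * α * q * B - 4 * α * q * D - 2 * m₂ * q * A
      - 2 * m₂ * q * C + τ * q ^ 2 * (8 * α * b + 4 * m₂ * b') := by
    rw [h1, h2, hα]; field_simp; ring
  have h3 : 8 * α * b + 4 * m₂ * b' ≤ N₁ * G := by
    refine le_trans ?_ hN₁
    have e1 : α * b ≤ |α| * |b| := by rw [← abs_mul]; exact le_abs_self _
    have e2 : m₂ * b' ≤ |m₂| * |b'| := by rw [← abs_mul]; exact le_abs_self _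
    linarith
  have h4 : τ * q ^ 2 * (8 * α * b + 4 * m₂ * b') ≤ τ * q ^ 2 * (N₁ * G) :=
    mul_le_mul_of_nonneg_left h3 (by positivity)
  have h5 : (16 * α ^ 2 + 4 * m₂ ^ 2) * q ^ 2 ≤ N₀ * q ^ 2 :=
    mul_le_mul_of_nonneg_right hN₀ (by positivity)
  have h6 : 0 ≤ (N₀ + τ * (N₁ * G)) * p ^ 2 := by positivity
  rw [key]
  nlinarith [sq_nonneg (B - 4 * α * q), sq_nonneg (D + 4 * α * q), sq_nonneg (A + 2 * m₂ * q),
    sq_nonneg (C + 2 * m₂ * q)]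

/-- The divergence of the real vector field that governs the Carleman estimate for
`∂₁ + (k + i m) ∂₂` with weight `φ`. -/
noncomputable def weightDiv (k m φ : ℂ → ℝ) (s : ℂ) : ℝ :=
  dx (fun s => 2 * (dx φ s + k s * dy φ s)) s +
    dy (fun s => 2 * (k s * dx φ s + (k s ^ 2 + m s ^ 2) * dy φ s)) s

set_option maxHeartbeats 1600000 in
/-- **Carleman estimate** for the first order complex operator `∂₁ + (k + i m) ∂₂` applied to
`p + i q`: if the divergence attached to the weight `φ` dominates its gradient on `K`, then the
weighted `L²` norm gains a factor `τ` for functions vanishing off `K`. The constant `N` does not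
depend on the weight. -/
theorem carleman_of_weight {k m : ℂ → ℝ} (hk : ContDiff ℝ ∞ k) (hm : ContDiff ℝ ∞ m)
    (hm0 : ∀ s, 0 < m s) {K : Set ℂ} (hK : IsCompact K) :
    ∃ N : ℝ, 0 ≤ N ∧ ∀ φ : ℂ → ℝ, ContDiff ℝ ∞ φ → ∀ c > 0,
      (∀ s ∈ K, N * (|dx φ s| + |dy φ s|) + c ≤ weightDiv k m φ s) →
      ∃ τ₀ > 0, ∀ τ ≥ τ₀, ∀ p q : ℂ → ℝ, ContDiff ℝ ∞ p → ContDiff ℝ ∞ q →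
        (∀ s ∉ K, p s = 0) → (∀ s ∉ K, q s = 0) →
        c * τ * ∫ s, Real.exp (2 * τ * φ s) * (p s ^ 2 + q s ^ 2) ≤
          3 * ∫ s, Real.exp (2 * τ * φ s) * ((dx p s + k s * dy p s - m s * dy q s) ^ 2 +
            (dx q s + k s * dy q s + m s * dy p s) ^ 2) := by
  have ck := hk.continuous
  have cm := hm.continuous
  have cm1 := (contDiff_dx hm).continuous
  have cm2 := (contDiff_dy hm).continuous
  have hm2 : ∀ s, 2 * m s ≠ 0 := fun s => by have := hm0 s; positivity
  set α : ℂ → ℝ := fun s => (dx m s + dy m s * k s) / (2 * m s) with hα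
  have cα : Continuous α := by
    rw [hα]; exact (cm1.add (cm2.mul ck)).div (continuous_const.mul cm) hm2
  obtain ⟨N₀, hN₀⟩ := hK.exists_bound_of_continuousOn
    (f := fun s => 16 * α s ^ 2 + 4 * dy m s ^ 2) (by fun_prop)
  obtain ⟨N₁, hN₁⟩ := hK.exists_bound_of_continuousOn
    (f := fun s => 8 * |α s| * (1 + |k s|) + 4 * |dy m s| * |m s|) (by fun_prop)
  refine ⟨max N₁ 0, le_max_right _ _, fun φ hφ c hc hdiv => ?_⟩
  refine ⟨2 * max N₀ 0 / c + 1, by positivity, fun τ hτ P Q hP hQ hP0 hQ0 => ?_⟩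
  have hτ0 : 0 < τ := lt_of_lt_of_le (by positivity) hτ
  have hτc : 2 * max N₀ 0 ≤ τ * c := by
    have : 2 * max N₀ 0 / c ≤ τ := by linarith
    rwa [div_le_iff₀ hc] at this
  set e : ℂ → ℝ := fun s => Real.exp (τ * φ s) with he
  have se : ContDiff ℝ ∞ e := by rw [he]; exact (contDiff_const.mul hφ).exp
  -- conjugation by the weight
  set p : ℂ → ℝ := fun s => e s * P s with hp
  set q : ℂ → ℝ := fun s => e s * Q s with hq
  have sp : ContDiff ℝ ∞ p := se.mul hP
  have sq : ContDiff ℝ ∞ q := se.mul hQ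
  have sp1 := contDiff_dx sp
  have sp2 := contDiff_dy sp
  have sφ1 := contDiff_dx hφ
  have sφ2 := contDiff_dy hφ
  have dd : ∀ {f : ℂ → ℝ}, ContDiff ℝ ∞ f → ∀ s, DifferentiableAt ℝ f s :=
    fun hf s => hf.differentiable (by simp) s
  set V₁ : ℂ → ℝ := fun s => 2 * (dx φ s + k s * dy φ s) with hV₁
  set V₂ : ℂ → ℝ := fun s => 2 * (k s * dx φ s + (k s ^ 2 + m s ^ 2) * dy φ s) with hV₂
  have sV₁ : ContDiff ℝ ∞ V₁ := by rw [hV₁]; fun_prop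
  have sV₂ : ContDiff ℝ ∞ V₂ := by rw [hV₂]; fun_prop
  set r : ℂ → ℝ := fun s => p s * p s + q s * q s with hr
  have sr : ContDiff ℝ ∞ r := (sp.mul sp).add (sq.mul sq)
  set mq : ℂ → ℝ := fun s => m s * q s with hmq
  have smq : ContDiff ℝ ∞ mq := hm.mul sq
  -- `(Z₁, Z₂)` is the field whose divergence is the difference of the squares of the conjugated
  -- operator and of its adjoint, up to zeroth order terms and an error of first order
  set Z₁ : ℂ → ℝ := fun s => 4 * (mq s * dy p s) - τ * (V₁ s * r s) with hZ₁
  set Z₂ : ℂ → ℝ := fun s => (-4) * (mq s * dx p s) - τ * (V₂ s * r s) with hZ₂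
  have sZ₁ : ContDiff ℝ ∞ Z₁ := by rw [hZ₁]; fun_prop
  have sZ₂ : ContDiff ℝ ∞ Z₂ := by rw [hZ₂]; fun_prop
  have p0 : ∀ s ∉ K, p s = 0 := fun s hs => by simp [hp, hP0 s hs]
  have q0 : ∀ s ∉ K, q s = 0 := fun s hs => by simp [hq, hQ0 s hs]
  have cZ₁ : HasCompactSupport Z₁ := HasCompactSupport.intro hK fun s hs => by
    simp [hZ₁, hr, hmq, p0 s hs, q0 s hs]
  have cZ₂ : HasCompactSupport Z₂ := HasCompactSupport.intro hK fun s hs => by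
    simp [hZ₂, hr, hmq, p0 s hs, q0 s hs]
  -- derivatives vanish off the closed set `K`
  have off : ∀ {f : ℂ → ℝ}, (∀ s ∉ K, f s = 0) → ∀ s ∉ K, dx f s = 0 ∧ dy f s = 0 := by
    intro f hf s hs
    have : f =ᶠ[𝓝 s] fun _ => 0 := by
      filter_upwards [hK.isClosed.isOpen_compl.mem_nhds hs] with t ht using hf t ht
    rw [dx_congr this, dy_congr this]
    exact ⟨dx_const 0, dy_const 0⟩
  set A : ℂ → ℝ := fun s => e s * (dx P s + k s * dy P s - m s * dy Q s) with hA
  set B : ℂ → ℝ := fun s => e s * (dx Q s + k s * dy Q s + m s * dy P s) with hB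
  have hpt : ∀ s, dx Z₁ s + dy Z₂ s + c * τ / 2 * (p s ^ 2 + q s ^ 2) ≤
      3 / 2 * (A s ^ 2 + B s ^ 2) := by
    intro s
    by_cases hs : s ∈ K
    swap
    · have z1 : dx Z₁ s = 0 := (off (f := Z₁) (fun s hs => by
        simp [hZ₁, hr, hmq, p0 s hs, q0 s hs]) s hs).1
      have z2 : dy Z₂ s = 0 := (off (f := Z₂) (fun s hs => by
        simp [hZ₂, hr, hmq, p0 s hs, q0 s hs]) s hs).2
      rw [z1, z2, p0 s hs, q0 s hs]
      have : 0 ≤ A s ^ 2 + B s ^ 2 := by positivity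
      linarith
    have e1 : dx e s = e s * (τ * dx φ s) := by
      rw [he, dx_exp ((dd hφ s).const_mul τ), dx_mul (differentiableAt_const _) (dd hφ s), dx_const]
      ring
    have e2 : dy e s = e s * (τ * dy φ s) := by
      rw [he, dy_exp ((dd hφ s).const_mul τ), dy_mul (differentiableAt_const _) (dd hφ s), dy_const]
      ring
    have p1 : dx p s = τ * dx φ s * p s + e s * dx P s := by
      rw [hp, dx_mul (dd se s) (dd hP s), e1]; ring
    have p2 : dy p s = τ * dy φ s * p s + e s * dy P s := by
      rw [hp, dy_mul (dd se s) (dd hP s), e2]; ring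
    have q1 : dx q s = τ * dx φ s * q s + e s * dx Q s := by
      rw [hq, dx_mul (dd se s) (dd hQ s), e1]; ring
    have q2 : dy q s = τ * dy φ s * q s + e s * dy Q s := by
      rw [hq, dy_mul (dd se s) (dd hQ s), e2]; ring
    set b : ℝ := dx φ s + k s * dy φ s with hb
    set b' : ℝ := m s * dy φ s with hb'
    have hAs : A s = dx p s + k s * dy p s - m s * dy q s - τ * (b * p s - b' * q s) := by
      rw [p1, p2, q2, hA, hb, hb']; ring
    have hBs : B s = dx q s + k s * dy q s + m s * dy p s - τ * (b * q s + b' * p s) := by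
      rw [q1, p2, q2, hB, hb, hb']; ring
    set C : ℝ := dx p s + k s * dy p s + m s * dy q s + τ * (b * p s + b' * q s) with hC
    set D : ℝ := dx q s + k s * dy q s - m s * dy p s + τ * (b * q s - b' * p s) with hD
    have hdZ₁ : dx Z₁ s = 4 * ((dx m s * q s + m s * dx q s) * dy p s + m s * q s * dx (dy p) s) -
        τ * (dx V₁ s * (p s ^ 2 + q s ^ 2) + V₁ s * (2 * (p s * dx p s + q s * dx q s))) := by
      rw [hZ₁, dx_sub (dd (contDiff_const.mul (smq.mul sp2)) s)
        (dd (contDiff_const.mul (sV₁.mul sr)) s),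
        dx_mul (differentiableAt_const _) (dd (smq.mul sp2) s), dx_mul (dd smq s) (dd sp2 s),
        dx_mul (differentiableAt_const _) (dd (sV₁.mul sr) s), dx_mul (dd sV₁ s) (dd sr s),
        hmq, dx_mul (dd hm s) (dd sq s), hr, dx_add (dd (sp.mul sp) s) (dd (sq.mul sq) s),
        dx_mul (dd sp s) (dd sp s), dx_mul (dd sq s) (dd sq s), dx_const, dx_const]
      ring
    have hdZ₂ : dy Z₂ s = -4 * ((dy m s * q s + m s * dy q s) * dx p s + m s * q s * dx (dy p) s) -
        τ * (dy V₂ s * (p s ^ 2 + q s ^ 2) + V₂ s * (2 * (p s * dy p s + q s * dy q s))) := by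
      rw [hZ₂, dy_sub (dd (contDiff_const.mul (smq.mul sp1)) s)
        (dd (contDiff_const.mul (sV₂.mul sr)) s),
        dy_mul (differentiableAt_const _) (dd (smq.mul sp1) s), dy_mul (dd smq s) (dd sp1 s),
        dy_mul (differentiableAt_const _) (dd (sV₂.mul sr) s), dy_mul (dd sV₂ s) (dd sr s),
        hmq, dy_mul (dd hm s) (dd sq s), hr, dy_add (dd (sp.mul sp) s) (dd (sq.mul sq) s),
        dy_mul (dd sp s) (dd sp s), dy_mul (dd sq s) (dd sq s), dy_const, dy_const,
        dx_dy_comm sp.contDiffAt]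
      ring
    have hident : A s ^ 2 + B s ^ 2 - C ^ 2 - D ^ 2 = dx Z₁ s + dy Z₂ s -
        4 * q s * (dx m s * dy p s - dy m s * dx p s) +
        τ * (dx V₁ s + dy V₂ s) * (p s ^ 2 + q s ^ 2) := by
      rw [hdZ₁, hdZ₂, hAs, hBs, hC, hD, hV₁, hV₂, hb, hb']
      ring
    have hG0 : 0 ≤ |dx φ s| + |dy φ s| := by positivity
    have hw : max N₁ 0 * (|dx φ s| + |dy φ s|) + c ≤ dx V₁ s + dy V₂ s := hdiv s hs
    have hbb : 8 * |α s| * |b| + 4 * |dy m s| * |b'| ≤ max N₁ 0 * (|dx φ s| + |dy φ s|) := by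
      have h1 : |b| ≤ (1 + |k s|) * (|dx φ s| + |dy φ s|) := by
        have := abs_add_le (dx φ s) (k s * dy φ s)
        rw [abs_mul] at this
        nlinarith [abs_nonneg (k s), abs_nonneg (dx φ s), abs_nonneg (dy φ s),
          mul_nonneg (abs_nonneg (k s)) (abs_nonneg (dx φ s))]
      have h2 : |b'| ≤ |m s| * (|dx φ s| + |dy φ s|) := by
        rw [hb', abs_mul]
        exact mul_le_mul_of_nonneg_left (by linarith [abs_nonneg (dx φ s)]) (abs_nonneg _)
      have h3 := (le_abs_self _).trans (hN₁ s hs)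
      calc 8 * |α s| * |b| + 4 * |dy m s| * |b'|
          ≤ 8 * |α s| * ((1 + |k s|) * (|dx φ s| + |dy φ s|)) +
            4 * |dy m s| * (|m s| * (|dx φ s| + |dy φ s|)) := by gcongr
        _ = (8 * |α s| * (1 + |k s|) + 4 * |dy m s| * |m s|) * (|dx φ s| + |dy φ s|) := by ring
        _ ≤ max N₁ 0 * (|dx φ s| + |dy φ s|) :=
            mul_le_mul_of_nonneg_right (h3.trans (le_max_left _ _)) hG0
    have herr := carleman_pointwise (p := p s) (q := q s) (p₁ := dx p s) (p₂ := dy p s) (k := k s)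
      (m₁ := dx m s) (m₂ := dy m s) (b := b) (b' := b') (τ := τ) (N₀ := max N₀ 0)
      (N₁ := max N₁ 0) (G := |dx φ s| + |dy φ s|) (A := A s) (B := B s) (C := C) (D := D)
      hτ0.le (hm0 s) rfl (by rw [hBs, hD]; ring) (by rw [hAs, hC]; ring)
      (((le_abs_self _).trans (hN₀ s hs)).trans (le_max_left _ _)) hbb
      (mul_nonneg (le_max_right _ _) hG0) (le_max_right _ _)
    have hr0 : 0 ≤ p s ^ 2 + q s ^ 2 := by positivity
    have hw' : τ * (max N₁ 0 * (|dx φ s| + |dy φ s|) + c) * (p s ^ 2 + q s ^ 2) ≤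
        τ * (dx V₁ s + dy V₂ s) * (p s ^ 2 + q s ^ 2) :=
      mul_le_mul_of_nonneg_right (mul_le_mul_of_nonneg_left hw hτ0.le) hr0
    have hc' : 2 * max N₀ 0 * (p s ^ 2 + q s ^ 2) ≤ τ * c * (p s ^ 2 + q s ^ 2) :=
      mul_le_mul_of_nonneg_right hτc hr0
    linarith [sq_nonneg C, sq_nonneg D]
  have cc : ∀ {f : ℂ → ℝ}, Continuous f → (∀ s ∉ K, f s = 0) → Integrable f := fun hf h0 =>
    hf.integrable_of_hasCompactSupport (HasCompactSupport.intro hK h0)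
  have hAc : Continuous A := by
    have := (contDiff_dx hP).continuous; have := (contDiff_dy hP).continuous
    have := (contDiff_dy hQ).continuous; have := se.continuous
    rw [hA]; fun_prop
  have hBc : Continuous B := by
    have := (contDiff_dx hQ).continuous; have := (contDiff_dy hP).continuous
    have := (contDiff_dy hQ).continuous; have := se.continuous
    rw [hB]; fun_prop
  have iAB : Integrable (fun s => A s ^ 2 + B s ^ 2) := cc (by fun_prop) fun s hs => by
    simp [hA, hB, off hP0 s hs, off hQ0 s hs]
  have ipq : Integrable (fun s => p s ^ 2 + q s ^ 2) := by
    have := sp.continuous; have := sq.continuous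
    exact cc (by fun_prop) fun s hs => by simp [p0 s hs, q0 s hs]
  have iZ : Integrable (fun s => dx Z₁ s + dy Z₂ s) := by
    have := (contDiff_dx sZ₁).continuous; have := (contDiff_dy sZ₂).continuous
    refine cc (by fun_prop) fun s hs => ?_
    rw [(off (f := Z₁) (fun s hs => by simp [hZ₁, hr, hmq, p0 s hs, q0 s hs]) s hs).1,
      (off (f := Z₂) (fun s hs => by simp [hZ₂, hr, hmq, p0 s hs, q0 s hs]) s hs).2, add_zero]
  have hint := integral_mono (iZ.add (ipq.const_mul (c * τ / 2))) (iAB.const_mul (3 / 2)) hpt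
  have hsplit := integral_add iZ (ipq.const_mul (c * τ / 2))
  simp only [Pi.add_apply] at hint
  rw [hsplit, integral_divergence_eq_zero sZ₁ sZ₂ cZ₁ cZ₂, integral_const_mul,
    integral_const_mul] at hint
  have ee : ∀ s, Real.exp (2 * τ * φ s) = e s ^ 2 := fun s => by
    rw [he, ← Real.exp_nat_mul]; congr 1; push_cast; ring
  have f1 : (fun s => Real.exp (2 * τ * φ s) * (P s ^ 2 + Q s ^ 2)) =
      fun s => p s ^ 2 + q s ^ 2 := by
    funext s; rw [ee, hp, hq]; ring
  have f2 : (fun s => Real.exp (2 * τ * φ s) * ((dx P s + k s * dy P s - m s * dy Q s) ^ 2 +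
      (dx Q s + k s * dy Q s + m s * dy P s) ^ 2)) = fun s => A s ^ 2 + B s ^ 2 := by
    funext s; rw [ee, hA, hB]; ring
  rw [f1, f2]
  linarith

end HypTranslator

namespace HypTranslator

open MeasureTheory

/-- The radial weight `exp (-l |s - a|²)`. -/
noncomputable def gaussWeight (a : ℂ) (l : ℝ) (s : ℂ) : ℝ :=
  Real.exp (-l * ((s.re - a.re) * (s.re - a.re) + (s.im - a.im) * (s.im - a.im)))

theorem gaussWeight_eq (a : ℂ) (l : ℝ) (s : ℂ) :
    gaussWeight a l s = Real.exp (-l * ‖s - a‖ ^ 2) := by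
  rw [gaussWeight, Complex.sq_norm, Complex.normSq_apply]; simp

theorem contDiff_re : ContDiff ℝ ∞ (fun s : ℂ => s.re) := Complex.reCLM.contDiff

theorem contDiff_im : ContDiff ℝ ∞ (fun s : ℂ => s.im) := Complex.imCLM.contDiff

theorem contDiff_gaussWeight (a : ℂ) (l : ℝ) : ContDiff ℝ ∞ (gaussWeight a l) := by
  have h1 : ContDiff ℝ ∞ (fun s : ℂ => s.re - a.re) := contDiff_re.sub contDiff_const
  have h2 : ContDiff ℝ ∞ (fun s : ℂ => s.im - a.im) := contDiff_im.sub contDiff_const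
  exact (contDiff_const.mul ((h1.mul h1).add (h2.mul h2))).exp

@[fun_prop]
theorem differentiableAt_re (s : ℂ) : DifferentiableAt ℝ (fun s : ℂ => s.re) s :=
  contDiff_re.differentiable (by simp) s

@[fun_prop]
theorem differentiableAt_im (s : ℂ) : DifferentiableAt ℝ (fun s : ℂ => s.im) s :=
  contDiff_im.differentiable (by simp) s

theorem dx_gaussWeight (a : ℂ) (l : ℝ) (s : ℂ) :
    dx (gaussWeight a l) s = -2 * l * ((s.re - a.re) * gaussWeight a l s) := by
  unfold gaussWeight
  simp (disch := fun_prop) only [dx_exp, dx_mul, dx_add, dx_sub, dx_const, dx_re, dx_im]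
  ring

theorem dy_gaussWeight (a : ℂ) (l : ℝ) (s : ℂ) :
    dy (gaussWeight a l) s = -2 * l * ((s.im - a.im) * gaussWeight a l s) := by
  unfold gaussWeight
  simp (disch := fun_prop) only [dy_exp, dy_mul, dy_add, dy_sub, dy_const, dy_re, dy_im]
  ring

theorem dx_dx_gaussWeight (a : ℂ) (l : ℝ) (s : ℂ) :
    dx (dx (gaussWeight a l)) s =
      (4 * l ^ 2 * (s.re - a.re) ^ 2 - 2 * l) * gaussWeight a l s := by
  have hg := (contDiff_gaussWeight a l).differentiable (by simp) s
  rw [show dx (gaussWeight a l) = _ from funext (dx_gaussWeight a l)]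
  simp (disch := fun_prop) only [dx_mul, dx_sub, dx_const, dx_re, dx_gaussWeight]
  ring

theorem dy_dx_gaussWeight (a : ℂ) (l : ℝ) (s : ℂ) :
    dy (dx (gaussWeight a l)) s =
      4 * l ^ 2 * ((s.re - a.re) * (s.im - a.im)) * gaussWeight a l s := by
  have hg := (contDiff_gaussWeight a l).differentiable (by simp) s
  rw [show dx (gaussWeight a l) = _ from funext (dx_gaussWeight a l)]
  simp (disch := fun_prop) only [dy_mul, dy_sub, dy_const, dy_re, dy_gaussWeight]
  ring

theorem dy_dy_gaussWeight (a : ℂ) (l : ℝ) (s : ℂ) :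
    dy (dy (gaussWeight a l)) s =
      (4 * l ^ 2 * (s.im - a.im) ^ 2 - 2 * l) * gaussWeight a l s := by
  have hg := (contDiff_gaussWeight a l).differentiable (by simp) s
  rw [show dy (gaussWeight a l) = _ from funext (dy_gaussWeight a l)]
  simp (disch := fun_prop) only [dy_mul, dy_sub, dy_const, dy_im, dy_gaussWeight]
  ring

/-- The explicit form of the divergence governing the Carleman estimate for `exp (-l |s - a|²)`. -/
theorem weightDiv_gaussWeight {k m : ℂ → ℝ} {s : ℂ} (dk : DifferentiableAt ℝ k s)
    (dm : DifferentiableAt ℝ m s) (a : ℂ) (l : ℝ) :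
    weightDiv k m (gaussWeight a l) s = gaussWeight a l s * l *
      (8 * l * (((s.re - a.re) + k s * (s.im - a.im)) ^ 2 + (m s * (s.im - a.im)) ^ 2) -
        4 * (1 + k s ^ 2 + m s ^ 2) - 4 * (dy k s * (s.re - a.re) +
          (dx k s + 2 * k s * dy k s + 2 * m s * dy m s) * (s.im - a.im))) := by
  have hd := contDiff_gaussWeight a l
  have d1 := (contDiff_dx hd).differentiable (by simp) s
  have d2 := (contDiff_dy hd).differentiable (by simp) s
  have hsq : (fun s => 2 * (k s * dx (gaussWeight a l) s +
      (k s ^ 2 + m s ^ 2) * dy (gaussWeight a l) s)) =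
      fun s => 2 * (k s * dx (gaussWeight a l) s +
        (k s * k s + m s * m s) * dy (gaussWeight a l) s) := by
    funext s; ring
  rw [weightDiv, hsq]
  simp (disch := fun_prop) only [dx_mul, dx_add, dx_const, dy_mul, dy_add, dy_const]
  rw [← dx_dy_comm hd.contDiffAt, dx_dx_gaussWeight, dy_dx_gaussWeight,
    dy_dy_gaussWeight, dx_gaussWeight, dy_gaussWeight]
  ring

set_option maxHeartbeats 800000 in
/-- On an annulus, for `l` large, the second derivatives of the weight `exp (-l |s - a|²)` dominate
its first derivatives: the former are of order `l²`, the latter of order `l`. -/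
theorem exists_gaussWeight {k m : ℂ → ℝ} (hk : ContDiff ℝ ∞ k) (hm : ContDiff ℝ ∞ m)
    (hm0 : ∀ s, 0 < m s) (a : ℂ) {r₀ : ℝ} (hr₀ : 0 < r₀) (r₂ N : ℝ) :
    ∃ l > 0, ∃ c > 0, ∀ s ∈ Metric.closedBall a r₂ \ Metric.ball a r₀,
      N * (|dx (gaussWeight a l) s| + |dy (gaussWeight a l) s|) + c ≤
        weightDiv k m (gaussWeight a l) s := by
  have ck := hk.continuous
  have cm := hm.continuous
  have ck1 := (contDiff_dx hk).continuous
  have ck2 := (contDiff_dy hk).continuous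
  have cm2 := (contDiff_dy hm).continuous
  set K : Set ℂ := Metric.closedBall a r₂ \ Metric.ball a r₀ with hKdef
  have hK : IsCompact K := (isCompact_closedBall a r₂).diff Metric.isOpen_ball
  have cx : Continuous (fun s : ℂ => s.re - a.re) := by fun_prop
  have cy : Continuous (fun s : ℂ => s.im - a.im) := by fun_prop
  rcases K.eq_empty_or_nonempty with he | hne
  · exact ⟨1, one_pos, 1, one_pos, fun s hs => by rw [he] at hs; exact hs.elim⟩
  obtain ⟨s₀, hs₀, hmin⟩ := hK.exists_isMinOn hne
    (f := fun s => ((s.re - a.re) + k s * (s.im - a.im)) ^ 2 + (m s * (s.im - a.im)) ^ 2)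
    (by fun_prop)
  set c₀ := ((s₀.re - a.re) + k s₀ * (s₀.im - a.im)) ^ 2 + (m s₀ * (s₀.im - a.im)) ^ 2 with hc₀
  have hc₀pos : 0 < c₀ := by
    rcases eq_or_ne (s₀.im - a.im) 0 with h | h
    · have : s₀.re - a.re ≠ 0 := by
        intro h'
        apply hs₀.2
        have : s₀ = a := Complex.ext (by linarith) (by linarith)
        simpa [this] using hr₀
      rw [hc₀, h]
      have : 0 < (s₀.re - a.re) ^ 2 := by positivity
      nlinarith
    · have := hm0 s₀
      have : 0 < (m s₀ * (s₀.im - a.im)) ^ 2 := by positivity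
      rw [hc₀]; positivity
  obtain ⟨C, hC⟩ := hK.exists_bound_of_continuousOn
    (f := fun s => |4 * (1 + k s ^ 2 + m s ^ 2)| + |4 * (dy k s * (s.re - a.re) +
      (dx k s + 2 * k s * dy k s + 2 * m s * dy m s) * (s.im - a.im))| +
      2 * |N| * (|s.re - a.re| + |s.im - a.im|)) (by fun_prop)
  have hCpos : 0 ≤ C := (norm_nonneg _).trans (hC s₀ hs₀)
  refine ⟨(C + 1) / (8 * c₀), by positivity, ?_⟩
  set l := (C + 1) / (8 * c₀) with hl
  have hlpos : 0 < l := by positivity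
  have hlc : 8 * l * c₀ = C + 1 := by rw [hl]; field_simp
  refine ⟨Real.exp (-l * r₂ ^ 2) * l, by positivity, fun s hs => ?_⟩
  set G := gaussWeight a l s with hG
  have hGpos : 0 < G := Real.exp_pos _
  set x := s.re - a.re with hx
  set y := s.im - a.im with hy
  have hdiv := weightDiv_gaussWeight (hk.differentiable (by simp) s)
    (hm.differentiable (by simp) s) a l
  rw [hdiv, dx_gaussWeight, dy_gaussWeight, ← hx, ← hy, ← hG]
  have habs : |-2 * l * (x * G)| + |-2 * l * (y * G)| = G * l * (2 * (|x| + |y|)) := by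
    simp only [abs_mul, abs_neg, abs_of_pos hlpos, abs_of_pos hGpos, abs_two]; ring
  rw [habs]
  have hGl : Real.exp (-l * r₂ ^ 2) ≤ G := by
    rw [hG, gaussWeight_eq]
    apply Real.exp_le_exp.2
    have h1 : ‖s - a‖ ≤ r₂ := by simpa [dist_eq_norm] using hs.1
    have h2 : ‖s - a‖ ^ 2 ≤ r₂ ^ 2 := by gcongr
    nlinarith
  have hq : c₀ ≤ (x + k s * y) ^ 2 + (m s * y) ^ 2 := hmin hs
  have hq' : 8 * l * c₀ ≤ 8 * l * ((x + k s * y) ^ 2 + (m s * y) ^ 2) :=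
    mul_le_mul_of_nonneg_left hq (by positivity)
  have hb := (le_abs_self _).trans (hC s hs)
  have hN : N * (2 * (|x| + |y|)) ≤ 2 * |N| * (|x| + |y|) := by
    have := le_abs_self N
    nlinarith [abs_nonneg x, abs_nonneg y]
  have hfin : N * (2 * (|x| + |y|)) + 1 ≤
      8 * l * ((x + k s * y) ^ 2 + (m s * y) ^ 2) - 4 * (1 + k s ^ 2 + m s ^ 2) -
        4 * (dy k s * x + (dx k s + 2 * k s * dy k s + 2 * m s * dy m s) * y) := by
    have h1 := le_abs_self (4 * (1 + k s ^ 2 + m s ^ 2))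
    have h2 := le_abs_self (4 * (dy k s * x + (dx k s + 2 * k s * dy k s + 2 * m s * dy m s) * y))
    linarith
  have hGl0 : 0 ≤ G * l := by positivity
  calc N * (G * l * (2 * (|x| + |y|))) + Real.exp (-l * r₂ ^ 2) * l
      ≤ N * (G * l * (2 * (|x| + |y|))) + G * l := by gcongr
    _ = G * l * (N * (2 * (|x| + |y|)) + 1) := by ring
    _ ≤ _ := mul_le_mul_of_nonneg_left hfin hGl0

end HypTranslator

namespace HypTranslator

open MeasureTheory

/-! ### Unique continuation for second order elliptic differential inequalities -/

/-- With `v = (∂₁ + (k - i m) ∂₂) w`, the operator `∂₁ + (k + i m) ∂₂` applied to `v` is the second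
order operator applied to `w` plus a term of first order. -/
theorem firstOrder_comp {k m w : ℂ → ℝ} (hk : ContDiff ℝ ∞ k) (hm : ContDiff ℝ ∞ m)
    (hw : ContDiff ℝ ∞ w) (s : ℂ) :
    (dx (fun s => dx w s + k s * dy w s) s + k s * dy (fun s => dx w s + k s * dy w s) s -
        m s * dy (fun s => (-1) * (m s * dy w s)) s =
      dx (dx w) s + 2 * k s * dx (dy w) s + (k s ^ 2 + m s ^ 2) * dy (dy w) s +
        (dx k s + k s * dy k s + m s * dy m s) * dy w s) ∧
    (dx (fun s => (-1) * (m s * dy w s)) s + k s * dy (fun s => (-1) * (m s * dy w s)) s +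
        m s * dy (fun s => dx w s + k s * dy w s) s =
      (m s * dy k s - dx m s - k s * dy m s) * dy w s) := by
  have d1 := (contDiff_dx hw).differentiable (by simp) s
  have d2 := (contDiff_dy hw).differentiable (by simp) s
  have dk := hk.differentiable (by simp) s
  have dm := hm.differentiable (by simp) s
  simp (disch := fun_prop) only [dx_mul, dx_add, dx_const, dy_mul, dy_add, dy_const]
  rw [dx_dy_comm hw.contDiffAt]
  constructor <;> ring

theorem firstOrder_bound {k m w : ℂ → ℝ} (hk : ContDiff ℝ ∞ k) (hm : ContDiff ℝ ∞ m)
    (hm0 : ∀ s, 0 < m s) (hw : ContDiff ℝ ∞ w) {K : Set ℂ} (hK : IsCompact K) {C : ℝ}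
    (hC : ∀ s ∈ K, |dx (dx w) s + 2 * k s * dx (dy w) s + (k s ^ 2 + m s ^ 2) * dy (dy w) s| ≤
      C * (|w s| + |dx w s| + |dy w s|)) :
    ∃ C₁, 0 ≤ C₁ ∧ ∀ s ∈ K,
      (dx (fun s => dx w s + k s * dy w s) s + k s * dy (fun s => dx w s + k s * dy w s) s -
        m s * dy (fun s => (-1) * (m s * dy w s)) s) ^ 2 +
      (dx (fun s => (-1) * (m s * dy w s)) s + k s * dy (fun s => (-1) * (m s * dy w s)) s +
        m s * dy (fun s => dx w s + k s * dy w s) s) ^ 2 ≤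
      C₁ * (w s ^ 2 + (dx w s + k s * dy w s) ^ 2 + ((-1) * (m s * dy w s)) ^ 2) := by
  have ck := hk.continuous
  have cm := hm.continuous
  have ck1 := (contDiff_dx hk).continuous
  have ck2 := (contDiff_dy hk).continuous
  have cm1 := (contDiff_dx hm).continuous
  have cm2 := (contDiff_dy hm).continuous
  have cmi : Continuous (fun s => (m s)⁻¹) := cm.inv₀ fun s => (hm0 s).ne'
  obtain ⟨M, hM⟩ := hK.exists_bound_of_continuousOn (f := fun s =>
    |dx k s + k s * dy k s + m s * dy m s| + |m s * dy k s - dx m s - k s * dy m s| +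
      |(m s)⁻¹| + |k s|) (by fun_prop)
  refine ⟨(|C| * (2 + |M| * |M| + |M|) + |M| * |M|) ^ 2 + (|M| * |M|) ^ 2, by positivity,
    fun s hs => ?_⟩
  obtain ⟨e1, e2⟩ := firstOrder_comp hk hm hw s
  rw [e1, e2]
  have hMs := ((le_abs_self _).trans (hM s hs)).trans (le_abs_self M)
  set v₁ := dx w s + k s * dy w s with hv₁
  set v₂ := (-1) * (m s * dy w s) with hv₂
  set S := w s ^ 2 + v₁ ^ 2 + v₂ ^ 2 with hS
  have a1 := abs_nonneg (dx k s + k s * dy k s + m s * dy m s)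
  have a2 := abs_nonneg (m s * dy k s - dx m s - k s * dy m s)
  have a3 := abs_nonneg (m s)⁻¹
  have a4 := abs_nonneg (k s)
  have aM := abs_nonneg M
  have b0 : |w s| ≤ √S := Real.abs_le_sqrt (by rw [hS]; nlinarith [sq_nonneg v₁, sq_nonneg v₂])
  have b1 : |v₁| ≤ √S := Real.abs_le_sqrt (by rw [hS]; nlinarith [sq_nonneg (w s), sq_nonneg v₂])
  have b2 : |v₂| ≤ √S := Real.abs_le_sqrt (by rw [hS]; nlinarith [sq_nonneg v₁, sq_nonneg (w s)])
  have hSS : √S ^ 2 = S := Real.sq_sqrt (by rw [hS]; positivity)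
  have hS0 := Real.sqrt_nonneg S
  set T := √S with hT
  have c2 : |dy w s| ≤ |M| * T := by
    have : dy w s = -((m s)⁻¹ * v₂) := by
      rw [hv₂]; field_simp [(hm0 s).ne']
    rw [this, abs_neg, abs_mul]
    exact mul_le_mul (by linarith) b2 (abs_nonneg _) aM
  have c1 : |dx w s| ≤ T + |M| * (|M| * T) := by
    have : dx w s = v₁ - k s * dy w s := by rw [hv₁]; ring
    rw [this]
    refine (abs_sub _ _).trans (add_le_add b1 ?_)
    rw [abs_mul]
    exact mul_le_mul (by linarith) c2 (abs_nonneg _) aM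
  have d1 : |dx (dx w) s + 2 * k s * dx (dy w) s + (k s ^ 2 + m s ^ 2) * dy (dy w) s +
      (dx k s + k s * dy k s + m s * dy m s) * dy w s| ≤
      (|C| * (2 + |M| * |M| + |M|) + |M| * |M|) * T := by
    refine (abs_add_le _ _).trans ?_
    have h1 := hC s hs
    have h2 : C * (|w s| + |dx w s| + |dy w s|) ≤ |C| * (T + (T + |M| * (|M| * T)) + |M| * T) :=
      mul_le_mul (le_abs_self C) (by linarith) (by positivity) (abs_nonneg C)
    have h3 : |(dx k s + k s * dy k s + m s * dy m s) * dy w s| ≤ |M| * (|M| * T) := by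
      rw [abs_mul]
      exact mul_le_mul (by linarith) c2 (abs_nonneg _) aM
    linarith
  have d2 : |(m s * dy k s - dx m s - k s * dy m s) * dy w s| ≤ |M| * |M| * T := by
    rw [abs_mul, mul_assoc]
    exact mul_le_mul (by linarith) c2 (abs_nonneg _) aM
  have s1 := sq_le_sq' (abs_le.1 d1).1 (abs_le.1 d1).2
  have s2 := sq_le_sq' (abs_le.1 d2).1 (abs_le.1 d2).2
  rw [mul_pow _ T, hSS] at s1 s2
  linarith

/-- Pointwise effect of a cutoff `χ` on the three first order expressions in the Carleman
estimates. -/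
theorem cutoff_pointwise (x x₁ x₂ k m w w₂ e₁ e₂ v₁ v₂ C : ℝ)
    (hv₂ : v₂ = (-1) * (m * w₂))
    (he : e₁ ^ 2 + e₂ ^ 2 ≤ C * (w ^ 2 + v₁ ^ 2 + v₂ ^ 2)) :
    (x * e₁ + ((x₁ + k * x₂) * v₁ - m * x₂ * v₂)) ^ 2 +
      (x * e₂ + ((x₁ + k * x₂) * v₂ + m * x₂ * v₁)) ^ 2 +
      ((x * v₁ + (x₁ + k * x₂) * w) ^ 2 + (x * (m * w₂) + m * x₂ * w) ^ 2) ≤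
    2 * (C + 1) * (x ^ 2 * (w ^ 2 + v₁ ^ 2 + v₂ ^ 2)) +
      2 * (((x₁ + k * x₂) * v₁ - m * x₂ * v₂) ^ 2 + ((x₁ + k * x₂) * v₂ + m * x₂ * v₁) ^ 2 +
        ((x₁ + k * x₂) * w) ^ 2 + (m * x₂ * w) ^ 2) := by
  have h : x ^ 2 * (e₁ ^ 2 + e₂ ^ 2) ≤ x ^ 2 * (C * (w ^ 2 + v₁ ^ 2 + v₂ ^ 2)) :=
    mul_le_mul_of_nonneg_left he (by positivity)
  have hm : m * w₂ = -v₂ := by rw [hv₂]; ring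
  rw [hm]
  have two : ∀ a b : ℝ, (a + b) ^ 2 ≤ 2 * a ^ 2 + 2 * b ^ 2 := fun a b => by
    nlinarith [sq_nonneg (a - b)]
  have t1 := two (x * e₁) ((x₁ + k * x₂) * v₁ - m * x₂ * v₂)
  have t2 := two (x * e₂) ((x₁ + k * x₂) * v₂ + m * x₂ * v₁)
  have t3 := two (x * v₁) ((x₁ + k * x₂) * w)
  have t4 := two (x * -v₂) (m * x₂ * w)
  have t5 : 0 ≤ 2 * (x ^ 2 * w ^ 2) := by positivity
  linear_combination t1 + t2 + t3 + t4 + 2 * h + t5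

set_option maxHeartbeats 800000 in
/-- Unique continuation from a small disc to a larger one, for the normalized operator
`∂₁₁ + 2 k ∂₁₂ + (k² + m²) ∂₂₂`. The Carleman estimate is applied to cutoffs of `w` and of
`v = (∂₁ + (k - i m) ∂₂) w`; the errors from the cutoff sit outside the disc of radius `r₁`, where
the weight is smaller, and disappear as `τ → ∞`. -/
theorem eq_zero_of_vanish_near {k m w : ℂ → ℝ} (hk : ContDiff ℝ ∞ k) (hm : ContDiff ℝ ∞ m)
    (hm0 : ∀ s, 0 < m s) (hw : ContDiff ℝ ∞ w) {a : ℂ} {r₀ r₁ r₂ C : ℝ} (hr₀ : 0 < r₀)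
    (hr₁ : 0 < r₁) (hr₂ : r₁ < r₂)
    (hC : ∀ s ∈ Metric.closedBall a r₂,
      |dx (dx w) s + 2 * k s * dx (dy w) s + (k s ^ 2 + m s ^ 2) * dy (dy w) s| ≤
        C * (|w s| + |dx w s| + |dy w s|))
    (h0 : ∀ s ∈ Metric.ball a r₀, w s = 0) : ∀ s ∈ Metric.ball a r₁, w s = 0 := by
  obtain ⟨C₁, hC₁0, hC₁⟩ := firstOrder_bound hk hm hm0 hw (isCompact_closedBall a r₂) hC
  set v₁ : ℂ → ℝ := fun s => dx w s + k s * dy w s with hv₁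
  set v₂ : ℂ → ℝ := fun s => (-1) * (m s * dy w s) with hv₂
  have sw1 := contDiff_dx hw
  have sw2 := contDiff_dy hw
  have sv₁ : ContDiff ℝ ∞ v₁ := sw1.add (hk.mul sw2)
  have sv₂ : ContDiff ℝ ∞ v₂ := contDiff_const.mul (hm.mul sw2)
  let f : ContDiffBump a := ⟨r₁, r₂, hr₁, hr₂⟩
  set χ : ℂ → ℝ := fun s => f s with hχ
  have sχ : ContDiff ℝ ∞ χ := f.contDiff
  have χ1 : ∀ s ∈ Metric.closedBall a r₁, χ s = 1 := fun s hs => f.one_of_mem_closedBall hs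
  have χ0 : ∀ s, s ∉ Metric.ball a r₂ → χ s = 0 := fun s hs => by
    refine f.zero_of_le_dist ?_
    simpa [Metric.mem_ball] using hs
  set K : Set ℂ := Metric.closedBall a r₂ \ Metric.ball a r₀ with hKdef
  have hK : IsCompact K := (isCompact_closedBall a r₂).diff Metric.isOpen_ball
  have off : ∀ {g : ℂ → ℝ}, (∀ s ∈ Metric.ball a r₀, g s = 0) → ∀ s ∉ K, χ s * g s = 0 := by
    intro g hg s hs
    by_cases h : s ∈ Metric.ball a r₀
    · rw [hg s h, mul_zero]
    · rw [χ0 s fun h' => hs ⟨Metric.ball_subset_closedBall h', h⟩, zero_mul]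
  have hder : ∀ s ∈ Metric.ball a r₀, dx w s = 0 ∧ dy w s = 0 := by
    intro s hs
    have : w =ᶠ[𝓝 s] fun _ => 0 := by
      filter_upwards [Metric.isOpen_ball.mem_nhds hs] with t ht using h0 t ht
    rw [dx_congr this, dy_congr this]
    exact ⟨dx_const 0, dy_const 0⟩
  have hv₁0 : ∀ s ∈ Metric.ball a r₀, v₁ s = 0 := fun s hs => by
    simp [hv₁, (hder s hs).1, (hder s hs).2]
  have hv₂0 : ∀ s ∈ Metric.ball a r₀, v₂ s = 0 := fun s hs => by
    simp [hv₂, (hder s hs).2]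
  obtain ⟨N, hN0, hN⟩ := carleman_of_weight hk hm hm0 hK
  obtain ⟨l, hl, c, hc, hweight⟩ := exists_gaussWeight hk hm hm0 a hr₀ r₂ N
  set φ := gaussWeight a l with hφ
  obtain ⟨τ₀, hτ₀, hcarl⟩ := hN φ (contDiff_gaussWeight a l) c hc hweight
  set R : ℂ → ℝ := fun s => 2 * (((dx χ s + k s * dy χ s) * v₁ s - m s * dy χ s * v₂ s) ^ 2 +
    ((dx χ s + k s * dy χ s) * v₂ s + m s * dy χ s * v₁ s) ^ 2 +
    ((dx χ s + k s * dy χ s) * w s) ^ 2 + (m s * dy χ s * w s) ^ 2) with hR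
  set S : ℂ → ℝ := fun s => w s ^ 2 + v₁ s ^ 2 + v₂ s ^ 2 with hS
  have ck := hk.continuous
  have cm := hm.continuous
  have cw := hw.continuous
  have cv₁ := sv₁.continuous
  have cv₂ := sv₂.continuous
  have cχ := sχ.continuous
  have cχ1 := (contDiff_dx sχ).continuous
  have cχ2 := (contDiff_dy sχ).continuous
  have cR : Continuous R := by rw [hR]; fun_prop
  have cφ : Continuous φ := (contDiff_gaussWeight a l).continuous
  -- the derivatives of the cutoff live between the circles of radii `r₁` and `r₂`
  have dχ_in : ∀ s ∈ Metric.ball a r₁, dx χ s = 0 ∧ dy χ s = 0 := by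
    intro s hs
    have : χ =ᶠ[𝓝 s] fun _ => 1 := by
      filter_upwards [Metric.isOpen_ball.mem_nhds hs] with t ht using
        χ1 t (Metric.ball_subset_closedBall ht)
    rw [dx_congr this, dy_congr this]
    exact ⟨dx_const 1, dy_const 1⟩
  have dχ_out : ∀ s ∉ Metric.closedBall a r₂, dx χ s = 0 ∧ dy χ s = 0 := by
    intro s hs
    have : χ =ᶠ[𝓝 s] fun _ => 0 := by
      filter_upwards [Metric.isClosed_closedBall.isOpen_compl.mem_nhds hs] with t ht using
        χ0 t fun h => ht (Metric.ball_subset_closedBall h)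
    rw [dx_congr this, dy_congr this]
    exact ⟨dx_const 0, dy_const 0⟩
  have R_in : ∀ s ∈ Metric.ball a r₁, R s = 0 := fun s hs => by
    simp [hR, (dχ_in s hs).1, (dχ_in s hs).2]
  have R_out : ∀ s ∉ Metric.closedBall a r₂, R s = 0 := fun s hs => by
    simp [hR, (dχ_out s hs).1, (dχ_out s hs).2]
  have R_nonneg : ∀ s, 0 ≤ R s := fun s => by rw [hR]; positivity
  have cc : ∀ {g : ℂ → ℝ}, Continuous g → (∀ s ∉ Metric.closedBall a r₂, g s = 0) →
      Integrable g := fun hg hg0 =>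
    hg.integrable_of_hasCompactSupport (HasCompactSupport.intro (isCompact_closedBall a r₂) hg0)
  have χout : ∀ s ∉ Metric.closedBall a r₂, χ s = 0 := fun s hs =>
    χ0 s fun h => hs (Metric.ball_subset_closedBall h)
  have iR : Integrable R := cc cR R_out
  set φ₁ := Real.exp (-l * r₁ ^ 2) with hφ₁
  set J := ∫ s in Metric.ball a r₁, w s ^ 2 with hJ
  have main : ∀ τ ≥ τ₀, 12 * (C₁ + 1) ≤ c * τ → c * τ * J ≤ 6 * ∫ s, R s := by
    intro τ hτ hτ'
    have hτ0 : 0 < τ := hτ₀.trans_le hτ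
    have z0 : ∀ s ∉ K, (fun _ : ℂ => (0 : ℝ)) s = 0 := fun _ _ => rfl
    have h1 := hcarl τ hτ (fun s => χ s * v₁ s) (fun s => χ s * v₂ s) (sχ.mul sv₁) (sχ.mul sv₂)
      (off hv₁0) (off hv₂0)
    have h2 := hcarl τ hτ (fun s => χ s * w s) (fun _ => 0) (sχ.mul hw) contDiff_const
      (off h0) z0
    set E : ℂ → ℝ := fun s => Real.exp (2 * τ * φ s) with hE
    have cE : Continuous E := by rw [hE]; fun_prop
    have E0 : ∀ s, 0 < E s := fun s => Real.exp_pos _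
    have dd : ∀ {g : ℂ → ℝ}, ContDiff ℝ ∞ g → ∀ s, DifferentiableAt ℝ g s :=
      fun hg s => hg.differentiable (by simp) s
    have g1 : (fun s => E s * ((dx (fun s => χ s * v₁ s) s + k s * dy (fun s => χ s * v₁ s) s -
        m s * dy (fun s => χ s * v₂ s) s) ^ 2 + (dx (fun s => χ s * v₂ s) s +
        k s * dy (fun s => χ s * v₂ s) s + m s * dy (fun s => χ s * v₁ s) s) ^ 2)) =
        fun s => E s * ((χ s * (dx v₁ s + k s * dy v₁ s - m s * dy v₂ s) +
          ((dx χ s + k s * dy χ s) * v₁ s - m s * dy χ s * v₂ s)) ^ 2 +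
          (χ s * (dx v₂ s + k s * dy v₂ s + m s * dy v₁ s) +
          ((dx χ s + k s * dy χ s) * v₂ s + m s * dy χ s * v₁ s)) ^ 2) := by
      funext s
      rw [dx_mul (dd sχ s) (dd sv₁ s), dy_mul (dd sχ s) (dd sv₁ s), dx_mul (dd sχ s) (dd sv₂ s),
        dy_mul (dd sχ s) (dd sv₂ s)]
      ring
    have g2 : (fun s => E s * ((dx (fun s => χ s * w s) s + k s * dy (fun s => χ s * w s) s -
        m s * dy (fun _ => (0 : ℝ)) s) ^ 2 + (dx (fun _ => (0 : ℝ)) s +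
        k s * dy (fun _ => (0 : ℝ)) s + m s * dy (fun s => χ s * w s) s) ^ 2)) =
        fun s => E s * ((χ s * v₁ s + (dx χ s + k s * dy χ s) * w s) ^ 2 +
          (χ s * (m s * dy w s) + m s * dy χ s * w s) ^ 2) := by
      funext s
      rw [dx_mul (dd sχ s) (dd hw s), dy_mul (dd sχ s) (dd hw s), dx_const, dy_const, hv₁]
      ring
    rw [g1] at h1
    rw [g2] at h2
    have cdv1 := (contDiff_dx sv₁).continuous
    have cdv2 := (contDiff_dx sv₂).continuous
    have cdv3 := (contDiff_dy sv₁).continuous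
    have cdv4 := (contDiff_dy sv₂).continuous
    have cdw2 := sw2.continuous
    have i1 : Integrable (fun s => E s * ((χ s * (dx v₁ s + k s * dy v₁ s - m s * dy v₂ s) +
          ((dx χ s + k s * dy χ s) * v₁ s - m s * dy χ s * v₂ s)) ^ 2 +
          (χ s * (dx v₂ s + k s * dy v₂ s + m s * dy v₁ s) +
          ((dx χ s + k s * dy χ s) * v₂ s + m s * dy χ s * v₁ s)) ^ 2)) :=
      cc (by fun_prop) fun s hs => by simp [χout s hs, (dχ_out s hs).1, (dχ_out s hs).2]
    have i2 : Integrable (fun s => E s * ((χ s * v₁ s + (dx χ s + k s * dy χ s) * w s) ^ 2 +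
          (χ s * (m s * dy w s) + m s * dy χ s * w s) ^ 2)) :=
      cc (by fun_prop) fun s hs => by simp [χout s hs, (dχ_out s hs).1, (dχ_out s hs).2]
    have i3 : Integrable (fun s => E s * ((χ s * v₁ s) ^ 2 + (χ s * v₂ s) ^ 2)) :=
      cc (by fun_prop) fun s hs => by simp [χout s hs]
    have i4 : Integrable (fun s => E s * ((χ s * w s) ^ 2 + (0 : ℝ) ^ 2)) :=
      cc (by fun_prop) fun s hs => by simp [χout s hs]
    have i5 : Integrable (fun s => E s * (χ s ^ 2 * S s)) :=
      cc (by rw [hS]; fun_prop) fun s hs => by simp [χout s hs]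
    have i6 : Integrable (fun s => E s * R s) := cc (by fun_prop) fun s hs => by simp [R_out s hs]
    have hsumR : (∫ s, E s * ((χ s * (dx v₁ s + k s * dy v₁ s - m s * dy v₂ s) +
          ((dx χ s + k s * dy χ s) * v₁ s - m s * dy χ s * v₂ s)) ^ 2 +
          (χ s * (dx v₂ s + k s * dy v₂ s + m s * dy v₁ s) +
          ((dx χ s + k s * dy χ s) * v₂ s + m s * dy χ s * v₁ s)) ^ 2)) +
        (∫ s, E s * ((χ s * v₁ s + (dx χ s + k s * dy χ s) * w s) ^ 2 +
          (χ s * (m s * dy w s) + m s * dy χ s * w s) ^ 2)) ≤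
        2 * (C₁ + 1) * (∫ s, E s * (χ s ^ 2 * S s)) + ∫ s, E s * R s := by
      rw [← integral_add i1 i2, ← integral_const_mul, ← integral_add (i5.const_mul _) i6]
      refine integral_mono (i1.add i2) ((i5.const_mul _).add i6) fun s => ?_
      by_cases hs : s ∈ Metric.closedBall a r₂
      · have := cutoff_pointwise (χ s) (dx χ s) (dy χ s) (k s) (m s) (w s) (dy w s)
          _ _ (v₁ s) (v₂ s) C₁ rfl (hC₁ s hs)
        have := mul_le_mul_of_nonneg_left this (E0 s).le
        simp only
        rw [hR, hS]
        linarith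
      · simp [χout s hs, (dχ_out s hs).1, (dχ_out s hs).2, R_out s hs]
    have hsumL : (∫ s, E s * ((χ s * v₁ s) ^ 2 + (χ s * v₂ s) ^ 2)) +
        (∫ s, E s * ((χ s * w s) ^ 2 + (0 : ℝ) ^ 2)) = ∫ s, E s * (χ s ^ 2 * S s) := by
      rw [← integral_add i3 i4]
      congr 1; funext s; rw [hS]; ring
    set T := ∫ s, E s * (χ s ^ 2 * S s) with hT
    have hT0 : 0 ≤ T := integral_nonneg fun s => by
      have := E0 s
      have : 0 ≤ S s := by rw [hS]; positivity
      positivity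
    have hTle : c * τ * T ≤ 3 * (2 * (C₁ + 1) * T + ∫ s, E s * R s) := by
      rw [← hsumL, mul_add]
      rw [← hsumL] at hsumR
      linarith
    have hTle' : c * τ * T ≤ 6 * ∫ s, E s * R s := by
      have := mul_le_mul_of_nonneg_right hτ' hT0
      linarith
    have hER : ∫ s, E s * R s ≤ Real.exp (2 * τ * φ₁) * ∫ s, R s := by
      rw [← integral_const_mul]
      refine integral_mono i6 (iR.const_mul _) fun s => ?_
      by_cases hs : s ∈ Metric.ball a r₁
      · simp [R_in s hs]
      · refine mul_le_mul_of_nonneg_right ?_ (R_nonneg s)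
        refine Real.exp_le_exp.2 (mul_le_mul_of_nonneg_left ?_ (by positivity))
        rw [hφ, gaussWeight_eq]
        refine Real.exp_le_exp.2 ?_
        have h1 : r₁ ≤ ‖s - a‖ := by simpa [dist_eq_norm] using hs
        have h2 : r₁ ^ 2 ≤ ‖s - a‖ ^ 2 := by gcongr
        nlinarith
    have hJT : Real.exp (2 * τ * φ₁) * J ≤ T := by
      have hset : ∫ s in Metric.ball a r₁, E s * (χ s ^ 2 * S s) ≤ T :=
        setIntegral_le_integral i5 (Eventually.of_forall fun s => by
          have := E0 s
          have : 0 ≤ S s := by rw [hS]; positivity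
          simp only [Pi.zero_apply]; positivity)
      refine le_trans ?_ hset
      rw [hJ, ← integral_const_mul]
      have iw : IntegrableOn (fun s => w s ^ 2) (Metric.ball a r₁) :=
        ((cw.pow 2).continuousOn.integrableOn_compact (isCompact_closedBall a r₁)).mono_set
          Metric.ball_subset_closedBall
      refine setIntegral_mono_on (iw.const_mul _) i5.integrableOn measurableSet_ball
        fun s hs => ?_
      rw [χ1 s (Metric.ball_subset_closedBall hs), one_pow, one_mul]
      refine mul_le_mul ?_ ?_ (sq_nonneg _) (E0 s).le
      · refine Real.exp_le_exp.2 (mul_le_mul_of_nonneg_left ?_ (by positivity))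
        rw [hφ, gaussWeight_eq]
        refine Real.exp_le_exp.2 ?_
        have h1 : ‖s - a‖ ≤ r₁ := by
          rw [← dist_eq_norm]; exact (Metric.mem_ball.1 hs).le
        have h2 : ‖s - a‖ ^ 2 ≤ r₁ ^ 2 := by gcongr
        nlinarith
      · rw [hS]; nlinarith [sq_nonneg (v₁ s), sq_nonneg (v₂ s)]
    have hpos := Real.exp_pos (2 * τ * φ₁)
    have hcτ : 0 ≤ c * τ := by positivity
    have : Real.exp (2 * τ * φ₁) * (c * τ * J) ≤ Real.exp (2 * τ * φ₁) * (6 * ∫ s, R s) := by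
      have := mul_le_mul_of_nonneg_left hJT hcτ
      linarith
    exact le_of_mul_le_mul_left this hpos
  have hJ0 : 0 ≤ J := setIntegral_nonneg measurableSet_ball fun s _ => sq_nonneg _
  have hJz : J = 0 := by
    by_contra hne
    have hJpos : 0 < J := lt_of_le_of_ne hJ0 (Ne.symm hne)
    set B := 6 * ∫ s, R s with hB
    set τ := max τ₀ (max (12 * (C₁ + 1) / c) ((|B| + 1) / (c * J))) with hτ
    have h1 : 12 * (C₁ + 1) ≤ c * τ := by
      have : 12 * (C₁ + 1) / c ≤ τ := (le_max_left _ _).trans (le_max_right _ _)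
      rw [div_le_iff₀ hc] at this; linarith
    have h2 : |B| + 1 ≤ τ * (c * J) := by
      have : (|B| + 1) / (c * J) ≤ τ := (le_max_right _ _).trans (le_max_right _ _)
      rwa [div_le_iff₀ (by positivity)] at this
    have h3 := main τ (le_max_left _ _) h1
    have h4 := le_abs_self B
    nlinarith
  have iw : IntegrableOn (fun s => w s ^ 2) (Metric.ball a r₁) :=
    ((cw.pow 2).continuousOn.integrableOn_compact (isCompact_closedBall a r₁)).mono_set
      Metric.ball_subset_closedBall
  have hae : (fun s => w s ^ 2) =ᵐ[volume.restrict (Metric.ball a r₁)] 0 :=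
    (setIntegral_eq_zero_iff_of_nonneg_ae (Eventually.of_forall fun s => sq_nonneg _) iw).1 hJz
  have heq := Measure.eqOn_open_of_ae_eq hae Metric.isOpen_ball (cw.pow 2).continuousOn
    continuousOn_const
  intro s hs
  have := heq hs
  simpa using this

end HypTranslator

namespace HypTranslator

theorem eventuallyEq_dx {f g : ℂ → ℝ} {s : ℂ} (h : f =ᶠ[𝓝 s] g) : dx f =ᶠ[𝓝 s] dx g := by
  filter_upwards [h.eventuallyEq_nhds] with t ht using dx_congr ht

theorem eventuallyEq_dy {f g : ℂ → ℝ} {s : ℂ} (h : f =ᶠ[𝓝 s] g) : dy f =ᶠ[𝓝 s] dy g := by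
  filter_upwards [h.eventuallyEq_nhds] with t ht using dy_congr ht

/-- The function `w` satisfies on the disc of center `a` and radius `ρ` the elliptic differential
inequality `|a₁₁ w₁₁ + 2 a₁₂ w₁₂ + a₂₂ w₂₂| ≤ C (|w| + |∇w|)`, with `C` uniform on smaller discs;
the ellipticity constant of the coefficients is normalized to `1`. -/
structure IsEllipticIneq (a₁₁ a₁₂ a₂₂ w : ℂ → ℝ) (a : ℂ) (ρ : ℝ) : Prop where
  smooth₁₁ : ContDiffOn ℝ ∞ a₁₁ (Metric.ball a ρ)
  smooth₁₂ : ContDiffOn ℝ ∞ a₁₂ (Metric.ball a ρ)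
  smooth₂₂ : ContDiffOn ℝ ∞ a₂₂ (Metric.ball a ρ)
  smooth : ContDiffOn ℝ ∞ w (Metric.ball a ρ)
  elliptic : ∀ s ∈ Metric.ball a ρ, ∀ x y : ℝ,
    x ^ 2 + y ^ 2 ≤ a₁₁ s * x ^ 2 + 2 * a₁₂ s * (x * y) + a₂₂ s * y ^ 2
  ineq : ∀ r < ρ, ∃ C : ℝ, ∀ s ∈ Metric.closedBall a r,
    |a₁₁ s * dx (dx w) s + 2 * a₁₂ s * dx (dy w) s + a₂₂ s * dy (dy w) s| ≤
      C * (|w s| + |dx w s| + |dy w s|)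

namespace IsEllipticIneq

variable {a₁₁ a₁₂ a₂₂ w : ℂ → ℝ} {a : ℂ} {ρ : ℝ}

theorem mono (h : IsEllipticIneq a₁₁ a₁₂ a₂₂ w a ρ) {b : ℂ} {σ : ℝ} (hb : dist b a + σ ≤ ρ) :
    IsEllipticIneq a₁₁ a₁₂ a₂₂ w b σ := by
  have hsub : Metric.ball b σ ⊆ Metric.ball a ρ := Metric.ball_subset_ball' (by linarith)
  refine ⟨h.smooth₁₁.mono hsub, h.smooth₁₂.mono hsub, h.smooth₂₂.mono hsub, h.smooth.mono hsub,
    fun s hs => h.elliptic s (hsub hs), fun r hr => ?_⟩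
  obtain ⟨C, hC⟩ := h.ineq (r + dist b a) (by linarith)
  exact ⟨C, fun s hs => hC s (Metric.closedBall_subset_closedBall' le_rfl hs)⟩

theorem one_le (h : IsEllipticIneq a₁₁ a₁₂ a₂₂ w a ρ) {s : ℂ} (hs : s ∈ Metric.ball a ρ) :
    1 ≤ a₁₁ s := by
  have := h.elliptic s hs 1 0
  linarith

theorem det_pos (h : IsEllipticIneq a₁₁ a₁₂ a₂₂ w a ρ) {s : ℂ} (hs : s ∈ Metric.ball a ρ) :
    0 < a₁₁ s * a₂₂ s - a₁₂ s ^ 2 := by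
  have h1 := h.one_le hs
  have h2 := h.elliptic s hs (-a₁₂ s) (a₁₁ s)
  have h3 : 0 < a₁₁ s * (a₁₁ s * a₂₂ s - a₁₂ s ^ 2) := by nlinarith [sq_nonneg (a₁₂ s)]
  exact pos_of_mul_pos_right h3 (by linarith)

end IsEllipticIneq

theorem contDiff_bump_mul {a : ℂ} (f : ContDiffBump a) {ρ : ℝ} (hρ : f.rOut < ρ) {g : ℂ → ℝ}
    (hg : ContDiffOn ℝ ∞ g (Metric.ball a ρ)) : ContDiff ℝ ∞ (fun s => f s * g s) := by
  rw [contDiff_iff_contDiffAt]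
  intro s
  by_cases hs : s ∈ Metric.ball a ρ
  · exact f.contDiffAt.mul (hg.contDiffAt (Metric.isOpen_ball.mem_nhds hs))
  · have hs' : s ∈ (Metric.closedBall a f.rOut)ᶜ := fun h =>
      hs (Metric.closedBall_subset_ball hρ h)
    have : (fun s => f s * g s) =ᶠ[𝓝 s] fun _ => 0 := by
      filter_upwards [Metric.isClosed_closedBall.isOpen_compl.mem_nhds hs'] with t ht
      have : f t = 0 := f.zero_of_le_dist (by
        simp only [mem_compl_iff, Metric.mem_closedBall, not_le] at ht; exact ht.le)
      rw [this, zero_mul]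
    exact contDiffAt_const.congr_of_eventuallyEq this

/-- **Weak unique continuation**: the operator is factored into two first order complex operators,
to each of which the Carleman estimate applies. -/
theorem IsEllipticIneq.unique_continuation {a₁₁ a₁₂ a₂₂ w : ℂ → ℝ} {a : ℂ} {ρ : ℝ}
    (h : IsEllipticIneq a₁₁ a₁₂ a₂₂ w a ρ) (h0 : w =ᶠ[𝓝 a] fun _ => 0) :
    ∀ s ∈ Metric.ball a ρ, w s = 0 := by
  intro s₁ hs₁
  -- the coefficients and the solution are extended to the plane by a cutoff equal to `1` on the
  -- disc of radius `r₃`; the extension of `m` is kept positive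
  obtain ⟨r₁, hd1, h1ρ⟩ := exists_between (Metric.mem_ball.1 hs₁)
  obtain ⟨r₂, h12, h2ρ⟩ := exists_between h1ρ
  obtain ⟨r₃, h23, h3ρ⟩ := exists_between h2ρ
  obtain ⟨r₄, h34, h4ρ⟩ := exists_between h3ρ
  have hr₁ : 0 < r₁ := dist_nonneg.trans_lt hd1
  let f : ContDiffBump a := ⟨r₃, r₄, by linarith, h34⟩
  have f1 : ∀ s ∈ Metric.ball a r₃, f s = 1 := fun s hs =>
    f.one_of_mem_closedBall (Metric.ball_subset_closedBall hs)
  have f0 : ∀ s, s ∉ Metric.ball a r₄ → f s = 0 := fun s hs =>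
    f.zero_of_le_dist (by simpa [Metric.mem_ball] using hs)
  have sk : ContDiffOn ℝ ∞ (fun s => a₁₂ s / a₁₁ s) (Metric.ball a ρ) :=
    h.smooth₁₂.div h.smooth₁₁ fun s hs => by have := h.one_le hs; positivity
  have sm : ContDiffOn ℝ ∞ (fun s => √(a₁₁ s * a₂₂ s - a₁₂ s ^ 2) / a₁₁ s)
      (Metric.ball a ρ) :=
    (((h.smooth₁₁.mul h.smooth₂₂).sub (h.smooth₁₂.pow 2)).sqrt
      fun s hs => (h.det_pos hs).ne').div h.smooth₁₁ fun s hs => by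
        have := h.one_le hs; positivity
  set k : ℂ → ℝ := fun s => f s * (a₁₂ s / a₁₁ s) with hk
  set m : ℂ → ℝ := fun s => f s * (√(a₁₁ s * a₂₂ s - a₁₂ s ^ 2) / a₁₁ s) + (1 - f s) with hm
  set W : ℂ → ℝ := fun s => f s * w s with hW
  have sk' : ContDiff ℝ ∞ k := contDiff_bump_mul f h4ρ sk
  have sm' : ContDiff ℝ ∞ m := (contDiff_bump_mul f h4ρ sm).add (contDiff_const.sub f.contDiff)
  have sW' : ContDiff ℝ ∞ W := contDiff_bump_mul f h4ρ h.smooth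
  have hm0 : ∀ s, 0 < m s := by
    intro s
    by_cases hs : s ∈ Metric.ball a r₄
    · have hs' := Metric.ball_subset_ball h4ρ.le hs
      have h1 := h.one_le hs'
      have h2 : 0 < √(a₁₁ s * a₂₂ s - a₁₂ s ^ 2) / a₁₁ s :=
        div_pos (Real.sqrt_pos.2 (h.det_pos hs')) (by linarith)
      have h3 : f s ≤ 1 := f.le_one
      have h4 : 0 < f s := f.pos_of_mem_ball hs
      have := mul_pos h4 h2
      rw [hm]; simp only; linarith
    · simp [hm, f0 s hs]
  obtain ⟨r₀, hr₀, hw0⟩ := Metric.eventually_nhds_iff_ball.1 h0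
  obtain ⟨C, hC⟩ := h.ineq r₂ h2ρ
  have hWw : ∀ s ∈ Metric.ball a r₃, W =ᶠ[𝓝 s] w := fun s hs => by
    filter_upwards [Metric.isOpen_ball.mem_nhds hs] with t ht
    rw [hW]; simp [f1 t ht]
  have := eq_zero_of_vanish_near sk' sm' hm0 sW' hr₀ hr₁ h12 (C := |C|) (fun s hs => ?_)
    (fun s hs => by rw [hW]; simp [hw0 s hs]) s₁ (Metric.mem_ball.2 hd1)
  · have h1 : f s₁ = 1 := f1 s₁ (Metric.mem_ball.2 (by linarith))
    simpa [hW, h1] using this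
  · have hs3 : s ∈ Metric.ball a r₃ := Metric.closedBall_subset_ball h23 hs
    have hsρ : s ∈ Metric.ball a ρ := Metric.closedBall_subset_ball h2ρ hs
    have e := hWw s hs3
    have hone := h.one_le hsρ
    rw [dx_congr (eventuallyEq_dx e), dx_congr (eventuallyEq_dy e), dy_congr (eventuallyEq_dy e),
      dx_congr e, dy_congr e, e.eq_of_nhds]
    have hks : k s = a₁₂ s / a₁₁ s := by simp [hk, f1 s hs3]
    have hms : m s = √(a₁₁ s * a₂₂ s - a₁₂ s ^ 2) / a₁₁ s := by simp [hm, f1 s hs3]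
    have hkm : k s ^ 2 + m s ^ 2 = a₂₂ s / a₁₁ s := by
      rw [hks, hms, div_pow, div_pow, Real.sq_sqrt (h.det_pos hsρ).le]
      field_simp
      ring
    rw [hkm, hks]
    have e1 : dx (dx w) s + 2 * (a₁₂ s / a₁₁ s) * dx (dy w) s + a₂₂ s / a₁₁ s * dy (dy w) s =
        (a₁₁ s * dx (dx w) s + 2 * a₁₂ s * dx (dy w) s + a₂₂ s * dy (dy w) s) / a₁₁ s := by
      field_simp
    rw [e1, abs_div, abs_of_pos (by linarith : 0 < a₁₁ s)]
    refine (div_le_self (abs_nonneg _) hone).trans ((hC s hs).trans ?_)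
    exact mul_le_mul_of_nonneg_right (le_abs_self C) (by positivity)

/-! ### The strong maximum principle -/

/-- The second derivative is nonnegative at a local minimum. -/
theorem second_deriv_nonneg_of_isLocalMin {γ γ' : ℝ → ℝ} {D : ℝ}
    (hγ : ∀ᶠ t in 𝓝 0, HasDerivAt γ (γ' t) t) (hγ' : HasDerivAt γ' D 0) (hmin : IsLocalMin γ 0) :
    0 ≤ D := by
  by_contra hD
  push Not at hD
  have h0 : γ' 0 = 0 := hmin.hasDerivAt_eq_zero hγ.self_of_nhds
  -- subtracting half of the quadratic term still leaves a strict local maximum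
  have h1 : ∀ᶠ t in 𝓝 (0 : ℝ), HasDerivAt (fun t => γ t - D / 4 * t ^ 2)
      (γ' t - D / 2 * t) t := by
    filter_upwards [hγ] with t ht
    refine (ht.sub ((hasDerivAt_pow 2 t).const_mul (D / 4))).congr_deriv ?_
    simp; ring
  have h2 : deriv (fun t => γ t - D / 4 * t ^ 2) =ᶠ[𝓝 0] fun t => γ' t - D / 2 * t := by
    filter_upwards [h1] with t ht using ht.deriv
  have h3 : HasDerivAt (fun t => γ' t - D / 2 * t) (D / 2) 0 := by
    refine (hγ'.sub ((hasDerivAt_id (0 : ℝ)).const_mul (D / 2))).congr_deriv ?_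
    ring
  have hmax : IsLocalMax (fun t => γ t - D / 4 * t ^ 2) 0 := by
    refine isLocalMax_of_deriv_deriv_neg ?_ ?_ h1.self_of_nhds.continuousAt
    · rw [h2.deriv_eq, h3.deriv]; linarith
    · rw [h2.eq_of_nhds, h0]; ring
  have h4 : ∀ᶠ t in 𝓝 (0 : ℝ), t = 0 := by
    filter_upwards [hmax, hmin] with t ht1 ht2
    have ht1' : γ t - D / 4 * t ^ 2 ≤ γ 0 := by simpa using ht1
    have : -D / 4 * t ^ 2 ≤ 0 := by linarith
    by_contra hne
    have : 0 < -D / 4 * t ^ 2 := by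
      have : 0 < t ^ 2 := by positivity
      have : 0 < -D := by linarith
      positivity
    linarith
  obtain ⟨ε, hε, hb⟩ := Metric.eventually_nhds_iff_ball.1 h4
  have := hb (ε / 2) (by simp [abs_of_pos hε]; linarith)
  linarith

theorem hessian_nonneg_of_isLocalMin {g : ℂ → ℝ} {s : ℂ} (hg : ContDiffAt ℝ ∞ g s)
    (hmin : IsLocalMin g s) (x y : ℝ) :
    0 ≤ x ^ 2 * dx (dx g) s + 2 * (x * y) * dx (dy g) s + y ^ 2 * dy (dy g) s := by
  set v : ℂ := ⟨x, y⟩ with hv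
  have hline : ∀ t : ℝ, HasDerivAt (fun t : ℝ => s + t • v) v t := fun t => by
    simpa using ((hasDerivAt_id t).smul_const v).const_add s
  have hcont : Tendsto (fun t : ℝ => s + t • v) (𝓝 0) (𝓝 s) := by
    have := (hline 0).continuousAt.tendsto
    simpa using this
  have hev : ∀ᶠ z in 𝓝 s, DifferentiableAt ℝ g z := by
    filter_upwards [(hg.of_le (m := 1) (by simp)).eventually (by simp)] with z hz using
      hz.differentiableAt (by simp)
  refine second_deriv_nonneg_of_isLocalMin (γ := fun t => g (s + t • v))
    (γ' := fun t => x * dx g (s + t • v) + y * dy g (s + t • v)) ?_ ?_ ?_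
  · filter_upwards [hcont.eventually hev] with t ht
    have := ht.hasFDerivAt.comp_hasDerivAt t (hline t)
    rw [fderiv_apply_eq_dx_dy] at this
    exact this
  · have h1 : DifferentiableAt ℝ (dx g) (s + (0 : ℝ) • v) := by
      simpa using (contDiffAt_dx hg).differentiableAt (by simp)
    have h2 : DifferentiableAt ℝ (dy g) (s + (0 : ℝ) • v) := by
      simpa using (contDiffAt_dy hg).differentiableAt (by simp)
    have h1' := (h1.hasFDerivAt.comp_hasDerivAt 0 (hline 0)).const_mul x
    have h2' := (h2.hasFDerivAt.comp_hasDerivAt 0 (hline 0)).const_mul y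
    refine (h1'.add h2').congr_deriv ?_
    rw [fderiv_apply_eq_dx_dy, fderiv_apply_eq_dx_dy]
    simp only [zero_smul, add_zero, hv]
    rw [dx_dy_comm hg]
    ring
  · have : IsLocalMin g (s + (0 : ℝ) • v) := by simpa using hmin
    exact this.comp_continuous (g := fun t : ℝ => s + t • v) (hline 0).continuousAt

/-- The contraction of a positive definite with a nonnegative symmetric matrix is nonnegative. -/
theorem contraction_nonneg {a₁₁ a₁₂ a₂₂ h₁₁ h₁₂ h₂₂ : ℝ} (ha : 0 < a₁₁)
    (hdet : 0 < a₁₁ * a₂₂ - a₁₂ ^ 2)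
    (hh : ∀ x y : ℝ, 0 ≤ x ^ 2 * h₁₁ + 2 * (x * y) * h₁₂ + y ^ 2 * h₂₂) :
    0 ≤ a₁₁ * h₁₁ + 2 * a₁₂ * h₁₂ + a₂₂ * h₂₂ := by
  have h1 := hh a₁₁ a₁₂
  have h2 : 0 ≤ h₂₂ := by have := hh 0 1; linarith
  have h3 := mul_nonneg hdet.le h2
  have : 0 ≤ a₁₁ * (a₁₁ * h₁₁ + 2 * a₁₂ * h₁₂ + a₂₂ * h₂₂) := by linarith
  exact nonneg_of_mul_nonneg_right this ha

end HypTranslator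

namespace HypTranslator

/-- For large `l` the function `exp (-l |s - q|²)` is a strict subsolution off its center. -/
theorem IsEllipticIneq.exists_barrier {a₁₁ a₁₂ a₂₂ w : ℂ → ℝ} {a : ℂ} {ρ : ℝ}
    (h : IsEllipticIneq a₁₁ a₁₂ a₂₂ w a ρ) {q : ℂ} {r C : ℝ} (hr : 0 < r)
    (hq : dist q a + r < ρ) (hC : 0 ≤ C) :
    ∃ l > 0, ∀ s ∈ Metric.closedBall q r \ Metric.ball q (r / 2),
      C * (gaussWeight q l s + |dx (gaussWeight q l) s| + |dy (gaussWeight q l) s|) <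
        a₁₁ s * dx (dx (gaussWeight q l)) s + 2 * a₁₂ s * dx (dy (gaussWeight q l)) s +
          a₂₂ s * dy (dy (gaussWeight q l)) s := by
  have hsub : Metric.closedBall q r ⊆ Metric.ball a ρ :=
    Metric.closedBall_subset_ball' (by linarith)
  obtain ⟨L, hL⟩ := (isCompact_closedBall q r).exists_bound_of_continuousOn
    (f := fun s => a₁₁ s + a₂₂ s)
    ((h.smooth₁₁.continuousOn.mono hsub).add (h.smooth₂₂.continuousOn.mono hsub))
  have hL0 : 0 ≤ L := (norm_nonneg _).trans (hL q (Metric.mem_closedBall_self hr.le))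
  refine ⟨(2 * L + 4 * C * r + C + 1) / r ^ 2 + 1, by positivity, fun s hs => ?_⟩
  set l := (2 * L + 4 * C * r + C + 1) / r ^ 2 + 1 with hl
  have hl1 : 1 ≤ l := by
    have : 0 ≤ (2 * L + 4 * C * r + C + 1) / r ^ 2 := by positivity
    linarith
  have hlr : 2 * L + 4 * C * r + C + 1 ≤ l * r ^ 2 := by
    have : l * r ^ 2 = (2 * L + 4 * C * r + C + 1) + r ^ 2 := by rw [hl]; field_simp
    nlinarith [sq_nonneg r]
  rw [← dx_dy_comm (contDiff_gaussWeight q l).contDiffAt, dx_dx_gaussWeight, dy_dx_gaussWeight,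
    dy_dy_gaussWeight, dx_gaussWeight, dy_gaussWeight]
  set G := gaussWeight q l s with hG
  have hGpos : 0 < G := Real.exp_pos _
  set x := s.re - q.re with hx
  set y := s.im - q.im with hy
  have hxy : x ^ 2 + y ^ 2 = ‖s - q‖ ^ 2 := by
    rw [Complex.sq_norm, Complex.normSq_apply, hx, hy]; simp; ring
  have hn1 : ‖s - q‖ ≤ r := by simpa [dist_eq_norm] using hs.1
  have hn2 : r / 2 ≤ ‖s - q‖ := by simpa [dist_eq_norm] using hs.2
  have hlow : r ^ 2 / 4 ≤ x ^ 2 + y ^ 2 := by rw [hxy]; nlinarith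
  have habsx : |x| ≤ r := (Complex.abs_re_le_norm (s - q)).trans hn1
  have habsy : |y| ≤ r := (Complex.abs_im_le_norm (s - q)).trans hn1
  have hell := h.elliptic s (hsub hs.1) x y
  have hLs := (le_abs_self _).trans (hL s hs.1)
  have h1 : |-2 * l * (x * G)| + |-2 * l * (y * G)| = G * (2 * l * (|x| + |y|)) := by
    have : (0 : ℝ) < l := by linarith
    simp only [abs_mul, abs_neg, abs_of_pos this, abs_of_pos hGpos, abs_two]; ring
  have h2 : C * (G + |-2 * l * (x * G)| + |-2 * l * (y * G)|) =
      G * (C * (1 + 2 * l * (|x| + |y|))) := by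
    rw [add_assoc, h1]; ring
  have h3 : C * (1 + 2 * l * (|x| + |y|)) ≤ C * (1 + 2 * l * (r + r)) := by gcongr
  have h4 : l * (2 * L + 4 * C * r + C + 1) ≤ l * (l * r ^ 2) :=
    mul_le_mul_of_nonneg_left hlr (by linarith)
  have h5 : 4 * l ^ 2 * (r ^ 2 / 4) ≤
      4 * l ^ 2 * (a₁₁ s * x ^ 2 + 2 * a₁₂ s * (x * y) + a₂₂ s * y ^ 2) :=
    mul_le_mul_of_nonneg_left (hlow.trans hell) (by positivity)
  have h6 : l * (a₁₁ s + a₂₂ s) ≤ l * L := mul_le_mul_of_nonneg_left hLs (by linarith)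
  have h7 : C ≤ l * C := le_mul_of_one_le_left hC hl1
  have h8 : C * (1 + 2 * l * (|x| + |y|)) <
      4 * l ^ 2 * (a₁₁ s * x ^ 2 + 2 * a₁₂ s * (x * y) + a₂₂ s * y ^ 2) -
        2 * l * (a₁₁ s + a₂₂ s) := by nlinarith
  rw [h2]
  calc G * (C * (1 + 2 * l * (|x| + |y|))) < G * (4 * l ^ 2 *
        (a₁₁ s * x ^ 2 + 2 * a₁₂ s * (x * y) + a₂₂ s * y ^ 2) - 2 * l * (a₁₁ s + a₂₂ s)) :=
        mul_lt_mul_of_pos_left h8 hGpos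
    _ = _ := by ring

/-- **Hopf's boundary point lemma**, in the form: a nonnegative solution that is positive inside a
circle has no interior zero on the circle. -/
theorem IsEllipticIneq.hopf {a₁₁ a₁₂ a₂₂ w : ℂ → ℝ} {a : ℂ} {ρ : ℝ}
    (h : IsEllipticIneq a₁₁ a₁₂ a₂₂ w a ρ) (hw : ∀ s ∈ Metric.ball a ρ, 0 ≤ w s) {q y : ℂ} {r : ℝ}
    (hr : 0 < r) (hq : dist q a + r < ρ) (hpos : ∀ s ∈ Metric.ball q r, 0 < w s)
    (hy : dist y q = r) : w y ≠ 0 := by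
  intro hwy
  have hsub : Metric.closedBall q r ⊆ Metric.ball a ρ :=
    Metric.closedBall_subset_ball' (by linarith)
  obtain ⟨C, hC⟩ := h.ineq (dist q a + r) hq
  have hCsub : Metric.closedBall q r ⊆ Metric.closedBall a (dist q a + r) :=
    Metric.closedBall_subset_closedBall' (by linarith)
  obtain ⟨l, hl, hbar⟩ := h.exists_barrier hr hq (abs_nonneg C)
  set G := gaussWeight q l with hG
  have sG : ContDiff ℝ ∞ G := contDiff_gaussWeight q l
  set c₀ := Real.exp (-l * r ^ 2) with hc₀
  set K : Set ℂ := Metric.closedBall q r \ Metric.ball q (r / 2) with hKdef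
  have hK : IsCompact K := (isCompact_closedBall q r).diff Metric.isOpen_ball
  have sw : ∀ s ∈ Metric.closedBall q r, ContDiffAt ℝ ∞ w s := fun s hs =>
    h.smooth.contDiffAt (Metric.isOpen_ball.mem_nhds (hsub hs))
  -- `w` is bounded below on the inner circle, which fixes the multiple of the barrier
  obtain ⟨s₂, hs₂, hmin₂⟩ := (isCompact_sphere q (r / 2)).exists_isMinOn
    (NormedSpace.sphere_nonempty.2 (by positivity)) (f := w)
    (fun s hs => (sw s (Metric.sphere_subset_closedBall.trans
      (Metric.closedBall_subset_closedBall (by linarith)) hs)).continuousAt.continuousWithinAt)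
  set ε := w s₂ with hε
  have hε0 : 0 < ε := hpos s₂ (by
    rw [Metric.mem_ball, Metric.mem_sphere.1 hs₂]; linarith)
  set g : ℂ → ℝ := fun s => w s - (ε * G s - ε * c₀) with hg
  have sg : ∀ s ∈ Metric.closedBall q r, ContDiffAt ℝ ∞ g s := fun s hs =>
    (sw s hs).sub ((contDiffAt_const.mul sG.contDiffAt).sub contDiffAt_const)
  have hyK : y ∈ K := ⟨by rw [Metric.mem_closedBall, hy], by
    rw [Metric.mem_ball, hy]; linarith⟩
  have hGon : ∀ s, dist s q = r → G s = c₀ := fun s hs => by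
    rw [hG, gaussWeight_eq, ← dist_eq_norm, hs]
  have hgy : g y = 0 := by simp [hg, hwy, hGon y hy]
  have hgK : ∀ s ∈ K, 0 ≤ g s := by
    -- a negative minimum would be interior, against the differential inequality
    obtain ⟨s₁, hs₁, hmin⟩ := hK.exists_isMinOn ⟨y, hyK⟩ (f := g) fun s hs =>
      (sg s hs.1).continuousAt.continuousWithinAt
    suffices 0 ≤ g s₁ from fun s hs => this.trans (hmin hs)
    by_contra hneg
    push Not at hneg
    have hd1 : dist s₁ q ≤ r := hs₁.1
    have hd2 : r / 2 ≤ dist s₁ q := by simpa using hs₁.2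
    have hw1 := hw s₁ (hsub hs₁.1)
    rcases hd1.eq_or_lt with hd1 | hd1
    · simp only [hg, hGon s₁ hd1] at hneg; linarith
    rcases hd2.eq_or_lt with hd2 | hd2
    · have h1 : ε ≤ w s₁ := hmin₂ (Metric.mem_sphere.2 hd2.symm)
      have h2 : G s₁ ≤ 1 := by
        rw [hG, gaussWeight_eq, Real.exp_le_one_iff]; nlinarith [sq_nonneg ‖s₁ - q‖]
      have h3 : 0 < c₀ := Real.exp_pos _
      simp only [hg] at hneg
      nlinarith
    have hnhds : K ∈ 𝓝 s₁ := by
      have : Metric.ball q r ∩ (Metric.closedBall q (r / 2))ᶜ ∈ 𝓝 s₁ :=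
        (Metric.isOpen_ball.inter Metric.isClosed_closedBall.isOpen_compl).mem_nhds
          ⟨hd1, by simpa using hd2⟩
      filter_upwards [this] with t ht
      exact ⟨Metric.ball_subset_closedBall ht.1, fun h' => ht.2 (Metric.ball_subset_closedBall h')⟩
    have hloc : IsLocalMin g s₁ := hmin.isLocalMin hnhds
    have hgrad : fderiv ℝ g s₁ = 0 := hloc.fderiv_eq_zero
    have hev : ∀ᶠ s in 𝓝 s₁, ContDiffAt ℝ ∞ w s := by
      filter_upwards [hnhds] with s hs using sw s hs.1
    have dG : ∀ s, DifferentiableAt ℝ G s := fun s => sG.differentiable (by simp) s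
    have e1 : dx g =ᶠ[𝓝 s₁] fun s => dx w s - (ε * dx G s - 0) := by
      filter_upwards [hev] with s hs
      have hs' := hs.differentiableAt (by simp)
      have := dG s
      rw [hg]
      simp (disch := fun_prop) only [dx_sub, dx_mul, dx_const]
      ring
    have e2 : dy g =ᶠ[𝓝 s₁] fun s => dy w s - (ε * dy G s - 0) := by
      filter_upwards [hev] with s hs
      have hs' := hs.differentiableAt (by simp)
      have := dG s
      rw [hg]
      simp (disch := fun_prop) only [dy_sub, dy_mul, dy_const]
      ring
    have g1 : dx w s₁ = ε * dx G s₁ := by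
      have : dx g s₁ = 0 := by rw [dx, hgrad]; rfl
      rw [e1.eq_of_nhds] at this; linarith
    have g2 : dy w s₁ = ε * dy G s₁ := by
      have : dy g s₁ = 0 := by rw [dy, hgrad]; rfl
      rw [e2.eq_of_nhds] at this; linarith
    have sw1 := hev.self_of_nhds
    have d1 := (contDiffAt_dx sw1).differentiableAt (by simp)
    have d2 := (contDiffAt_dy sw1).differentiableAt (by simp)
    have d3 := (contDiff_dx sG).differentiable (by simp) s₁
    have d4 := (contDiff_dy sG).differentiable (by simp) s₁
    have f1 : dx (dx g) s₁ = dx (dx w) s₁ - ε * dx (dx G) s₁ := by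
      rw [dx_congr e1]
      simp (disch := fun_prop) only [dx_sub, dx_mul, dx_const]
      ring
    have f2 : dx (dy g) s₁ = dx (dy w) s₁ - ε * dx (dy G) s₁ := by
      rw [dx_congr e2]
      simp (disch := fun_prop) only [dx_sub, dx_mul, dx_const]
      ring
    have f3 : dy (dy g) s₁ = dy (dy w) s₁ - ε * dy (dy G) s₁ := by
      rw [dy_congr e2]
      simp (disch := fun_prop) only [dy_sub, dy_mul, dy_const]
      ring
    have hcon := contraction_nonneg (by linarith [h.one_le (hsub hs₁.1)] : 0 < a₁₁ s₁)
      (h.det_pos (hsub hs₁.1)) (hessian_nonneg_of_isLocalMin (sg s₁ hs₁.1) hloc)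
    rw [f1, f2, f3] at hcon
    have hb := mul_lt_mul_of_pos_left (hbar s₁ hs₁) hε0
    have hi := (le_abs_self _).trans (hC s₁ (hCsub hs₁.1))
    have hc₀' : 0 < c₀ := Real.exp_pos _
    have hwle : w s₁ ≤ ε * G s₁ := by
      simp only [hg] at hneg
      nlinarith
    rw [g1, g2, abs_mul, abs_mul, abs_of_pos hε0, abs_of_nonneg hw1] at hi
    have hi' : C * (w s₁ + ε * |dx G s₁| + ε * |dy G s₁|) ≤
        |C| * (ε * G s₁ + ε * |dx G s₁| + ε * |dy G s₁|) :=
      mul_le_mul (le_abs_self C) (by linarith) (by positivity) (abs_nonneg C)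
    nlinarith
  -- at `y` the gradient of `w` vanishes, so the inward derivative of `g` is negative
  have hsegm : segment ℝ y (y + (2⁻¹ : ℝ) • (q - y)) ⊆ K := by
    rintro z hz
    rw [segment_eq_image'] at hz
    obtain ⟨t, ⟨ht0, ht1⟩, rfl⟩ := hz
    have : dist (y + t • (y + (2⁻¹ : ℝ) • (q - y) - y)) q = (1 - t / 2) * r := by
      rw [dist_eq_norm, ← hy, dist_eq_norm, show y + t • (y + (2⁻¹ : ℝ) • (q - y) - y) - q =
        (1 - t / 2) • (y - q) by module, norm_smul, Real.norm_of_nonneg (by linarith)]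
    refine ⟨?_, ?_⟩
    · rw [Metric.mem_closedBall, this]; nlinarith
    · rw [Metric.mem_ball, this]; nlinarith
  have hcone := mem_posTangentConeAt_of_segment_subset hsegm
  have hlocw : IsLocalMin w y := by
    filter_upwards [Metric.isOpen_ball.mem_nhds (hsub hyK.1)] with s hs
    rw [hwy]; exact hw s hs
  have hlocg : IsLocalMinOn g K y := by
    filter_upwards [self_mem_nhdsWithin] with s hs
    rw [hgy]; exact hgK s hs
  have hdw : HasFDerivAt w (0 : ℂ →L[ℝ] ℝ) y := by
    rw [← hlocw.fderiv_eq_zero]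
    exact ((sw y hyK.1).differentiableAt (by simp)).hasFDerivAt
  have hdG : HasFDerivAt G (fderiv ℝ G y) y := (sG.differentiable (by simp) y).hasFDerivAt
  have hdg : HasFDerivAt g (0 - ε • fderiv ℝ G y) y :=
    hdw.sub ((hdG.const_mul ε).sub_const (ε * c₀))
  have hnn := hlocg.hasFDerivWithinAt_nonneg hdg.hasFDerivWithinAt hcone
  have hval : (0 - ε • fderiv ℝ G y) ((2⁻¹ : ℝ) • (q - y)) = -(ε * l * r ^ 2 * G y) := by
    have hxy : (y.re - q.re) ^ 2 + (y.im - q.im) ^ 2 = r ^ 2 := by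
      rw [← hy, dist_eq_norm, Complex.sq_norm, Complex.normSq_apply]; simp; ring
    simp only [zero_sub, neg_apply, smul_apply,
      fderiv_apply_eq_dx_dy, hG, dx_gaussWeight, dy_gaussWeight, smul_eq_mul, ← hxy,
      Complex.smul_re, Complex.smul_im, Complex.sub_re, Complex.sub_im]
    ring
  rw [hval] at hnn
  have : 0 < G y := Real.exp_pos _
  have : 0 < ε * l * r ^ 2 * G y := by positivity
  linarith

/-- **Strong maximum principle** for nonnegative solutions with an interior zero. -/
theorem IsEllipticIneq.eventually_eq_zero {a₁₁ a₁₂ a₂₂ w : ℂ → ℝ} {a : ℂ} {ρ : ℝ} (hρ : 0 < ρ)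
    (h : IsEllipticIneq a₁₁ a₁₂ a₂₂ w a ρ) (hw : ∀ s ∈ Metric.ball a ρ, 0 ≤ w s) (ha : w a = 0) :
    w =ᶠ[𝓝 a] fun _ => 0 := by
  filter_upwards [Metric.ball_mem_nhds a (by positivity : 0 < ρ / 4)] with q hq
  by_contra hne
  have hq' := Metric.mem_ball.1 hq
  have hsub : Metric.closedBall a (ρ / 2) ⊆ Metric.ball a ρ :=
    Metric.closedBall_subset_ball (by linarith)
  set Z : Set ℂ := Metric.closedBall a (ρ / 2) ∩ w ⁻¹' {0} with hZ
  have hZc : IsCompact Z := by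
    refine (isCompact_closedBall a (ρ / 2)).of_isClosed_subset ?_ inter_subset_left
    exact (h.smooth.continuousOn.mono hsub).preimage_isClosed_of_isClosed
      Metric.isClosed_closedBall isClosed_singleton
  have haZ : a ∈ Z := ⟨Metric.mem_closedBall_self (by positivity), ha⟩
  -- the largest disc around `q` without zeros has a zero `y` on its boundary
  obtain ⟨y, hyZ, hy⟩ := hZc.exists_infDist_eq_dist ⟨a, haZ⟩ q
  have hle : Metric.infDist q Z ≤ dist q a := Metric.infDist_le_dist_of_mem haZ
  have hr : 0 < dist y q := by
    rw [dist_pos]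
    rintro rfl
    exact hne hyZ.2
  rw [dist_comm] at hy
  refine h.hopf hw hr (by rw [← hy]; linarith) (fun s hs => ?_) rfl hyZ.2
  have hs' := Metric.mem_ball.1 hs
  have hsa : dist s a ≤ ρ / 2 := by
    have := dist_triangle s q a
    linarith
  refine lt_of_le_of_ne (hw s (hsub hsa)) fun h0 => ?_
  have : Metric.infDist q Z ≤ dist q s := Metric.infDist_le_dist_of_mem ⟨hsa, h0.symm⟩
  rw [dist_comm] at this
  linarith

end HypTranslator

namespace HypTranslator

/-! ### The translator equation for graphs -/

/-- The functions `F` and `G` are continuous on `K` and their difference is `O(N)`, uniformly. -/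
structure LipClose (K : Set ℂ) (N F G : ℂ → ℝ) : Prop where
  left : ContinuousOn F K
  right : ContinuousOn G K
  bound : ∃ C : ℝ, ∀ s ∈ K, |F s - G s| ≤ C * N s

namespace LipClose

variable {K : Set ℂ} {N F G F' G' : ℂ → ℝ}

theorem refl (hF : ContinuousOn F K) : LipClose K N F F :=
  ⟨hF, hF, 0, fun s _ => by simp⟩

theorem add (h : LipClose K N F G) (h' : LipClose K N F' G') :
    LipClose K N (fun s => F s + F' s) (fun s => G s + G' s) := by
  obtain ⟨C, hC⟩ := h.bound
  obtain ⟨C', hC'⟩ := h'.bound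
  refine ⟨h.left.add h'.left, h.right.add h'.right, C + C', fun s hs => ?_⟩
  rw [show F s + F' s - (G s + G' s) = (F s - G s) + (F' s - G' s) by ring]
  refine (abs_add_le _ _).trans ?_
  have := hC s hs
  have := hC' s hs
  linarith

theorem mul (hK : IsCompact K) (h : LipClose K N F G) (h' : LipClose K N F' G') :
    LipClose K N (fun s => F s * F' s) (fun s => G s * G' s) := by
  obtain ⟨C, hC⟩ := h.bound
  obtain ⟨C', hC'⟩ := h'.bound
  obtain ⟨A, hA⟩ := hK.exists_bound_of_continuousOn h.left
  obtain ⟨B, hB⟩ := hK.exists_bound_of_continuousOn h'.right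
  refine ⟨h.left.mul h'.left, h.right.mul h'.right, A * C' + C * B, fun s hs => ?_⟩
  rw [show F s * F' s - G s * G' s = F s * (F' s - G' s) + (F s - G s) * G' s by ring]
  refine (abs_add_le _ _).trans ?_
  rw [abs_mul, abs_mul]
  have h1 : |F s| * |F' s - G' s| ≤ A * (C' * N s) :=
    mul_le_mul (hA s hs) (hC' s hs) (abs_nonneg _) ((abs_nonneg _).trans (hA s hs))
  have h2 : |F s - G s| * |G' s| ≤ C * N s * B :=
    mul_le_mul (hC s hs) (hB s hs) (abs_nonneg _) ((abs_nonneg _).trans (hC s hs))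
  linarith

theorem inv (hK : IsCompact K) (h : LipClose K N F G) (hF : ∀ s ∈ K, F s ≠ 0)
    (hG : ∀ s ∈ K, G s ≠ 0) : LipClose K N (fun s => (F s)⁻¹) (fun s => (G s)⁻¹) := by
  obtain ⟨C, hC⟩ := h.bound
  have cF := h.left.inv₀ hF
  have cG := h.right.inv₀ hG
  obtain ⟨A, hA⟩ := hK.exists_bound_of_continuousOn (cF.mul cG)
  refine ⟨cF, cG, A * C, fun s hs => ?_⟩
  have h1 := hF s hs
  have h2 := hG s hs
  rw [show (F s)⁻¹ - (G s)⁻¹ = ((F s)⁻¹ * (G s)⁻¹) * -(F s - G s) by field_simp; ring, abs_mul,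
    abs_neg, mul_assoc]
  exact mul_le_mul (hA s hs) (hC s hs) (abs_nonneg _) ((abs_nonneg _).trans (hA s hs))

end LipClose

/-- The height `z` of the point with coordinates `s`, `v` over a plane, where `β j` is the height
of the `j`-th vector of the frame. -/
noncomputable def graphHeight (β : Fin 3 → ℝ) (s : ℂ) (v : ℝ) : ℝ :=
  s.re * β 0 + s.im * β 1 + v * β 2

/-- The right hand side of the translator equation for a graph, with `v` the value and `p`, `q` the
first derivatives of the function. -/
noncomputable def translatorRhs (β : Fin 3 → ℝ) (s : ℂ) (v p q : ℝ) : ℝ :=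
  2 * (1 + p * p + q * q) * ((v + (-1) * (p * s.re + q * s.im)) *
    ((graphHeight β s v)⁻¹ * (graphHeight β s v)⁻¹) +
    (-1) * ((β 2 + (-1) * (p * β 0 + q * β 1)) * (graphHeight β s v)⁻¹))

/-- The graph of `u` over the disc of center `a` and radius `ρ` lies in the half-space and satisfies
the quasilinear elliptic equation expressing that it is a translator. -/
structure IsTranslatorGraph (β : Fin 3 → ℝ) (u : ℂ → ℝ) (a : ℂ) (ρ : ℝ) : Prop where
  smooth : ContDiffOn ℝ ∞ u (Metric.ball a ρ)
  height_pos : ∀ s ∈ Metric.ball a ρ, 0 < graphHeight β s (u s)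
  eqn : ∀ s ∈ Metric.ball a ρ, (1 + dy u s ^ 2) * dx (dx u) s - 2 * (dx u s * dy u s) *
    dx (dy u) s + (1 + dx u s ^ 2) * dy (dy u) s = translatorRhs β s (u s) (dx u s) (dy u s)

theorem contDiffOn_dx {u : ℂ → ℝ} {U : Set ℂ} (hU : IsOpen U) (hu : ContDiffOn ℝ ∞ u U) :
    ContDiffOn ℝ ∞ (dx u) U := fun _ hs =>
  (contDiffAt_dx (hu.contDiffAt (hU.mem_nhds hs))).contDiffWithinAt

theorem contDiffOn_dy {u : ℂ → ℝ} {U : Set ℂ} (hU : IsOpen U) (hu : ContDiffOn ℝ ∞ u U) :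
    ContDiffOn ℝ ∞ (dy u) U := fun _ hs =>
  (contDiffAt_dy (hu.contDiffAt (hU.mem_nhds hs))).contDiffWithinAt

/-- The difference of two solutions of the quasilinear translator equation satisfies a linear
elliptic differential inequality. -/
theorem IsTranslatorGraph.isEllipticIneq_sub {β : Fin 3 → ℝ} {u v : ℂ → ℝ} {a : ℂ} {ρ : ℝ}
    (hu : IsTranslatorGraph β u a ρ) (hv : IsTranslatorGraph β v a ρ) :
    IsEllipticIneq (fun s => 1 + dy u s ^ 2) (fun s => -(dx u s * dy u s))
      (fun s => 1 + dx u s ^ 2) (fun s => u s - v s) a ρ := by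
  have su := hu.smooth
  have sv := hv.smooth
  have su1 := contDiffOn_dx Metric.isOpen_ball su
  have su2 := contDiffOn_dy Metric.isOpen_ball su
  have sv1 := contDiffOn_dx Metric.isOpen_ball sv
  have sv2 := contDiffOn_dy Metric.isOpen_ball sv
  refine ⟨contDiffOn_const.add (su2.pow 2), (su1.mul su2).neg, contDiffOn_const.add (su1.pow 2),
    su.sub sv, fun s _ x y => by nlinarith [sq_nonneg (dy u s * x - dx u s * y)], fun r hr => ?_⟩
  set K := Metric.closedBall a r with hKdef
  have hsub : K ⊆ Metric.ball a ρ := Metric.closedBall_subset_ball hr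
  have hK : IsCompact K := isCompact_closedBall a r
  set w : ℂ → ℝ := fun s => u s - v s with hw
  set N : ℂ → ℝ := fun s => |w s| + |dx w s| + |dy w s| with hN
  have au : ∀ s ∈ K, ContDiffAt ℝ ∞ u s := fun s hs =>
    su.contDiffAt (Metric.isOpen_ball.mem_nhds (hsub hs))
  have av : ∀ s ∈ K, ContDiffAt ℝ ∞ v s := fun s hs =>
    sv.contDiffAt (Metric.isOpen_ball.mem_nhds (hsub hs))
  have ed : ∀ s ∈ K, dx w =ᶠ[𝓝 s] (fun s => dx u s - dx v s) ∧
      dy w =ᶠ[𝓝 s] (fun s => dy u s - dy v s) := by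
    intro s hs
    have h1 := ((au s hs).of_le (m := 1) (by simp)).eventually (by simp)
    have h2 := ((av s hs).of_le (m := 1) (by simp)).eventually (by simp)
    constructor <;> filter_upwards [h1, h2] with t h1 h2
    · exact dx_sub (h1.differentiableAt (by simp)) (h2.differentiableAt (by simp))
    · exact dy_sub (h1.differentiableAt (by simp)) (h2.differentiableAt (by simp))
  have l0 : LipClose K N u v := ⟨su.continuousOn.mono hsub, sv.continuousOn.mono hsub, 1,
    fun s _ => by
      rw [one_mul, hN]; simp only; linarith [abs_nonneg (dx w s), abs_nonneg (dy w s)]⟩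
  have l1 : LipClose K N (dx u) (dx v) := ⟨su1.continuousOn.mono hsub, sv1.continuousOn.mono hsub,
    1, fun s hs => by
      rw [one_mul, hN, ← (ed s hs).1.eq_of_nhds]
      simp only; linarith [abs_nonneg (w s), abs_nonneg (dy w s)]⟩
  have l2 : LipClose K N (dy u) (dy v) := ⟨su2.continuousOn.mono hsub, sv2.continuousOn.mono hsub,
    1, fun s hs => by
      rw [one_mul, hN, ← (ed s hs).2.eq_of_nhds]
      simp only; linarith [abs_nonneg (w s), abs_nonneg (dx w s)]⟩
  have lr : ∀ {F : ℂ → ℝ}, ContinuousOn F K → LipClose K N F F := fun hF => LipClose.refl hF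
  have lc : ∀ c : ℝ, LipClose K N (fun _ => c) (fun _ => c) := fun c => lr continuousOn_const
  have lx : LipClose K N (fun s : ℂ => s.re) (fun s => s.re) :=
    lr Complex.continuous_re.continuousOn
  have ly : LipClose K N (fun s : ℂ => s.im) (fun s => s.im) :=
    lr Complex.continuous_im.continuousOn
  have lz : LipClose K N (fun s => (graphHeight β s (u s))⁻¹)
      (fun s => (graphHeight β s (v s))⁻¹) :=
    (((lx.mul hK (lc _)).add (ly.mul hK (lc _))).add (l0.mul hK (lc _))).inv hK
      (fun s hs => (hu.height_pos s (hsub hs)).ne') (fun s hs => (hv.height_pos s (hsub hs)).ne')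
  have lrhs : LipClose K N (fun s => translatorRhs β s (u s) (dx u s) (dy u s))
      (fun s => translatorRhs β s (v s) (dx v s) (dy v s)) :=
    ((lc 2).mul hK (((lc 1).add (l1.mul hK l1)).add (l2.mul hK l2))).mul hK
      (((l0.add ((lc (-1)).mul hK ((l1.mul hK lx).add (l2.mul hK ly)))).mul hK (lz.mul hK lz)).add
      ((lc (-1)).mul hK (((lc _).add ((lc (-1)).mul hK ((l1.mul hK (lc _)).add
        (l2.mul hK (lc _))))).mul hK lz)))
  -- the second derivatives of `v` appear as coefficients: only differences of the coefficients of
  -- the two equations multiply them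
  have lxx := lr ((contDiffOn_dx Metric.isOpen_ball sv1).continuousOn.mono hsub)
  have lxy := lr ((contDiffOn_dx Metric.isOpen_ball sv2).continuousOn.mono hsub)
  have lyy := lr ((contDiffOn_dy Metric.isOpen_ball sv2).continuousOn.mono hsub)
  have hall := lrhs.add ((lc (-1)).mul hK (((((lc 1).add (l2.mul hK l2)).mul hK lxx).add
    ((lc (-2)).mul hK ((l1.mul hK l2).mul hK lxy))).add
    (((lc 1).add (l1.mul hK l1)).mul hK lyy)))
  obtain ⟨C, hC⟩ := hall.bound
  refine ⟨C, fun s hs => ?_⟩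
  have eu := hu.eqn s (hsub hs)
  have ev := hv.eqn s (hsub hs)
  have d1 := (contDiffAt_dx (au s hs)).differentiableAt (by simp)
  have d2 := (contDiffAt_dy (au s hs)).differentiableAt (by simp)
  have d3 := (contDiffAt_dx (av s hs)).differentiableAt (by simp)
  have d4 := (contDiffAt_dy (av s hs)).differentiableAt (by simp)
  have f1 : dx (dx w) s = dx (dx u) s - dx (dx v) s := by
    rw [dx_congr (ed s hs).1, dx_sub d1 d3]
  have f2 : dx (dy w) s = dx (dy u) s - dx (dy v) s := by
    rw [dx_congr (ed s hs).2, dx_sub d2 d4]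
  have f3 : dy (dy w) s = dy (dy u) s - dy (dy v) s := by
    rw [dy_congr (ed s hs).2, dy_sub d2 d4]
  refine le_trans (le_of_eq ?_) (hC s hs)
  congr 1
  rw [f1, f2, f3]
  linear_combination eu - ev

end HypTranslator

namespace HypTranslator

/-- The graph of `u` over the plane spanned by the first two vectors of an orthonormal frame, in the
direction of the third. -/
noncomputable def graphMap (b : OrthonormalBasis (Fin 3) ℝ E3) (u : ℂ → ℝ) (s : ℂ) : E3 :=
  s.re • b 0 + s.im • b 1 + u s • b 2

/-- The coordinates of a point of `ℝ³` along the first two vectors of an orthonormal frame. -/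
noncomputable def frameProj (b : OrthonormalBasis (Fin 3) ℝ E3) : E3 →L[ℝ] ℂ :=
  (innerSL ℝ (b 0)).smulRight (1 : ℂ) + (innerSL ℝ (b 1)).smulRight Complex.I

theorem frameProj_re (b : OrthonormalBasis (Fin 3) ℝ E3) (q : E3) :
    (frameProj b q).re = inner ℝ (b 0) q := by
  simp [frameProj]

theorem frameProj_im (b : OrthonormalBasis (Fin 3) ℝ E3) (q : E3) :
    (frameProj b q).im = inner ℝ (b 1) q := by
  simp [frameProj]

theorem inner_frame (b : OrthonormalBasis (Fin 3) ℝ E3) (x y z : ℝ) :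
    inner ℝ (b 0) (x • b 0 + y • b 1 + z • b 2) = x ∧
    inner ℝ (b 1) (x • b 0 + y • b 1 + z • b 2) = y ∧
    inner ℝ (b 2) (x • b 0 + y • b 1 + z • b 2) = z := by
  simp [inner_add_right, inner_smul_right]

theorem frame_expansion (b : OrthonormalBasis (Fin 3) ℝ E3) (q : E3) :
    q = (inner ℝ (b 0) q : ℝ) • b 0 + (inner ℝ (b 1) q : ℝ) • b 1 +
      (inner ℝ (b 2) q : ℝ) • b 2 := by
  conv_lhs => rw [← b.sum_repr' q]
  simp [Fin.sum_univ_three]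

theorem frame_inner (b : OrthonormalBasis (Fin 3) ℝ E3) (q r : E3) :
    inner ℝ q r = inner ℝ (b 0) q * inner ℝ (b 0) r + inner ℝ (b 1) q * inner ℝ (b 1) r +
      inner ℝ (b 2) q * inner ℝ (b 2) r := by
  rw [← b.sum_inner_mul_inner q r]
  simp [Fin.sum_univ_three, real_inner_comm]

theorem inner_e₃ (q : E3) : inner ℝ q e₃ = q 2 := by
  simp [e₃, EuclideanSpace.inner_single_right]

theorem frame_height (b : OrthonormalBasis (Fin 3) ℝ E3) (q : E3) :
    q 2 = inner ℝ (b 0) q * b 0 2 + inner ℝ (b 1) q * b 1 2 + inner ℝ (b 2) q * b 2 2 := by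
  rw [← inner_e₃ q, frame_inner b]
  simp only [inner_e₃]

theorem frameProj_graphMap (b : OrthonormalBasis (Fin 3) ℝ E3) (u : ℂ → ℝ) (s : ℂ) :
    frameProj b (graphMap b u s) = s := by
  obtain ⟨h0, h1, -⟩ := inner_frame b s.re s.im (u s)
  exact Complex.ext ((frameProj_re b _).trans h0) ((frameProj_im b _).trans h1)

theorem graphMap_height (b : OrthonormalBasis (Fin 3) ℝ E3) (u : ℂ → ℝ) (s : ℂ) :
    graphMap b u s 2 = graphHeight (fun j => b j 2) s (u s) := by
  simp [graphMap, graphHeight]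

theorem graphMap_frameProj (b : OrthonormalBasis (Fin 3) ℝ E3) (q : E3) {u : ℂ → ℝ}
    (hu : u (frameProj b q) = inner ℝ (b 2) q) : graphMap b u (frameProj b q) = q := by
  rw [graphMap, frameProj_re, frameProj_im, hu]
  exact (frame_expansion b q).symm

theorem fderiv_graphMap (b : OrthonormalBasis (Fin 3) ℝ E3) {u : ℂ → ℝ} {s : ℂ}
    (hu : DifferentiableAt ℝ u s) (v : ℂ) :
    fderiv ℝ (graphMap b u) s v = v.re • b 0 + v.im • b 1 + fderiv ℝ u s v • b 2 := by
  have h1 : HasFDerivAt (fun s : ℂ => s.re) Complex.reCLM s := Complex.reCLM.hasFDerivAt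
  have h2 : HasFDerivAt (fun s : ℂ => s.im) Complex.imCLM s := Complex.imCLM.hasFDerivAt
  have := ((h1.smul_const (b 0)).add (h2.smul_const (b 1))).add (hu.hasFDerivAt.smul_const (b 2))
  rw [show fderiv ℝ (graphMap b u) s = _ from this.fderiv]
  simp

theorem contDiffOn_graphMap (b : OrthonormalBasis (Fin 3) ℝ E3) {u : ℂ → ℝ} {U : Set ℂ}
    (hu : ContDiffOn ℝ ∞ u U) : ContDiffOn ℝ ∞ (graphMap b u) U :=
  ((contDiff_re.contDiffOn.smul contDiffOn_const).add
    (contDiff_im.contDiffOn.smul contDiffOn_const)).add (hu.smul contDiffOn_const)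

/-- The trace of the shape operator, read off from the coordinates of `∇η` in a basis. -/
theorem trace_neg_leftInverse_comp {V : Type*} [AddCommGroup V] [Module ℝ V] (D c : V →ₗ[ℝ] E3)
    (hD : Function.Injective D) (L : ℂ ≃ₗ[ℝ] V) {p q r t : ℝ}
    (h1 : c (L 1) = p • D (L 1) + q • D (L Complex.I))
    (h2 : c (L Complex.I) = r • D (L 1) + t • D (L Complex.I)) :
    LinearMap.trace ℝ V (-(D.leftInverse ∘ₗ c)) = -(p + t) := by
  have hk : LinearMap.ker D = ⊥ := LinearMap.ker_eq_bot.2 hD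
  set S := -(D.leftInverse ∘ₗ c) with hS
  have s1 : S (L 1) = -(p • L 1 + q • L Complex.I) := by
    rw [hS, LinearMap.neg_apply, LinearMap.comp_apply, h1, map_add, map_smul, map_smul,
      LinearMap.leftInverse_apply_of_inj hk, LinearMap.leftInverse_apply_of_inj hk]
  have s2 : S (L Complex.I) = -(r • L 1 + t • L Complex.I) := by
    rw [hS, LinearMap.neg_apply, LinearMap.comp_apply, h2, map_add, map_smul, map_smul,
      LinearMap.leftInverse_apply_of_inj hk, LinearMap.leftInverse_apply_of_inj hk]
  rw [← LinearMap.trace_conj' S L.symm, LinearMap.trace_eq_matrix_trace ℝ Complex.basisOneI,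
    Matrix.trace_fin_two, LinearMap.toMatrix_apply, LinearMap.toMatrix_apply]
  simp [LinearEquiv.conj_apply, s1, s2]
  ring

/-- The algebra behind the translator equation. The numbers `c, c₁, c₂` stand for the component of
the unit normal along the graph direction and its derivatives, `h₁, h₂` for the derivatives of the
height, `ν` for the height of the unnormalized normal. -/
theorem translator_algebra {p q p₁ p₂ q₂ c c₁ c₂ z h₁ h₂ ν f W t : ℝ} (hz : z ≠ 0) (hc : c ≠ 0)
    (hW : W = 1 + p ^ 2 + q ^ 2)
    (r₁ : c₁ * W + c * (p * p₁ + q * p₂) = z⁻¹ * h₁ * c * W)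
    (r₂ : c₂ * W + c * (p * p₂ + q * q₂) = z⁻¹ * h₂ * c * W)
    (ht : t = -((-(p₁ * c + p * c₁) + z⁻¹ * (h₁ * (p * c) - c * ν)) +
      (-(q₂ * c + q * c₂) + z⁻¹ * (h₂ * (q * c) - c * ν))))
    (hH : t / 2 = c * f / z ^ 2) :
    (1 + q ^ 2) * p₁ - 2 * (p * q) * p₂ + (1 + p ^ 2) * q₂ =
      2 * W * (f * (z⁻¹ * z⁻¹) - ν * z⁻¹) := by
  have hH' : t = 2 * (c * f * (z⁻¹ * z⁻¹)) := by
    have : t = 2 * (c * f / z ^ 2) := by linarith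
    rw [this]; field_simp
  apply mul_left_cancel₀ hc
  subst hW
  linear_combination (1 + p ^ 2 + q ^ 2) * hH' - (1 + p ^ 2 + q ^ 2) * ht - p * r₁ - q * r₂

/-- The derivative of the normalization `c² W = z²`. -/
theorem normalization_deriv {c c₁ z h W k : ℝ} (hz : z ≠ 0) (hc : c ≠ 0) (h0 : c ^ 2 * W = z ^ 2)
    (h1 : 2 * c * c₁ * W + c ^ 2 * (2 * k) = 2 * z * h) :
    c₁ * W + c * k = z⁻¹ * h * c * W := by
  apply mul_left_cancel₀ hc
  have : c * (z⁻¹ * h * c * W) = z⁻¹ * h * z ^ 2 := by rw [← h0]; ring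
  rw [this, pow_two, ← mul_assoc, mul_right_comm z⁻¹, inv_mul_cancel₀ hz, one_mul]
  linarith

end HypTranslator

namespace HypTranslator

section Graph

variable {H : Type*} [TopologicalSpace H]
  {I : ModelWithCorners ℝ (EuclideanSpace ℝ (Fin 2)) H}
  {M : Type*} [TopologicalSpace M] [ChartedSpace H M]

theorem dmap_comp {F : Type*} [NormedAddCommGroup F] [NormedSpace ℝ F] {f : M → E3} {τ : F → M}
    {s : F} (hf : MDifferentiableAt I 𝓘(ℝ, E3) f (τ s)) (hτ : MDifferentiableAt 𝓘(ℝ, F) I τ s)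
    (v : F) : dmap I f (τ s) (mfderiv 𝓘(ℝ, F) I τ s v) = fderiv ℝ (f ∘ τ) s v := by
  have := mfderiv_comp s hf hτ
  rw [mfderiv_eq_fderiv] at this
  rw [this]
  rfl

/-- The tangent space of a surface at a point of a local parametrization. -/
theorem exists_equiv_mfderiv {X : M → E3} {τ : ℂ → M} {s : ℂ}
    (hX : MDifferentiableAt I 𝓘(ℝ, E3) X (τ s)) (hτ : MDifferentiableAt 𝓘(ℝ, ℂ) I τ s)
    (hinj : Function.Injective (fderiv ℝ (X ∘ τ) s)) :
    ∃ L : ℂ ≃ₗ[ℝ] TangentSpace I (τ s), ∀ v : ℂ, L v = mfderiv 𝓘(ℝ, ℂ) I τ s v := by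
  set T : ℂ →ₗ[ℝ] EuclideanSpace ℝ (Fin 2) := (mfderiv 𝓘(ℝ, ℂ) I τ s).toLinearMap with hT
  have hTinj : Function.Injective T := by
    intro v w hvw
    apply hinj
    rw [← dmap_comp hX hτ v, ← dmap_comp hX hτ w]
    exact congrArg _ hvw
  have hdim : Module.finrank ℝ ℂ = Module.finrank ℝ (EuclideanSpace ℝ (Fin 2)) := by simp
  let L : ℂ ≃ₗ[ℝ] EuclideanSpace ℝ (Fin 2) := LinearEquiv.ofInjectiveOfFinrankEq T hTinj hdim
  exact ⟨L, fun v => rfl⟩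

theorem inner_dmap_normal {X η : M → E3} (hX : IsImmersedSurface I X) (hη : IsUnitNormal I X η)
    (x : M) (v : TangentSpace I x) : inner ℝ (dmap I X x v) (η x) = 0 := by
  have h := hη.normal x v
  have hz : X x 2 ≠ 0 := (hX.mem x).ne'
  rw [hypInner, div_eq_zero_iff] at h
  exact h.resolve_right (by positivity)

theorem inner_normal_self {X η : M → E3} (hX : IsImmersedSurface I X) (hη : IsUnitNormal I X η)
    (x : M) : inner ℝ (η x) (η x) = X x 2 ^ 2 := by
  have h := hη.unit x
  have hz : X x 2 ≠ 0 := (hX.mem x).ne'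
  rw [hypInner, div_eq_one_iff_eq (by positivity)] at h
  exact h

set_option maxHeartbeats 1000000 in
/-- A graph parametrizing a piece of a surface whose mean curvature is the normal component of the
Killing field `X` of the translations satisfies the quasilinear translator equation. -/
theorem isTranslatorGraph_of_meanCurvature {X η : M → E3} (hX : IsImmersedSurface I X)
    (hη : IsUnitNormal I X η) (b : OrthonormalBasis (Fin 3) ℝ E3) {τ : ℂ → M} {u : ℂ → ℝ} {a : ℂ}
    {ρ : ℝ} (hu : ContDiffOn ℝ ∞ u (Metric.ball a ρ))
    (hτ : ContMDiffOn 𝓘(ℝ, ℂ) I ∞ τ (Metric.ball a ρ))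
    (hXτ : ∀ s ∈ Metric.ball a ρ, X (τ s) = graphMap b u s)
    (hH : ∀ s ∈ Metric.ball a ρ,
      meanCurvature I X η (τ s) = hypInner (X (τ s)) (X (τ s)) (η (τ s))) :
    IsTranslatorGraph (fun j => b j 2) u a ρ := by
  have hzpos : ∀ s ∈ Metric.ball a ρ, 0 < graphHeight (fun j => b j 2) s (u s) := fun s hs => by
    rw [← graphMap_height, ← hXτ s hs]; exact hX.mem _
  refine ⟨hu, hzpos, fun s hs => ?_⟩
  have hnhds : ∀ {t}, t ∈ Metric.ball a ρ → Metric.ball a ρ ∈ 𝓝 t := fun ht =>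
    Metric.isOpen_ball.mem_nhds ht
  have mτ : ∀ t ∈ Metric.ball a ρ, MDifferentiableAt 𝓘(ℝ, ℂ) I τ t := fun t ht =>
    ((hτ t ht).contMDiffAt (hnhds ht)).mdifferentiableAt (by simp)
  have mX : ∀ x, MDifferentiableAt I 𝓘(ℝ, E3) X x := fun x =>
    (hX.smooth x).mdifferentiableAt (by simp)
  have mη : ∀ x, MDifferentiableAt I 𝓘(ℝ, E3) η x := fun x =>
    (hη.smooth x).mdifferentiableAt (by simp)
  have du : ∀ t ∈ Metric.ball a ρ, DifferentiableAt ℝ u t := fun t ht =>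
    (hu.contDiffAt (hnhds ht)).differentiableAt (by simp)
  have hdX : ∀ t ∈ Metric.ball a ρ, ∀ v : ℂ, dmap I X (τ t) (mfderiv 𝓘(ℝ, ℂ) I τ t v) =
      v.re • b 0 + v.im • b 1 + fderiv ℝ u t v • b 2 := by
    intro t ht v
    rw [dmap_comp (mX _) (mτ t ht), ← fderiv_graphMap b (du t ht)]
    have : X ∘ τ =ᶠ[𝓝 t] graphMap b u := by
      filter_upwards [hnhds ht] with r hr using hXτ r hr
    rw [this.fderiv_eq]
  have sN : ContDiffOn ℝ ∞ (η ∘ τ) (Metric.ball a ρ) :=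
    contMDiffOn_iff_contDiffOn.1 (hη.smooth.comp_contMDiffOn hτ)
  set n : Fin 3 → ℂ → ℝ := fun j t => inner ℝ (b j) (η (τ t)) with hn
  have sn : ∀ j, ContDiffOn ℝ ∞ (n j) (Metric.ball a ρ) := fun j =>
    contDiffOn_const.inner ℝ sN
  have dn : ∀ j, ∀ t ∈ Metric.ball a ρ, DifferentiableAt ℝ (n j) t := fun j t ht =>
    ((sn j).contDiffAt (hnhds ht)).differentiableAt (by simp)
  -- the normal is a multiple of `b 2 - u₁ b 0 - u₂ b 1`
  have hn0 : ∀ t ∈ Metric.ball a ρ, n 0 t = (-1) * (dx u t * n 2 t) := by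
    intro t ht
    have h := inner_dmap_normal hX hη (τ t) (mfderiv 𝓘(ℝ, ℂ) I τ t (1 : ℂ))
    rw [hdX t ht] at h
    simp only [inner_add_left, inner_smul_left, conj_trivial, Complex.one_re, Complex.one_im] at h
    simp only [hn, dx]
    linarith
  have hn1 : ∀ t ∈ Metric.ball a ρ, n 1 t = (-1) * (dy u t * n 2 t) := by
    intro t ht
    have h := inner_dmap_normal hX hη (τ t) (mfderiv 𝓘(ℝ, ℂ) I τ t Complex.I)
    rw [hdX t ht] at h
    simp only [inner_add_left, inner_smul_left, conj_trivial, Complex.I_re, Complex.I_im] at h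
    simp only [hn, dy]
    linarith
  set Z : ℂ → ℝ := fun t => t.re * b 0 2 + t.im * b 1 2 + u t * b 2 2 with hZ
  have hZX : ∀ t ∈ Metric.ball a ρ, X (τ t) 2 = Z t := fun t ht => by
    rw [hXτ t ht, graphMap_height]; rfl
  have hunit : ∀ t ∈ Metric.ball a ρ, n 2 t * n 2 t * (1 + dx u t * dx u t + dy u t * dy u t) =
      Z t * Z t := by
    intro t ht
    have h := inner_normal_self hX hη (τ t)
    rw [frame_inner b, hZX t ht] at h
    have h0 := hn0 t ht
    have h1 := hn1 t ht
    simp only [hn] at h0 h1 ⊢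
    rw [h0, h1] at h
    linarith
  have hn0' : n 0 =ᶠ[𝓝 s] fun t => (-1) * (dx u t * n 2 t) := by
    filter_upwards [hnhds hs] with t ht using hn0 t ht
  have hn1' : n 1 =ᶠ[𝓝 s] fun t => (-1) * (dy u t * n 2 t) := by
    filter_upwards [hnhds hs] with t ht using hn1 t ht
  have hunit' : (fun t => n 2 t * n 2 t * (1 + dx u t * dx u t + dy u t * dy u t)) =ᶠ[𝓝 s]
      fun t => Z t * Z t := by
    filter_upwards [hnhds hs] with t ht using hunit t ht
  have cu := hu.contDiffAt (hnhds hs)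
  have dus := du s hs
  have dux := (contDiffAt_dx cu).differentiableAt (by simp)
  have duy := (contDiffAt_dy cu).differentiableAt (by simp)
  have dn2 := dn 2 s hs
  set c := n 2 s with hc
  set p := dx u s with hp
  set q := dy u s with hq
  have hZpos : 0 < Z s := hzpos s hs
  have hsq := hunit s hs
  have hc0 : c ≠ 0 := by
    intro h
    rw [← hc, h] at hsq
    nlinarith
  have dZ : DifferentiableAt ℝ Z s := by rw [hZ]; fun_prop
  have hZx : dx Z s = b 0 2 + p * b 2 2 := by
    rw [hZ]
    simp (disch := fun_prop) only [dx_add, dx_mul, dx_const, dx_re, dx_im]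
    ring
  have hZy : dy Z s = b 1 2 + q * b 2 2 := by
    rw [hZ]
    simp (disch := fun_prop) only [dy_add, dy_mul, dy_const, dy_re, dy_im]
    ring
  have n0x : dx (n 0) s = -(dx (dx u) s * c + p * dx (n 2) s) := by
    rw [dx_congr hn0']
    simp (disch := fun_prop) only [dx_mul, dx_const]
    ring
  have n0y : dy (n 0) s = -(dx (dy u) s * c + p * dy (n 2) s) := by
    rw [dy_congr hn0']
    simp (disch := fun_prop) only [dy_mul, dy_const]
    rw [dx_dy_comm cu]
    ring
  have n1x : dx (n 1) s = -(dx (dy u) s * c + q * dx (n 2) s) := by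
    rw [dx_congr hn1']
    simp (disch := fun_prop) only [dx_mul, dx_const]
    ring
  have n1y : dy (n 1) s = -(dy (dy u) s * c + q * dy (n 2) s) := by
    rw [dy_congr hn1']
    simp (disch := fun_prop) only [dy_mul, dy_const]
    ring
  set W := 1 + p ^ 2 + q ^ 2 with hW
  have h0 : c ^ 2 * W = Z s ^ 2 := by
    rw [hW]; simp only [← hc, ← hp, ← hq] at hsq; linarith
  have hux : 2 * c * dx (n 2) s * W + c ^ 2 * (2 * (p * dx (dx u) s + q * dx (dy u) s)) =
      2 * Z s * (b 0 2 + p * b 2 2) := by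
    have := dx_congr hunit'
    simp (disch := fun_prop) only [dx_add, dx_mul, dx_const, hZx] at this
    simp only [← hc, ← hp, ← hq] at this
    rw [hW]; linarith
  have huy : 2 * c * dy (n 2) s * W + c ^ 2 * (2 * (p * dx (dy u) s + q * dy (dy u) s)) =
      2 * Z s * (b 1 2 + q * b 2 2) := by
    have := dy_congr hunit'
    simp (disch := fun_prop) only [dy_add, dy_mul, dy_const, hZy] at this
    rw [dx_dy_comm cu] at this
    simp only [← hc, ← hp, ← hq] at this
    rw [hW]; linarith
  have r1 := normalization_deriv hZpos.ne' hc0 h0 hux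
  have r2 := normalization_deriv hZpos.ne' hc0 h0 huy
  have e0 : n 0 s = -(p * c) := by rw [hn0 s hs]; ring
  have e1 : n 1 s = -(q * c) := by rw [hn1 s hs]; ring
  set ν := b 2 2 - p * b 0 2 - q * b 1 2 with hν
  have hN3 : η (τ s) 2 = c * ν := by
    rw [frame_height b, hν]
    simp only [hn] at e0 e1
    rw [e0, e1, hc]
    ring
  -- the covariant derivative of the normal in the frame
  have hcomp : ∀ (j : Fin 3) (v : ℂ), inner ℝ (b j) (fderiv ℝ (η ∘ τ) s v) =
      fderiv ℝ (n j) s v := by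
    intro j v
    have h1 : HasFDerivAt (η ∘ τ) (fderiv ℝ (η ∘ τ) s) s :=
      ((sN.contDiffAt (hnhds hs)).differentiableAt (by simp)).hasFDerivAt
    have h2 := (innerSL ℝ (b j)).hasFDerivAt.comp s h1
    have h3 : fderiv ℝ (n j) s = _ := h2.fderiv
    rw [h3]; rfl
  have hcov : ∀ v : ℂ, ∀ j : Fin 3,
      inner ℝ (b j) (covDeriv I X η (τ s) (mfderiv 𝓘(ℝ, ℂ) I τ s v)) = fderiv ℝ (n j) s v +
        (Z s)⁻¹ * (-((v.re * b 0 2 + v.im * b 1 2 + fderiv ℝ u s v * b 2 2) * n j s) -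
          c * ν * inner ℝ (b j) (v.re • b 0 + v.im • b 1 + fderiv ℝ u s v • b 2)) := by
    intro v j
    have h1 : covDeriv I X η (τ s) (mfderiv 𝓘(ℝ, ℂ) I τ s v) =
        fderiv ℝ (η ∘ τ) s v + christoffel (X (τ s))
          (v.re • b 0 + v.im • b 1 + fderiv ℝ u s v • b 2) (η (τ s)) := by
      rw [← dmap_comp (mη _) (mτ s hs), ← hdX s hs]
      rfl
    have h2 : inner ℝ (v.re • b 0 + v.im • b 1 + fderiv ℝ u s v • b 2) (η (τ s)) = 0 := by
      rw [← hdX s hs]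
      exact inner_dmap_normal hX hη _ _
    rw [h1, inner_add_right, hcomp, christoffel, h2, hZX s hs, hN3]
    simp only [zero_smul, zero_sub, inner_smul_right, inner_sub_right, inner_neg_right,
      PiLp.add_apply, PiLp.smul_apply, smul_eq_mul]
    rfl
  have fd : ∀ f : ℂ → ℝ, fderiv ℝ f s 1 = dx f s ∧ fderiv ℝ f s Complex.I = dy f s :=
    fun f => ⟨rfl, rfl⟩
  obtain ⟨i0, i1, i2⟩ := inner_frame b 1 0 p
  obtain ⟨k0, k1, k2⟩ := inner_frame b 0 1 q
  have c1 : ∀ j : Fin 3, inner ℝ (b j) (covDeriv I X η (τ s) (mfderiv 𝓘(ℝ, ℂ) I τ s (1 : ℂ))) =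
      dx (n j) s + (Z s)⁻¹ * (-((b 0 2 + p * b 2 2) * n j s) -
        c * ν * inner ℝ (b j) ((1 : ℝ) • b 0 + (0 : ℝ) • b 1 + p • b 2)) := by
    intro j
    rw [hcov, (fd _).1, (fd _).1, ← hp]
    simp only [Complex.one_re, Complex.one_im]
    ring
  have c2 : ∀ j : Fin 3, inner ℝ (b j) (covDeriv I X η (τ s) (mfderiv 𝓘(ℝ, ℂ) I τ s Complex.I)) =
      dy (n j) s + (Z s)⁻¹ * (-((b 1 2 + q * b 2 2) * n j s) -
        c * ν * inner ℝ (b j) ((0 : ℝ) • b 0 + (1 : ℝ) • b 1 + q • b 2)) := by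
    intro j
    rw [hcov, (fd _).2, (fd _).2, ← hq]
    simp only [Complex.I_re, Complex.I_im]
    ring
  have hdX1 : dmap I X (τ s) (mfderiv 𝓘(ℝ, ℂ) I τ s (1 : ℂ)) =
      (1 : ℝ) • b 0 + (0 : ℝ) • b 1 + p • b 2 := by
    rw [hdX s hs, (fd _).1]; simp [hp]
  have hdX2 : dmap I X (τ s) (mfderiv 𝓘(ℝ, ℂ) I τ s Complex.I) =
      (0 : ℝ) • b 0 + (1 : ℝ) • b 1 + q • b 2 := by
    rw [hdX s hs, (fd _).2]; simp [hq]
  have hginj : Function.Injective (fderiv ℝ (X ∘ τ) s) := by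
    intro v w hvw
    rw [← dmap_comp (mX _) (mτ s hs), ← dmap_comp (mX _) (mτ s hs), hdX s hs, hdX s hs] at hvw
    obtain ⟨v0, v1, -⟩ := inner_frame b v.re v.im (fderiv ℝ u s v)
    obtain ⟨w0, w1, -⟩ := inner_frame b w.re w.im (fderiv ℝ u s w)
    rw [hvw] at v0 v1
    exact Complex.ext (v0.symm.trans w0) (v1.symm.trans w1)
  obtain ⟨L, hL⟩ := exists_equiv_mfderiv (mX _) (mτ s hs) hginj
  have htr := trace_neg_leftInverse_comp (dmap I X (τ s)) (covDeriv I X η (τ s))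
    (hX.immersive _) L
    (p := -(dx (dx u) s * c + p * dx (n 2) s) + (Z s)⁻¹ * ((b 0 2 + p * b 2 2) * (p * c) - c * ν))
    (q := -(dx (dy u) s * c + q * dx (n 2) s) + (Z s)⁻¹ * ((b 0 2 + p * b 2 2) * (q * c)))
    (r := -(dx (dy u) s * c + p * dy (n 2) s) + (Z s)⁻¹ * ((b 1 2 + q * b 2 2) * (p * c)))
    (t := -(dy (dy u) s * c + q * dy (n 2) s) + (Z s)⁻¹ * ((b 1 2 + q * b 2 2) * (q * c) - c * ν))
    (by
      rw [hL, hL, hdX1, hdX2, frame_expansion b (covDeriv I X η (τ s) _), c1, c1, c1, i0, i1, i2,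
        n0x, n1x, e0, e1, ← hc]
      match_scalars
      · ring
      · ring
      · rw [hW] at r1; linear_combination r1)
    (by
      rw [hL, hL, hdX1, hdX2, frame_expansion b (covDeriv I X η (τ s) _), c2, c2, c2, k0, k1, k2,
        n0y, n1y, e0, e1, ← hc]
      match_scalars
      · ring
      · ring
      · rw [hW] at r2; linear_combination r2)
  have hHs := hH s hs
  have hXN : inner ℝ (X (τ s)) (η (τ s)) = c * (u s - (p * s.re + q * s.im)) := by
    rw [frame_inner b, hXτ s hs]
    obtain ⟨g0, g1, g2⟩ := inner_frame b s.re s.im (u s)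
    rw [graphMap, g0, g1, g2]
    simp only [hn] at e0 e1
    rw [e0, e1, hc]
    ring
  rw [meanCurvature, shapeOperator, hypInner, hXN, hZX s hs] at hHs
  have := translator_algebra hZpos.ne' hc0 hW r1 r2 htr hHs
  rw [this, translatorRhs, show graphHeight (fun j => b j 2) s (u s) = Z s from rfl]
  ring

end Graph

end HypTranslator

namespace HypTranslator

open MeasureTheory

/-! ### From the self-similar flow to the pointwise equation -/

/-- A smooth map from the plane to `ℝ³` has a null image. -/
theorem volume_image_eq_zero {f : EuclideanSpace ℝ (Fin 2) → E3}
    {T : Set (EuclideanSpace ℝ (Fin 2))} (hf : DifferentiableOn ℝ f T) :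
    volume (f '' T) = 0 := by
  -- `f` is extended to a map of `ℝ³`, constant in the last variable, and restricted to a plane
  let P : E3 →L[ℝ] EuclideanSpace ℝ (Fin 2) := LinearMap.toContinuousLinearMap
    { toFun := fun q => !₂[q 0, q 1]
      map_add' := fun q r => by ext i; fin_cases i <;> simp
      map_smul' := fun c q => by ext i; fin_cases i <;> simp }
  let V : Submodule ℝ E3 :=
    { carrier := {q | q 2 = 0}
      add_mem' := fun {q r} hq hr => by
        simp only [mem_ofPred_eq, PiLp.add_apply] at *; rw [hq, hr, add_zero]
      zero_mem' := by simp
      smul_mem' := fun c q hq => by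
        simp only [mem_ofPred_eq, PiLp.smul_apply] at *; rw [hq, smul_zero] }
  have hV : V ≠ ⊤ := by
    intro h
    have : e₃ ∈ V := by rw [h]; trivial
    have : e₃ 2 = 0 := this
    simp [e₃] at this
  have hs : volume ((V : Set E3) ∩ P ⁻¹' T) = 0 :=
    measure_mono_null inter_subset_left (Measure.addHaar_submodule volume V hV)
  have hd : DifferentiableOn ℝ (f ∘ P) ((V : Set E3) ∩ P ⁻¹' T) :=
    hf.comp P.differentiable.differentiableOn fun q hq => hq.2
  have := addHaar_image_eq_zero_of_differentiableOn_of_addHaar_eq_zero volume hd hs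
  refine measure_mono_null ?_ this
  rintro _ ⟨v, hv, rfl⟩
  have hPv : P !₂[v 0, v 1, 0] = v := by
    ext i; fin_cases i <;> simp [P]
  refine ⟨!₂[v 0, v 1, 0], ⟨?_, ?_⟩, ?_⟩
  · change (!₂[v 0, v 1, 0] : E3) 2 = 0
    simp
  · change P !₂[v 0, v 1, 0] ∈ T
    rwa [hPv]
  · change f (P !₂[v 0, v 1, 0]) = f v
    rw [hPv]

section

variable {H : Type*} [TopologicalSpace H]
  {I : ModelWithCorners ℝ (EuclideanSpace ℝ (Fin 2)) H}
  {M : Type*} [TopologicalSpace M] [ChartedSpace H M] [IsManifold I ∞ M]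

theorem volume_range_eq_zero [SecondCountableTopology M] {X : M → E3}
    (hX : ContMDiff I 𝓘(ℝ, E3) ∞ X) : volume (range X) = 0 := by
  obtain ⟨S, hS, hU⟩ := TopologicalSpace.countable_cover_nhds
    (fun x : M => extChartAt_source_mem_nhds (I := I) x)
  have hsub : range X ⊆ ⋃ x ∈ S, (X ∘ (extChartAt I x).symm) '' (extChartAt I x).target := by
    rintro _ ⟨y, rfl⟩
    have : y ∈ ⋃ x ∈ S, (extChartAt I x).source := by rw [hU]; trivial
    simp only [mem_iUnion] at this ⊢
    obtain ⟨x, hx, hy⟩ := this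
    exact ⟨x, hx, extChartAt I x y, (extChartAt I x).map_source hy,
      congrArg X ((extChartAt I x).left_inv hy)⟩
  refine measure_mono_null hsub ((measure_biUnion_null_iff hS).2 fun x _ => ?_)
  refine volume_image_eq_zero ?_
  have : ContMDiffOn 𝓘(ℝ, EuclideanSpace ℝ (Fin 2)) 𝓘(ℝ, E3) ∞ (X ∘ (extChartAt I x).symm)
      (extChartAt I x).target := hX.comp_contMDiffOn (contMDiffOn_extChartAt_symm x)
  exact (contMDiffOn_iff_contDiffOn.1 this).differentiableOn (by simp)

/-- A chart around an interior point, as a local parametrization defined on an open set. -/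
theorem exists_chart_param {x : M} (hx : I.IsInteriorPoint x) :
    ∃ σ : EuclideanSpace ℝ (Fin 2) → M, ∃ D : Set (EuclideanSpace ℝ (Fin 2)), ∃ s₀ ∈ D,
      IsOpen D ∧ σ s₀ = x ∧ ContMDiffOn 𝓘(ℝ, EuclideanSpace ℝ (Fin 2)) I ∞ σ D ∧
      (∀ s ∈ D, map σ (𝓝 s) = 𝓝 (σ s)) ∧
      (∀ s ∈ D, Function.Injective (mfderiv 𝓘(ℝ, EuclideanSpace ℝ (Fin 2)) I σ s)) ∧
      ∀ s ∈ D, I.IsInteriorPoint (σ s) := by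
  have hD : ∀ s ∈ interior (extChartAt I x).target, range I ∈ 𝓝 s := fun s hs =>
    mem_of_superset (mem_interior_iff_mem_nhds.1 hs) (extChartAt_target_subset_range x)
  refine ⟨(extChartAt I x).symm, interior (extChartAt I x).target, extChartAt I x x,
    ModelWithCorners.isInteriorPoint_iff.1 hx, isOpen_interior, extChartAt_to_inv x,
    (contMDiffOn_extChartAt_symm x).mono interior_subset, fun s hs => ?_, fun s hs => ?_,
    fun s hs => ?_⟩
  · have h := map_extChartAt_symm_nhdsWithin_range' (I := I)
      ((extChartAt I x).map_target (interior_subset hs))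
    rwa [(extChartAt I x).right_inv (interior_subset hs), nhdsWithin_eq_nhds.2 (hD s hs)] at h
  · have h := isInvertible_mfderivWithin_extChartAt_symm (I := I) (interior_subset hs)
    rw [mfderivWithin_of_mem_nhds (hD s hs)] at h
    exact h.injective
  · have hsrc := (extChartAt I x).map_target (interior_subset hs)
    rw [extChartAt_source] at hsrc
    rw [ModelWithCorners.isInteriorPoint_iff_of_mem_atlas (n := ∞) (by simp)
      (chart_mem_atlas H x) hsrc]
    change extChartAt I x ((extChartAt I x).symm s) ∈ interior (extChartAt I x).target
    rwa [(extChartAt I x).right_inv (interior_subset hs)]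

/-- The mean curvature equation of a translator: the mean curvature is the normal component of the
Killing field of the translations. The maps `e^{-t} F_t` take values in the null set `X(M)`, so the
differential of `(t, x) ↦ e^{-t} F_t(x)` is singular for `t > 0`, and by continuity for `t = 0`:
there `∂_t F - X` is tangent to the surface. -/
theorem IsTranslator.exists_normal [SecondCountableTopology M] {X : M → E3}
    (h : IsTranslator I X) : ∃ η : M → E3, IsImmersedSurface I X ∧ IsUnitNormal I X η ∧
      ∀ x, I.IsInteriorPoint x → meanCurvature I X η x = hypInner (X x) (X x) (η x) := by
  obtain ⟨δ, hδ, F, η, hF, rfl, hrange⟩ := h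
  have h0δ : (0 : ℝ) ∈ Ico 0 δ := ⟨le_rfl, hδ⟩
  have hX := hF.immersed 0 h0δ
  refine ⟨η 0, hX, hF.normal 0 h0δ, fun x hx => ?_⟩
  rw [← hF.evolution 0 h0δ x]
  obtain ⟨σ, D, s₀, hs₀, hD, hσx, hσ, -, hσinj, -⟩ := exists_chart_param hx
  set G : ℝ × EuclideanSpace ℝ (Fin 2) → E3 := fun q => Real.exp (-q.1) • F q.1 (σ q.2) with hG
  set Q : Set (ℝ × EuclideanSpace ℝ (Fin 2)) := Ico 0 δ ×ˢ D with hQ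
  have hGs : ContDiffOn ℝ ∞ G Q := by
    have h1 : ContMDiffOn 𝓘(ℝ, ℝ × EuclideanSpace ℝ (Fin 2)) (𝓘(ℝ, ℝ).prod I) ∞
        (fun q : ℝ × EuclideanSpace ℝ (Fin 2) => (q.1, σ q.2)) Q := by
      refine ContMDiffOn.prodMk ?_ ?_
      · exact contMDiffOn_iff_contDiffOn.2 contDiff_fst.contDiffOn
      · exact hσ.comp (contMDiffOn_iff_contDiffOn.2 contDiff_snd.contDiffOn) fun q hq => hq.2
    have h2 : ContMDiffOn 𝓘(ℝ, ℝ × EuclideanSpace ℝ (Fin 2)) 𝓘(ℝ, E3) ∞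
        (fun q : ℝ × EuclideanSpace ℝ (Fin 2) => F q.1 (σ q.2)) Q :=
      hF.smooth.comp h1 fun q hq => ⟨hq.1, mem_univ _⟩
    exact (contDiff_fst.neg.exp).contDiffOn.smul (contMDiffOn_iff_contDiffOn.1 h2)
  have hQu : UniqueDiffOn ℝ Q := (uniqueDiffOn_Ico 0 δ).prod hD.uniqueDiffOn
  have hGrange : ∀ q ∈ Q, G q ∈ range (F 0) := by
    rintro ⟨t, s⟩ ⟨ht, -⟩
    have : F t (σ s) ∈ range (F t) := mem_range_self _
    rw [hrange t ht] at this
    obtain ⟨y, hy, he⟩ := this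
    simp only [hG]
    rw [← he, smul_smul, ← Real.exp_add]
    simpa using hy
  have hnull : volume (range (F 0)) = 0 := volume_range_eq_zero hX.smooth
  let e : E3 ≃L[ℝ] ℝ × EuclideanSpace ℝ (Fin 2) := ContinuousLinearEquiv.ofFinrankEq (by simp)
  set d : ℝ → ℝ := fun t =>
    ((e : E3 →L[ℝ] ℝ × EuclideanSpace ℝ (Fin 2)).comp (fderivWithin ℝ G Q (t, s₀))).det with hd
  have hdc : ContinuousOn d (Ico 0 δ) := by
    have h1 : ContinuousOn (fun t : ℝ => fderivWithin ℝ G Q (t, s₀)) (Ico 0 δ) :=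
      (hGs.continuousOn_fderivWithin hQu (by simp)).comp (by fun_prop) fun t ht => ⟨ht, hs₀⟩
    exact ContinuousLinearMap.continuous_det.comp_continuousOn
      (continuousOn_const.clm_comp h1)
  -- for `t > 0` a regular point would give an open set in the image
  have hd0 : ∀ t ∈ Ioo 0 δ, d t = 0 := by
    intro t ht
    by_contra hne
    have hmem : Q ∈ 𝓝 (t, s₀) := prod_mem_nhds (Ico_mem_nhds ht.1 ht.2) (hD.mem_nhds hs₀)
    have hcd : ContDiffAt ℝ ∞ G (t, s₀) := hGs.contDiffAt hmem
    have hstrict : HasStrictFDerivAt G (fderivWithin ℝ G Q (t, s₀)) (t, s₀) := by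
      rw [fderivWithin_of_mem_nhds hmem]
      exact hcd.hasStrictFDerivAt (by simp)
    have hsurj : (fderivWithin ℝ G Q (t, s₀)).range = ⊤ := by
      have hdet : IsUnit (LinearMap.det ((e : E3 →L[ℝ] ℝ × EuclideanSpace ℝ (Fin 2)).comp
        (fderivWithin ℝ G Q (t, s₀))).toLinearMap) := isUnit_iff_ne_zero.2 hne
      rw [LinearMap.range_eq_top]
      intro y
      obtain ⟨v, hv⟩ := (LinearMap.equivOfDetNeZero _ hdet.ne_zero).surjective (e y)
      refine ⟨v, e.injective ?_⟩
      exact hv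
    have hmap := hstrict.map_nhds_eq_of_surj hsurj
    have : G '' Q ∈ 𝓝 (G (t, s₀)) := by
      rw [← hmap]; exact image_mem_map hmem
    have hpos := Measure.measure_pos_of_mem_nhds volume this
    refine hpos.ne' (measure_mono_null ?_ hnull)
    rintro _ ⟨q, hq, rfl⟩
    exact hGrange q hq
  have hdz : d 0 = 0 := by
    have hcl : (0 : ℝ) ∈ closure (Ioo 0 δ) := by
      rw [closure_Ioo hδ.ne]; exact ⟨le_rfl, hδ.le⟩
    have : (𝓝[Ioo 0 δ] (0 : ℝ)).NeBot := mem_closure_iff_nhdsWithin_neBot.1 hcl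
    have h1 : Tendsto d (𝓝[Ioo 0 δ] 0) (𝓝 (d 0)) :=
      (hdc 0 h0δ).mono_left (nhdsWithin_mono _ Ioo_subset_Ico_self)
    have h2 : Tendsto d (𝓝[Ioo 0 δ] 0) (𝓝 0) := by
      refine tendsto_const_nhds.congr' ?_
      filter_upwards [self_mem_nhdsWithin] with t ht using (hd0 t ht).symm
    exact tendsto_nhds_unique h1 h2
  set T := fderivWithin ℝ G Q (0, s₀) with hT
  have hTd : HasFDerivWithinAt G T Q (0, s₀) :=
    (hGs.differentiableOn (by simp) (0, s₀) ⟨h0δ, hs₀⟩).hasFDerivWithinAt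
  -- the restriction of the differential to the surface directions
  have mσ : MDifferentiableAt 𝓘(ℝ, EuclideanSpace ℝ (Fin 2)) I σ s₀ :=
    ((hσ s₀ hs₀).contMDiffAt (hD.mem_nhds hs₀)).mdifferentiableAt (by simp)
  have mX : MDifferentiableAt I 𝓘(ℝ, E3) (F 0) (σ s₀) :=
    (hX.smooth _).mdifferentiableAt (by simp)
  have hTs : ∀ v, T (0, v) = dmap I (F 0) (σ s₀)
      (mfderiv 𝓘(ℝ, EuclideanSpace ℝ (Fin 2)) I σ s₀ v) := by
    intro v
    rw [dmap_comp mX mσ]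
    have h1 : HasFDerivWithinAt (fun s : EuclideanSpace ℝ (Fin 2) => ((0 : ℝ), s))
        (ContinuousLinearMap.inr ℝ ℝ (EuclideanSpace ℝ (Fin 2))) D s₀ :=
      (hasFDerivAt_prodMk_right (0 : ℝ) s₀).hasFDerivWithinAt
    have h2 := (hTd.comp s₀ h1 fun s hs => ⟨h0δ, hs⟩).hasFDerivAt (hD.mem_nhds hs₀)
    have h3 : G ∘ (fun s => ((0 : ℝ), s)) = F 0 ∘ σ := by
      funext s; simp [hG]
    rw [h3] at h2
    rw [h2.fderiv]
    rfl
  have hTt : T (1, 0) = derivWithin (fun s => F s x) (Ico 0 δ) 0 - F 0 x := by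
    have h1 : HasDerivWithinAt (fun t : ℝ => (t, s₀)) ((1 : ℝ), (0 : EuclideanSpace ℝ (Fin 2)))
        (Ico 0 δ) 0 := ((hasDerivAt_id (0 : ℝ)).prodMk (hasDerivAt_const 0 s₀)).hasDerivWithinAt
    have h2 := hTd.comp_hasDerivWithinAt (0 : ℝ) h1
      (show MapsTo (fun t : ℝ => (t, s₀)) (Ico 0 δ) Q from fun t ht => ⟨ht, hs₀⟩)
    have h3 : G ∘ (fun t => (t, s₀)) = fun t => Real.exp (-t) • F t x := by
      funext t; simp [hG, hσx]
    rw [h3] at h2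
    have h4 : HasDerivWithinAt (fun t => Real.exp t) (1 : ℝ) (Ico 0 δ) 0 := by
      simpa using (Real.hasDerivAt_exp 0).hasDerivWithinAt
    have h5 := h4.smul h2
    have h6 : (fun t => F t x) = fun t => Real.exp t • (Real.exp (-t) • F t x) := by
      funext t; rw [smul_smul, ← Real.exp_add]; simp
    have h7 : HasDerivWithinAt (fun t => F t x) (T (1, 0) + F 0 x) (Ico 0 δ) 0 := by
      rw [h6]
      refine h5.congr_deriv ?_
      simp
    rw [h7.derivWithin (uniqueDiffOn_Ico 0 δ 0 h0δ)]
    abel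
  -- the singular differential kills a vector with nonzero time component
  obtain ⟨w, hw0, hw⟩ : ∃ w ≠ 0, T w = 0 := by
    have hdet : LinearMap.det ((e : E3 →L[ℝ] ℝ × EuclideanSpace ℝ (Fin 2)).comp T).toLinearMap
      = 0 := hdz
    have hb := LinearMap.bot_lt_ker_of_det_eq_zero hdet
    obtain ⟨w, hw, hw0⟩ := Submodule.exists_mem_ne_zero_of_ne_bot hb.ne'
    refine ⟨w, hw0, e.injective ?_⟩
    rw [map_zero]
    exact hw
  obtain ⟨α, v⟩ := w
  have hsplit : T (α, v) = α • T (1, 0) + T (0, v) := by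
    rw [← map_smul, ← map_add]; simp
  rw [hsplit] at hw
  have hα : α ≠ 0 := by
    rintro rfl
    rw [zero_smul, zero_add, hTs] at hw
    have h1 := hX.immersive (σ s₀) (hw.trans (map_zero _).symm)
    have h2 := hσinj s₀ hs₀ (h1.trans (map_zero _).symm)
    exact hw0 (by rw [h2]; rfl)
  have hn : inner ℝ (T (1, 0)) (η 0 x) = 0 := by
    have h1 : α * inner ℝ (T (1, 0)) (η 0 x) + inner ℝ (T (0, v)) (η 0 x) = 0 := by
      have := congrArg (fun y => inner ℝ y (η 0 x)) hw
      simpa [inner_add_left, inner_smul_left] using this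
    have h2 : inner ℝ (T (0, v)) (η 0 x) = 0 := by
      rw [hTs, ← hσx]
      exact inner_dmap_normal hX (hF.normal 0 h0δ) _ _
    rw [h2, add_zero] at h1
    exact (mul_eq_zero.1 h1).resolve_left hα
  rw [hTt, inner_sub_left, sub_eq_zero] at hn
  rw [hypInner, hypInner, hn]

end

end HypTranslator

namespace HypTranslator

/-! ### Surfaces as graphs -/

section

variable {H : Type*} [TopologicalSpace H]
  (I : ModelWithCorners ℝ (EuclideanSpace ℝ (Fin 2)) H)
  {M : Type*} [TopologicalSpace M] [ChartedSpace H M]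

/-- The local parametrization `τ` presents an open piece of the immersed surface `X` as the graph of
`u` over the disc of center `a` and radius `ρ`, relatively to the frame `b`. -/
structure IsGraphParam (X : M → E3) (b : OrthonormalBasis (Fin 3) ℝ E3) (u : ℂ → ℝ) (τ : ℂ → M)
    (a : ℂ) (ρ : ℝ) : Prop where
  smooth : ContDiffOn ℝ ∞ u (Metric.ball a ρ)
  param_smooth : ContMDiffOn 𝓘(ℝ, ℂ) I ∞ τ (Metric.ball a ρ)
  eq_graph : ∀ s ∈ Metric.ball a ρ, X (τ s) = graphMap b u s
  map_nhds : ∀ s ∈ Metric.ball a ρ, map τ (𝓝 s) = 𝓝 (τ s)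
  interior : ∀ s ∈ Metric.ball a ρ, I.IsInteriorPoint (τ s)

variable {I}

theorem IsGraphParam.mono {X : M → E3} {b : OrthonormalBasis (Fin 3) ℝ E3} {u : ℂ → ℝ} {τ : ℂ → M}
    {a : ℂ} {ρ σ : ℝ} (h : IsGraphParam I X b u τ a ρ) (hσ : σ ≤ ρ) :
    IsGraphParam I X b u τ a σ := by
  have hs := Metric.ball_subset_ball (x := a) hσ
  exact ⟨h.smooth.mono hs, h.param_smooth.mono hs, fun s h' => h.eq_graph s (hs h'),
    fun s h' => h.map_nhds s (hs h'), fun s h' => h.interior s (hs h')⟩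

/-- An immersed surface is, near an interior point, a graph over a plane to which its tangent plane
projects injectively. -/
theorem exists_isGraphParam [IsManifold I ∞ M] {X : M → E3} (hX : IsImmersedSurface I X) {x : M}
    (hx : I.IsInteriorPoint x) (b : OrthonormalBasis (Fin 3) ℝ E3)
    (hb : ∀ v : TangentSpace I x, frameProj b (dmap I X x v) = 0 → v = 0) :
    ∃ ρ > 0, ∃ u τ, IsGraphParam I X b u τ (frameProj b (X x)) ρ ∧ τ (frameProj b (X x)) = x := by
  obtain ⟨σ, D, s₀, hs₀, hD, hσx, hσ, hmap, hσinj, hint⟩ := exists_chart_param hx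
  subst hσx
  set g : EuclideanSpace ℝ (Fin 2) → ℂ := fun s => frameProj b (X (σ s)) with hg
  have hXσ : ContDiffOn ℝ ∞ (X ∘ σ) D :=
    contMDiffOn_iff_contDiffOn.1 (hX.smooth.comp_contMDiffOn hσ)
  have hgD : ContDiffOn ℝ ∞ g D := (frameProj b).contDiff.comp_contDiffOn hXσ
  have hgat : ∀ s ∈ D, ContDiffAt ℝ ∞ g s := fun s hs => hgD.contDiffAt (hD.mem_nhds hs)
  have hinj : Function.Injective (fderiv ℝ g s₀) := by
    have h1 : HasFDerivAt (X ∘ σ) (fderiv ℝ (X ∘ σ) s₀) s₀ :=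
      ((hXσ.contDiffAt (hD.mem_nhds hs₀)).differentiableAt (by simp)).hasFDerivAt
    have h2 : fderiv ℝ g s₀ = _ := ((frameProj b).hasFDerivAt.comp s₀ h1).fderiv
    rw [injective_iff_map_eq_zero]
    intro v hv
    rw [h2] at hv
    have hv' : frameProj b (fderiv ℝ (X ∘ σ) s₀ v) = 0 := hv
    rw [← dmap_comp ((hX.smooth _).mdifferentiableAt (by simp))
      (((hσ s₀ hs₀).contMDiffAt (hD.mem_nhds hs₀)).mdifferentiableAt (by simp))] at hv'
    exact hσinj s₀ hs₀ ((hb _ hv').trans (map_zero _).symm)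
  let f' : EuclideanSpace ℝ (Fin 2) ≃L[ℝ] ℂ := (LinearEquiv.ofInjectiveOfFinrankEq
    (fderiv ℝ g s₀).toLinearMap hinj (by simp)).toContinuousLinearEquiv
  have hf' : HasFDerivAt g (f' : EuclideanSpace ℝ (Fin 2) →L[ℝ] ℂ) s₀ := by
    have : (f' : EuclideanSpace ℝ (Fin 2) →L[ℝ] ℂ) = fderiv ℝ g s₀ := by ext v; rfl
    rw [this]
    exact ((hgat s₀ hs₀).differentiableAt (by simp)).hasFDerivAt
  let e := (hgat s₀ hs₀).toOpenPartialHomeomorph g hf' (by simp)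
  have he : ∀ s, e s = g s := fun s => rfl
  have hs₀e : s₀ ∈ e.source := (hgat s₀ hs₀).mem_toOpenPartialHomeomorph_source hf' (by simp)
  have ha : g s₀ ∈ e.target := e.map_source hs₀e
  have hsymm : e.symm (g s₀) = s₀ := e.left_inv hs₀e
  have hcont : Tendsto e.symm (𝓝 (g s₀)) (𝓝 s₀) := by
    have := e.symm.continuousAt ha
    rwa [ContinuousAt, hsymm] at this
  have hev : ∀ᶠ s in 𝓝 s₀, ∃ L : EuclideanSpace ℝ (Fin 2) ≃L[ℝ] ℂ, (L : _ →L[ℝ] ℂ) =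
      fderiv ℝ g s := by
    have h1 : ContinuousAt (fderiv ℝ g) s₀ :=
      ((hgat s₀ hs₀).fderiv_right (m := 0) (by simp)).continuousAt
    have h2 := ContinuousLinearEquiv.nhds f'
    have h3 : (f' : EuclideanSpace ℝ (Fin 2) →L[ℝ] ℂ) = fderiv ℝ g s₀ := by ext v; rfl
    rw [h3] at h2
    exact h1.eventually h2
  have hall : ∀ᶠ t in 𝓝 (g s₀), t ∈ e.target ∧ e.symm t ∈ D ∧
      ∃ L : EuclideanSpace ℝ (Fin 2) ≃L[ℝ] ℂ, (L : _ →L[ℝ] ℂ) = fderiv ℝ g (e.symm t) :=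
    (e.open_target.eventually_mem ha).and
      ((hcont.eventually (hD.eventually_mem hs₀)).and (hcont.eventually hev))
  obtain ⟨ρ, hρ, hball⟩ := Metric.eventually_nhds_iff_ball.1 hall
  have hsm : ContDiffOn ℝ ∞ e.symm (Metric.ball (g s₀) ρ) := by
    intro t ht
    obtain ⟨h1, h2, L, hL⟩ := hball t ht
    refine (e.contDiffAt_symm h1 (f₀' := L) ?_ (hgat _ h2)).contDiffWithinAt
    rw [hL]
    exact ((hgat _ h2).differentiableAt (by simp)).hasFDerivAt
  have hτ : ContMDiffOn 𝓘(ℝ, ℂ) I ∞ (fun t => σ (e.symm t)) (Metric.ball (g s₀) ρ) :=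
    hσ.comp (contMDiffOn_iff_contDiffOn.2 hsm) fun t ht => (hball t ht).2.1
  refine ⟨ρ, hρ, fun t => inner ℝ (b 2) (X (σ (e.symm t))), fun t => σ (e.symm t),
    ⟨?_, hτ, fun t ht => ?_, fun t ht => ?_, fun t ht => hint _ (hball t ht).2.1⟩, ?_⟩
  · exact contDiffOn_const.inner ℝ
      (contMDiffOn_iff_contDiffOn.1 (hX.smooth.comp_contMDiffOn hτ))
  · have h1 : frameProj b (X (σ (e.symm t))) = t := e.right_inv (hball t ht).1
    have h2 := graphMap_frameProj b (X (σ (e.symm t)))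
      (u := fun t => inner ℝ (b 2) (X (σ (e.symm t)))) (by rw [h1])
    rw [h1] at h2
    exact h2.symm
  · obtain ⟨h1, h2, -⟩ := hball t ht
    change map (σ ∘ e.symm) (𝓝 t) = 𝓝 (σ (e.symm t))
    rw [← Filter.map_map, e.symm.map_nhds_eq h1, hmap _ h2]
  · change σ (e.symm (g s₀)) = σ s₀
    rw [hsymm]

end

end HypTranslator

namespace HypTranslator

/-! ### Local coincidence of surfaces -/

section

variable {H : Type*} [TopologicalSpace H]
  {I : ModelWithCorners ℝ (EuclideanSpace ℝ (Fin 2)) H}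
  {M : Type*} [TopologicalSpace M] [ChartedSpace H M]

theorem IsGraphParam.isTranslatorGraph [IsManifold I ∞ M] [SecondCountableTopology M]
    {X : M → E3} (hX : IsTranslator I X) {b : OrthonormalBasis (Fin 3) ℝ E3} {u : ℂ → ℝ}
    {τ : ℂ → M} {a : ℂ} {ρ : ℝ} (h : IsGraphParam I X b u τ a ρ) :
    IsTranslatorGraph (fun j => b j 2) u a ρ := by
  obtain ⟨η, h1, h2, h3⟩ := hX.exists_normal
  exact isTranslatorGraph_of_meanCurvature h1 h2 b h.smooth h.param_smooth h.eq_graph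
    fun s hs => h3 _ (h.interior s hs)

theorem IsGraphParam.congr {X : M → E3} {b : OrthonormalBasis (Fin 3) ℝ E3} {u v : ℂ → ℝ}
    {τ : ℂ → M} {a : ℂ} {ρ : ℝ} (h : IsGraphParam I X b u τ a ρ)
    (huv : ∀ s ∈ Metric.ball a ρ, v s = u s) : IsGraphParam I X b v τ a ρ :=
  ⟨h.smooth.congr huv, h.param_smooth, fun s hs => by
    rw [h.eq_graph s hs, graphMap, graphMap, huv s hs], h.map_nhds, h.interior⟩

theorem IsGraphParam.map_nhds_comp {X : M → E3} {b : OrthonormalBasis (Fin 3) ℝ E3} {u : ℂ → ℝ}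
    {τ : ℂ → M} {a : ℂ} {ρ : ℝ} (h : IsGraphParam I X b u τ a ρ) {s : ℂ}
    (hs : s ∈ Metric.ball a ρ) : map X (𝓝 (τ s)) = map (graphMap b u) (𝓝 s) := by
  rw [← h.map_nhds s hs, map_map]
  refine Filter.map_congr ?_
  filter_upwards [Metric.isOpen_ball.mem_nhds hs] with t ht using h.eq_graph t ht

theorem IsGraphParam.isOpen_image {X : M → E3} {b : OrthonormalBasis (Fin 3) ℝ E3} {u : ℂ → ℝ}
    {τ : ℂ → M} {a : ℂ} {ρ : ℝ} (h : IsGraphParam I X b u τ a ρ) {U : Set ℂ} (hU : IsOpen U)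
    (hUρ : U ⊆ Metric.ball a ρ) : IsOpen (τ '' U) := by
  rw [isOpen_iff_mem_nhds]
  rintro _ ⟨s, hs, rfl⟩
  rw [← h.map_nhds s (hUρ hs)]
  exact image_mem_map (hU.mem_nhds hs)

theorem injective_frameProj_dmap {X : M → E3} (hX : IsImmersedSurface I X)
    (b : OrthonormalBasis (Fin 3) ℝ E3) {x : M} (ℓ : ℂ → ℝ) (hℓ : ℓ 0 = 0)
    (h : ∀ v : TangentSpace I x, inner ℝ (b 2) (dmap I X x v) = ℓ (frameProj b (dmap I X x v)))
    (v : TangentSpace I x) (hv : frameProj b (dmap I X x v) = 0) : v = 0 := by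
  apply hX.immersive x
  have h2 := h v
  have h0 := frameProj_re b (dmap I X x v)
  have h1 := frameProj_im b (dmap I X x v)
  rw [hv] at h0 h1 h2
  rw [hℓ] at h2
  rw [map_zero, frame_expansion b (dmap I X x v), ← h0, ← h1, h2]
  simp

/-- An orthonormal frame whose third vector is parallel to `N`. -/
theorem exists_frame {N : E3} (hN : N ≠ 0) : ∃ b : OrthonormalBasis (Fin 3) ℝ E3, ∀ q,
    inner ℝ q N = (0 : ℝ) → inner ℝ (b 2) q = (0 : ℝ) := by
  have h1 : ‖(‖N‖⁻¹ : ℝ) • N‖ = 1 := by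
    rw [norm_smul, norm_inv, norm_norm, inv_mul_cancel₀ (norm_ne_zero_iff.2 hN)]
  have h2 : Orthonormal ℝ (({2} : Set (Fin 3)).domRestrict fun _ : Fin 3 => (‖N‖⁻¹ : ℝ) • N) := by
    refine ⟨fun i => h1, fun i j hij => (hij (Subsingleton.elim i j)).elim⟩
  obtain ⟨b, hb⟩ := h2.exists_orthonormalBasis_extension_of_card_eq (by simp)
  refine ⟨b, fun q hq => ?_⟩
  rw [hb 2 rfl, inner_smul_left, real_inner_comm, hq, mul_zero]

theorem IsTranslator.exists_frame [IsManifold I ∞ M] [SecondCountableTopology M] {X : M → E3}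
    (hX : IsTranslator I X) (x : M) : ∃ b : OrthonormalBasis (Fin 3) ℝ E3,
      ∀ v, inner ℝ (b 2) (dmap I X x v) = (0 : ℝ) := by
  obtain ⟨η, h1, h2, -⟩ := hX.exists_normal
  have hN : η x ≠ 0 := by
    intro h
    have h3 := inner_normal_self h1 h2 x
    rw [h, inner_zero_left] at h3
    exact (pow_ne_zero 2 (h1.mem x).ne') h3.symm
  obtain ⟨b, hb⟩ := HypTranslator.exists_frame hN
  exact ⟨b, fun v => hb _ (inner_dmap_normal h1 h2 x v)⟩

/-- At a limit of points near which a surface is contained in the graph of a fixed smooth function,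
the surface is tangent to this graph, hence it is a graph too. -/
theorem exists_isGraphParam_of_frequently [IsManifold I ∞ M] {X : M → E3}
    (hX : IsImmersedSurface I X) {x : M} (hx : I.IsInteriorPoint x)
    (b : OrthonormalBasis (Fin 3) ℝ E3) {u : ℂ → ℝ}
    (hu : ∀ᶠ s in 𝓝 (frameProj b (X x)), ContDiffAt ℝ ∞ u s)
    (h : ∃ᶠ y in 𝓝 x, ∀ᶠ z in 𝓝 y, inner ℝ (b 2) (X z) = u (frameProj b (X z))) :
    ∃ ρ > 0, ∃ v τ, IsGraphParam I X b v τ (frameProj b (X x)) ρ ∧ τ (frameProj b (X x)) = x := by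
  refine exists_isGraphParam hX hx b
    (injective_frameProj_dmap hX b (fderiv ℝ u (frameProj b (X x))) (map_zero _) fun v => ?_)
  obtain ⟨σ, D, s₀, hs₀, hD, rfl, hσ, hmap, hσinj, -⟩ := exists_chart_param hx
  have hXσ : ContDiffAt ℝ ∞ (X ∘ σ) s₀ := (contMDiffOn_iff_contDiffOn.1
    (hX.smooth.comp_contMDiffOn hσ)).contDiffAt (hD.mem_nhds hs₀)
  set f : EuclideanSpace ℝ (Fin 2) → ℝ := fun s =>
    inner ℝ (b 2) ((X ∘ σ) s) - u (frameProj b ((X ∘ σ) s)) with hf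
  have hpr : ContDiffAt ℝ ∞ (fun s => frameProj b ((X ∘ σ) s)) s₀ :=
    (frameProj b).contDiff.contDiffAt.comp s₀ hXσ
  have hfs : ContDiffAt ℝ ∞ f s₀ :=
    (contDiffAt_const.inner ℝ hXσ).sub (hu.self_of_nhds.comp s₀ hpr)
  have hfreq : ∃ᶠ s in 𝓝 s₀, fderiv ℝ f s = 0 := by
    rw [← hmap s₀ hs₀, frequently_map] at h
    refine (h.and_eventually (hD.mem_nhds hs₀)).mono fun s hs => ?_
    have h1 : f =ᶠ[𝓝 s] fun _ => 0 := by
      have h2 := hs.1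
      rw [← hmap s hs.2, eventually_map] at h2
      filter_upwards [h2] with t ht
      simp only [hf, Function.comp_apply, ht, sub_self]
    rw [h1.fderiv_eq]
    simp
  have hzero : fderiv ℝ f s₀ = 0 := isClosed_singleton.mem_of_frequently_of_tendsto hfreq
    (hfs.fderiv_right (m := 0) (by simp)).continuousAt
  -- every tangent vector comes from the parameter plane
  obtain ⟨w, rfl⟩ : ∃ w : EuclideanSpace ℝ (Fin 2),
      mfderiv 𝓘(ℝ, EuclideanSpace ℝ (Fin 2)) I σ s₀ w = v := by
    let T : EuclideanSpace ℝ (Fin 2) →ₗ[ℝ] EuclideanSpace ℝ (Fin 2) :=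
      (mfderiv 𝓘(ℝ, EuclideanSpace ℝ (Fin 2)) I σ s₀).toLinearMap
    have hT : Function.Injective T := hσinj s₀ hs₀
    exact (LinearMap.injective_iff_surjective.1 hT) v
  have d0 := dmap_comp ((hX.smooth (σ s₀)).mdifferentiableAt (by simp))
    (((hσ s₀ hs₀).contMDiffAt (hD.mem_nhds hs₀)).mdifferentiableAt (by simp)) w
  erw [d0]
  have d1 : HasFDerivAt (X ∘ σ) (fderiv ℝ (X ∘ σ) s₀) s₀ :=
    (hXσ.differentiableAt (by simp)).hasFDerivAt
  have d2 := (frameProj b).hasFDerivAt.comp s₀ d1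
  have d3 := (hu.self_of_nhds.differentiableAt (by simp)).hasFDerivAt.comp s₀ d2
  have d4 := (((innerSL ℝ (b 2)).hasFDerivAt.comp s₀ d1).sub d3).fderiv
  have d5 : fderiv ℝ f s₀ = _ := d4
  have d6 := congrArg (fun L : EuclideanSpace ℝ (Fin 2) →L[ℝ] ℝ => L w) (d5.symm.trans hzero)
  exact sub_eq_zero.1 d6

end

section

variable {H₁ : Type*} [TopologicalSpace H₁]
  {I₁ : ModelWithCorners ℝ (EuclideanSpace ℝ (Fin 2)) H₁}
  {M₁ : Type*} [TopologicalSpace M₁] [ChartedSpace H₁ M₁]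
  {H₂ : Type*} [TopologicalSpace H₂]
  {I₂ : ModelWithCorners ℝ (EuclideanSpace ℝ (Fin 2)) H₂}
  {M₂ : Type*} [TopologicalSpace M₂] [ChartedSpace H₂ M₂]

/-- The sheet of `X₁` through `x` and the sheet of `X₂` through `y` have the same germ, expressed by
the equality of the image filters. -/
def SameSheet (X₁ : M₁ → E3) (X₂ : M₂ → E3) (x : M₁) (y : M₂) : Prop :=
  map X₁ (𝓝 x) = map X₂ (𝓝 y)

theorem SameSheet.apply_eq {X₁ : M₁ → E3} {X₂ : M₂ → E3} {x : M₁} {y : M₂}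
    (h : SameSheet X₁ X₂ x y) (h₁ : ContinuousAt X₁ x) (h₂ : ContinuousAt X₂ y) :
    X₁ x = X₂ y := by
  have h2 : Tendsto id (map X₁ (𝓝 x)) (𝓝 (X₂ y)) := by
    rw [show map X₁ (𝓝 x) = _ from h]; exact h₂
  exact tendsto_nhds_unique (f := X₁) h₁ h2

/-- Two graphs in the same frame have the same germ over a point iff the functions do: the function
of a graph is recovered from the image of the neighborhoods. -/
theorem sameSheet_iff {X₁ : M₁ → E3} {X₂ : M₂ → E3} {b : OrthonormalBasis (Fin 3) ℝ E3}
    {u₁ u₂ : ℂ → ℝ} {τ₁ : ℂ → M₁} {τ₂ : ℂ → M₂} {a₁ a₂ : ℂ} {ρ₁ ρ₂ : ℝ}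
    (h₁ : IsGraphParam I₁ X₁ b u₁ τ₁ a₁ ρ₁) (h₂ : IsGraphParam I₂ X₂ b u₂ τ₂ a₂ ρ₂) {s : ℂ}
    (hs₁ : s ∈ Metric.ball a₁ ρ₁) (hs₂ : s ∈ Metric.ball a₂ ρ₂) :
    SameSheet X₁ X₂ (τ₁ s) (τ₂ s) ↔ u₁ =ᶠ[𝓝 s] u₂ := by
  rw [SameSheet, h₁.map_nhds_comp hs₁, h₂.map_nhds_comp hs₂]
  refine ⟨fun h => ?_, fun h => Filter.map_congr (h.mono fun t ht => by simp only [graphMap, ht])⟩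
  have h3 : ∀ᶠ q in map (graphMap b u₂) (𝓝 s), inner ℝ (b 2) q = u₂ (frameProj b q) :=
    eventually_map.2 <| Eventually.of_forall fun t => by
      rw [frameProj_graphMap]
      exact (inner_frame b t.re t.im (u₂ t)).2.2
  rw [← h, eventually_map] at h3
  refine h3.mono fun t ht => ?_
  rw [frameProj_graphMap] at ht
  exact ((inner_frame b t.re t.im (u₁ t)).2.2).symm.trans ht

/-- A surface having the same germ as a graph is a graph in the same frame. -/
theorem SameSheet.exists_isGraphParam [IsManifold I₂ ∞ M₂] {X₁ : M₁ → E3} {X₂ : M₂ → E3}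
    (hX₁ : Continuous X₁) (hX₂ : IsImmersedSurface I₂ X₂) {b : OrthonormalBasis (Fin 3) ℝ E3}
    {u₁ : ℂ → ℝ} {τ₁ : ℂ → M₁} {a : ℂ} {ρ : ℝ} (h₁ : IsGraphParam I₁ X₁ b u₁ τ₁ a ρ) {s : ℂ}
    (hs : s ∈ Metric.ball a ρ) {y : M₂} (hy : I₂.IsInteriorPoint y)
    (h : SameSheet X₁ X₂ (τ₁ s) y) :
    ∃ σ > 0, ∃ u₂ τ₂, IsGraphParam I₂ X₂ b u₂ τ₂ s σ ∧ τ₂ s = y := by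
  have hp : frameProj b (X₂ y) = s := by
    rw [← h.apply_eq hX₁.continuousAt hX₂.smooth.continuous.continuousAt, h₁.eq_graph s hs,
      frameProj_graphMap]
  have h2 : ∀ᶠ q in map X₁ (𝓝 (τ₁ s)), inner ℝ (b 2) q = u₁ (frameProj b q) := by
    rw [h₁.map_nhds_comp hs]
    exact eventually_map.2 <| Eventually.of_forall fun t => by
      rw [frameProj_graphMap]
      exact (inner_frame b t.re t.im (u₁ t)).2.2
  rw [show map X₁ (𝓝 (τ₁ s)) = _ from h, eventually_map] at h2
  have h3 := exists_isGraphParam_of_frequently hX₂ hy b (u := u₁) (by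
    rw [hp]
    filter_upwards [Metric.isOpen_ball.mem_nhds hs] with t ht using
      h₁.smooth.contDiffAt (Metric.isOpen_ball.mem_nhds ht))
    (h2.eventually_nhds.frequently)
  rwa [hp] at h3

theorem SameSheet.exists_graph [IsManifold I₁ ∞ M₁] [SecondCountableTopology M₁]
    [IsManifold I₂ ∞ M₂] {X₁ : M₁ → E3} {X₂ : M₂ → E3} (hX₁ : IsTranslator I₁ X₁)
    (hX₂ : IsImmersedSurface I₂ X₂) {x : M₁} (hx : I₁.IsInteriorPoint x) {y : M₂}
    (hy : I₂.IsInteriorPoint y) (h : SameSheet X₁ X₂ x y) :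
    ∃ b u a ρ, ∃ τ₁ τ₂, 0 < ρ ∧ IsGraphParam I₁ X₁ b u τ₁ a ρ ∧ IsGraphParam I₂ X₂ b u τ₂ a ρ ∧
      τ₁ a = x ∧ τ₂ a = y := by
  obtain ⟨b, hb⟩ := hX₁.exists_frame x
  obtain ⟨η, hX₁', -⟩ := hX₁.exists_normal
  obtain ⟨ρ₁, hρ₁, u₁, τ₁, h₁, hτ₁⟩ := HypTranslator.exists_isGraphParam hX₁' hx b
    (injective_frameProj_dmap hX₁' b (fun _ => 0) rfl hb)
  have ha₁ := Metric.mem_ball_self (x := frameProj b (X₁ x)) hρ₁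
  rw [← hτ₁] at h
  obtain ⟨ρ₂, hρ₂, u₂, τ₂, h₂, hτ₂⟩ := h.exists_isGraphParam hX₁'.smooth.continuous hX₂ h₁ ha₁ hy
  have ha₂ := Metric.mem_ball_self (x := frameProj b (X₁ x)) hρ₂
  rw [← hτ₂, sameSheet_iff h₁ h₂ ha₁ ha₂] at h
  obtain ⟨r, hr, hball⟩ := Metric.eventually_nhds_iff_ball.1 h
  have hρ : min r (min ρ₁ ρ₂) ≤ ρ₁ := (min_le_right _ _).trans (min_le_left _ _)
  have hρ' : min r (min ρ₁ ρ₂) ≤ ρ₂ := (min_le_right _ _).trans (min_le_right _ _)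
  exact ⟨b, u₁, _, min r (min ρ₁ ρ₂), τ₁, τ₂, by positivity, h₁.mono hρ, (h₂.mono hρ').congr
    fun s hs => hball s (Metric.ball_subset_ball (min_le_left _ _) hs), hτ₁, hτ₂⟩

/-- Of two graphs in the direction `b 2` through a common point, one of them contained in a regular
level set and the other on one side of it, one lies above the other. -/
theorem eventually_graph_le {b : OrthonormalBasis (Fin 3) ℝ E3} {u v : ℂ → ℝ} {a : ℂ}
    {f : E3 → ℝ} {W : Set E3} (hW : IsOpen W) (hf : ContDiffOn ℝ ∞ f W) (huv : u a = v a)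
    (hu : ContinuousAt u a) (hv : DifferentiableAt ℝ v a) (ha : graphMap b v a ∈ W)
    (hreg : fderiv ℝ f (graphMap b v a) ≠ 0) (hfv : ∀ᶠ s in 𝓝 a, f (graphMap b v s) = 0)
    (hfu : ∀ᶠ s in 𝓝 a, 0 ≤ f (graphMap b u s)) :
    (∀ᶠ s in 𝓝 a, u s ≤ v s) ∨ ∀ᶠ s in 𝓝 a, v s ≤ u s := by
  set p := graphMap b v a with hp
  set c := fderiv ℝ f p (b 2) with hc
  have hfd : ∀ q ∈ W, DifferentiableAt ℝ f q := fun q hq =>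
    (hf.contDiffAt (hW.mem_nhds hq)).differentiableAt (by simp)
  have hgm : HasFDerivAt (graphMap b v) (fderiv ℝ (graphMap b v) a) a := by
    have h1 : HasFDerivAt (fun s : ℂ => s.re) Complex.reCLM a := Complex.reCLM.hasFDerivAt
    have h2 : HasFDerivAt (fun s : ℂ => s.im) Complex.imCLM a := Complex.imCLM.hasFDerivAt
    exact (((h1.smul_const (b 0)).add (h2.smul_const (b 1))).add
      (hv.hasFDerivAt.smul_const (b 2))).differentiableAt.hasFDerivAt
  -- the differential of `f` is transverse to the direction of the graphs
  have hc0 : c ≠ 0 := by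
    intro h0
    have h1 : ∀ w : ℂ, fderiv ℝ f p (fderiv ℝ (graphMap b v) a w) = 0 := by
      intro w
      have h2 := ((hfd p ha).hasFDerivAt.comp a hgm).fderiv
      have h3 : f ∘ graphMap b v =ᶠ[𝓝 a] fun _ => 0 := hfv
      rw [h3.fderiv_eq, fderiv_const_apply] at h2
      exact (congrArg (fun L : ℂ →L[ℝ] ℝ => L w) h2).symm
    have h4 := h1 1
    have h5 := h1 Complex.I
    simp only [fderiv_graphMap b hv, map_add, map_smul, ← hc, h0, Complex.one_re, Complex.one_im,
      Complex.I_re, Complex.I_im, smul_eq_mul, one_mul, zero_mul, mul_zero, add_zero,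
      zero_add] at h4 h5
    apply hreg
    ext q
    rw [frame_expansion b q]
    simp only [map_add, map_smul, ← hc, h0, h4, h5, smul_zero, add_zero,
      zero_apply]
  have hcont : ContinuousAt (fun q => c * fderiv ℝ f q (b 2)) p :=
    (((hf.contDiffAt (hW.mem_nhds ha)).fderiv_right (m := 0) (by simp)).continuousAt.clm_apply
      continuousAt_const).const_mul c
  have hpos : 0 < c * fderiv ℝ f p (b 2) := mul_self_pos.2 hc0
  have hev : ∀ᶠ q in 𝓝 p, q ∈ W ∧ 0 < c * fderiv ℝ f q (b 2) :=
    (hW.eventually_mem ha).and (hcont.eventually (lt_mem_nhds hpos))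
  obtain ⟨r, hr, hball⟩ := Metric.eventually_nhds_iff_ball.1 hev
  have hgu : ContinuousAt (graphMap b u) a :=
    ((Complex.continuous_re.continuousAt.smul continuousAt_const).add
      (Complex.continuous_im.continuousAt.smul continuousAt_const)).add
      (hu.smul continuousAt_const)
  have hpu : graphMap b u a = p := by rw [hp, graphMap, graphMap, huv]
  have hmain : ∀ᶠ s in 𝓝 a, 0 ≤ c * (u s - v s) := by
    have e1 := hgu.eventually_mem (Metric.ball_mem_nhds (graphMap b u a) hr)
    have e2 := hgm.continuousAt.eventually_mem (Metric.ball_mem_nhds (graphMap b v a) hr)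
    rw [hpu] at e1
    filter_upwards [e1, e2, hfv, hfu] with s m1 m2 fv fu
    obtain ⟨ξ, hξ, hmvt⟩ := domain_mvt (f := f) (f' := fun q => fderiv ℝ f q)
      (fun q hq => (hfd q (hball q hq).1).hasFDerivAt.hasFDerivWithinAt)
      (convex_ball p r) m2 m1
    have hdiff : graphMap b u s - graphMap b v s = (u s - v s) • b 2 := by
      simp only [graphMap]; module
    rw [hdiff, map_smul, fv, sub_zero, smul_eq_mul] at hmvt
    have hξ' := (hball ξ ((convex_ball p r).segment_subset m2 m1 hξ)).2
    rw [hmvt] at fu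
    by_contra! hneg
    nlinarith [mul_nonneg fu (sq_nonneg c), mul_pos hξ' (neg_pos.2 hneg)]
  rcases hc0.lt_or_gt with h | h
  · left
    filter_upwards [hmain] with s hs
    nlinarith
  · right
    filter_upwards [hmain] with s hs
    nlinarith

/-- The local part of the tangency principle: over the common tangent plane the difference of the
two graphs has a sign and vanishes at the point of tangency, so the strong maximum principle
applies. -/
theorem sameSheet_of_liesOnOneSide [IsManifold I₁ ∞ M₁] [SecondCountableTopology M₁]
    [IsManifold I₂ ∞ M₂] [SecondCountableTopology M₂] {X₁ : M₁ → E3} {X₂ : M₂ → E3}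
    (hX₁ : IsTranslator I₁ X₁) (hX₂ : IsTranslator I₂ X₂) {p₁ : M₁} {p₂ : M₂}
    (hp₁ : I₁.IsInteriorPoint p₁) (hp₂ : I₂.IsInteriorPoint p₂) (hp : X₁ p₁ = X₂ p₂)
    (htangent : LinearMap.range (dmap I₁ X₁ p₁) = LinearMap.range (dmap I₂ X₂ p₂))
    (hside : LiesOnOneSide X₁ p₁ X₂ p₂) : SameSheet X₁ X₂ p₁ p₂ := by
  obtain ⟨b, hb⟩ := hX₁.exists_frame p₁
  obtain ⟨-, hi₁, -⟩ := hX₁.exists_normal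
  obtain ⟨-, hi₂, -⟩ := hX₂.exists_normal
  have hb₂ : ∀ v, inner ℝ (b 2) (dmap I₂ X₂ p₂ v) = (0 : ℝ) := by
    intro v
    obtain ⟨w, hw⟩ : dmap I₂ X₂ p₂ v ∈ LinearMap.range (dmap I₁ X₁ p₁) := by
      rw [htangent]; exact LinearMap.mem_range_self _ v
    rw [← hw, hb]
  obtain ⟨ρ₁, hρ₁, u₁, τ₁, h₁, hτ₁⟩ := exists_isGraphParam hi₁ hp₁ b
    (injective_frameProj_dmap hi₁ b (fun _ => 0) rfl hb)
  obtain ⟨ρ₂, hρ₂, u₂, τ₂, h₂, hτ₂⟩ := exists_isGraphParam hi₂ hp₂ b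
    (injective_frameProj_dmap hi₂ b (fun _ => 0) rfl hb₂)
  rw [hp] at h₁ hτ₁
  set a := frameProj b (X₂ p₂) with ha
  set ρ := min ρ₁ ρ₂ with hρ
  have hρ0 : 0 < ρ := lt_min hρ₁ hρ₂
  replace h₁ := h₁.mono (min_le_left ρ₁ ρ₂)
  replace h₂ := h₂.mono (min_le_right ρ₁ ρ₂)
  have hmem := Metric.mem_ball_self (x := a) hρ0
  have hn := Metric.ball_mem_nhds a hρ0
  have t₁ : Tendsto τ₁ (𝓝 a) (𝓝 p₁) := by rw [← hτ₁, ← h₁.map_nhds a hmem]; exact tendsto_map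
  have t₂ : Tendsto τ₂ (𝓝 a) (𝓝 p₂) := by rw [← hτ₂, ← h₂.map_nhds a hmem]; exact tendsto_map
  have g₁ : graphMap b u₁ a = X₂ p₂ := by rw [← h₁.eq_graph a hmem, hτ₁, hp]
  have g₂ : graphMap b u₂ a = X₂ p₂ := by rw [← h₂.eq_graph a hmem, hτ₂]
  have hu : u₁ a = u₂ a := by
    rw [← (inner_frame b a.re a.im (u₁ a)).2.2, ← (inner_frame b a.re a.im (u₂ a)).2.2]
    exact congrArg _ (g₁.trans g₂.symm)
  obtain ⟨U₁, hU₁, U₂, hU₂, W, -, hW, hpW, f, hf, hreg, hzero, hnn⟩ := hside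
  have hXW₁ : ∀ᶠ s in 𝓝 a, X₁ (τ₁ s) ∈ W := by
    refine (hi₁.smooth.continuous.continuousAt.tendsto.comp t₁).eventually_mem ?_
    rw [hp]; exact hW.mem_nhds hpW
  have hXW₂ : ∀ᶠ s in 𝓝 a, X₂ (τ₂ s) ∈ W :=
    (hi₂.smooth.continuous.continuousAt.tendsto.comp t₂).eventually_mem (hW.mem_nhds hpW)
  have hsides := eventually_graph_le (b := b) (u := u₁) (v := u₂) (a := a) hW hf hu
    (h₁.smooth.continuousOn.continuousAt hn) ((h₂.smooth.contDiffAt hn).differentiableAt (by simp))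
    (by rwa [g₂]) (by rw [g₂]; exact hreg _ hpW)
    (by
      filter_upwards [hn, t₂.eventually_mem hU₂, hXW₂] with s m1 m2 m3
      rw [← h₂.eq_graph s m1]
      have : X₂ (τ₂ s) ∈ X₂ '' U₂ ∩ W := ⟨mem_image_of_mem _ m2, m3⟩
      rw [hzero] at this
      exact this.2)
    (by
      filter_upwards [hn, t₁.eventually_mem hU₁, hXW₁] with s m1 m2 m3
      rw [← h₁.eq_graph s m1]
      exact hnn _ ⟨mem_image_of_mem _ m2, m3⟩)
  have q₁ := h₁.isTranslatorGraph hX₁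
  have q₂ := h₂.isTranslatorGraph hX₂
  rw [← hτ₁, ← hτ₂, sameSheet_iff h₁ h₂ hmem hmem]
  rcases hsides with hle | hle
  · obtain ⟨r, hr, hball⟩ := Metric.eventually_nhds_iff_ball.1 hle
    have := ((q₂.isEllipticIneq_sub q₁).mono (b := a) (σ := min r ρ)
      (by rw [dist_self, zero_add]; exact min_le_right _ _)).eventually_eq_zero (lt_min hr hρ0)
      (fun s hs => sub_nonneg.2 (hball s (Metric.ball_subset_ball (min_le_left _ _) hs)))
      (sub_eq_zero.2 hu.symm)
    exact this.mono fun s hs => (sub_eq_zero.1 hs).symm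
  · obtain ⟨r, hr, hball⟩ := Metric.eventually_nhds_iff_ball.1 hle
    have := ((q₁.isEllipticIneq_sub q₂).mono (b := a) (σ := min r ρ)
      (by rw [dist_self, zero_add]; exact min_le_right _ _)).eventually_eq_zero (lt_min hr hρ0)
      (fun s hs => sub_nonneg.2 (hball s (Metric.ball_subset_ball (min_le_left _ _) hs)))
      (sub_eq_zero.2 hu)
    exact this.mono fun s hs => sub_eq_zero.1 hs

end

end HypTranslator

namespace HypTranslator

/-! ### The induced distance -/

theorem hypNorm_eq {p : E3} (hp : p ∈ upperHalfSpace) (w : E3) : hypNorm p w = ‖w‖ / p 2 := by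
  have hz : 0 < p 2 := hp
  rw [hypNorm, hypInner, real_inner_self_eq_norm_sq, ← div_pow, Real.sqrt_sq (by positivity)]

theorem hypNorm_smul (p : E3) (c : ℝ) (w : E3) : hypNorm p (c • w) = |c| * hypNorm p w := by
  rw [hypNorm, hypNorm, ← Real.sqrt_sq_eq_abs, ← Real.sqrt_mul (sq_nonneg c), hypInner, hypInner,
    inner_smul_left, inner_smul_right, conj_trivial]
  ring_nf

theorem norm_frameProj_le (b : OrthonormalBasis (Fin 3) ℝ E3) (q : E3) :
    ‖frameProj b q‖ ≤ ‖q‖ := by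
  refine le_of_sq_le_sq ?_ (norm_nonneg q)
  rw [← real_inner_self_eq_norm_sq q, frame_inner b q q, ← Complex.normSq_eq_norm_sq,
    Complex.normSq_apply, frameProj_re, frameProj_im]
  nlinarith [mul_self_nonneg (inner ℝ (b 2) q : ℝ)]

section

variable {H : Type*} [TopologicalSpace H]
  {I : ModelWithCorners ℝ (EuclideanSpace ℝ (Fin 2)) H}
  {M : Type*} [TopologicalSpace M] [ChartedSpace H M]

variable (I) in
/-- The norm on the tangent spaces of `M` of the metric induced by `X`. -/
@[reducible] noncomputable def inducedENorm (X : M → E3) (p : M) : ENorm (TangentSpace I p) :=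
  ⟨fun v => ENNReal.ofReal (hypNorm (X p) (dmap I X p v))⟩

theorem inducedENorm_smulClass (X : M → E3) (p : M) :
    letI := inducedENorm I X p
    ENormSMulClass ℝ (TangentSpace I p) := by
  let := inducedENorm I X p
  refine ⟨fun c v => ?_⟩
  change ENNReal.ofReal _ = ‖c‖ₑ * ENNReal.ofReal _
  rw [map_smul, hypNorm_smul, ENNReal.ofReal_mul (abs_nonneg c), Real.enorm_eq_ofReal_abs]

theorem inducedEDist_self (X : M → E3) (x : M) : inducedEDist I X x x = 0 := by
  let := inducedENorm I X
  have := inducedENorm_smulClass (I := I) X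
  exact Manifold.riemannianEDist_self (I := I)

theorem inducedEDist_comm (X : M → E3) (x y : M) :
    inducedEDist I X x y = inducedEDist I X y x := by
  let := inducedENorm I X
  have := inducedENorm_smulClass (I := I) X
  exact Manifold.riemannianEDist_comm (I := I)

theorem inducedEDist_triangle (X : M → E3) (x y z : M) :
    inducedEDist I X x z ≤ inducedEDist I X x y + inducedEDist I X y z := by
  let := inducedENorm I X
  have := inducedENorm_smulClass (I := I) X
  exact Manifold.riemannianEDist_triangle (I := I)

theorem mdifferentiableAt_of_contMDiffOn_Icc {γ : ℝ → M} {a b t : ℝ}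
    (hγ : ContMDiffOn 𝓘(ℝ, ℝ) I 1 γ (Icc a b)) (ht : t ∈ Ioo a b) :
    MDifferentiableAt 𝓘(ℝ, ℝ) I γ t :=
  ((hγ t (Ioo_subset_Icc_self ht)).contMDiffAt (Icc_mem_nhds ht.1 ht.2)).mdifferentiableAt
    (by simp)

theorem inducedEDist_le {X : M → E3} (hX : ContMDiff I 𝓘(ℝ, E3) ∞ X) {γ : ℝ → M} {a b K : ℝ}
    (hab : a ≤ b) (hγ : ContMDiffOn 𝓘(ℝ, ℝ) I 1 γ (Icc a b))
    (hK : ∀ t ∈ Ioo a b, hypNorm (X (γ t)) (deriv (X ∘ γ) t) ≤ K) :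
    inducedEDist I X (γ a) (γ b) ≤ ENNReal.ofReal (K * (b - a)) := by
  let := inducedENorm I X
  have := inducedENorm_smulClass (I := I) X
  refine (Manifold.riemannianEDist_le_pathELength (I := I) hγ rfl rfl hab).trans ?_
  rw [Manifold.pathELength_eq_lintegral_mfderiv_Ioo]
  have h1 : ∀ t ∈ Ioo a b, ‖mfderiv 𝓘(ℝ, ℝ) I γ t (1 : ℝ)‖ₑ ≤ ENNReal.ofReal K := by
    intro t ht
    change ENNReal.ofReal (hypNorm (X (γ t)) (dmap I X (γ t) (mfderiv 𝓘(ℝ, ℝ) I γ t (1 : ℝ)))) ≤ _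
    rw [dmap_comp ((hX _).mdifferentiableAt (by simp)) (mdifferentiableAt_of_contMDiffOn_Icc hγ ht)]
    exact ENNReal.ofReal_le_ofReal (hK t ht)
  refine (MeasureTheory.setLIntegral_mono' measurableSet_Ioo h1).trans ?_
  rw [MeasureTheory.setLIntegral_const, Real.volume_Ioo,
    ← ENNReal.ofReal_mul' (sub_nonneg.2 hab)]

/-- The topology of the induced distance is finer than the topology of the surface: a path leaving
a graph over a disc is at least as long as its projection to the disc. -/
theorem IsGraphParam.exists_inducedEDist_lt [T2Space M] {X : M → E3} (hX : IsImmersedSurface I X)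
    {b : OrthonormalBasis (Fin 3) ℝ E3} {u : ℂ → ℝ} {τ : ℂ → M} {a : ℂ} {ρ : ℝ} (hρ : 0 < ρ)
    (h : IsGraphParam I X b u τ a ρ) {V : Set M} (hV : V ∈ 𝓝 (τ a)) :
    ∃ ε > 0, ∀ y, inducedEDist I X (τ a) y < ε → y ∈ V := by
  have ha := Metric.mem_ball_self (x := a) hρ
  have hev : ∀ᶠ s in 𝓝 a, s ∈ Metric.ball a ρ ∧ τ s ∈ V := by
    refine (Metric.isOpen_ball.eventually_mem ha).and ?_
    have hV' : ∀ᶠ z in 𝓝 (τ a), z ∈ V := hV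
    rwa [← h.map_nhds a ha, eventually_map] at hV'
  obtain ⟨r, hr, hball⟩ := Metric.nhds_basis_closedBall.eventually_iff.1 hev
  have hτc : ContinuousOn τ (Metric.closedBall a r) :=
    h.param_smooth.continuousOn.mono fun s hs => (hball hs).1
  have hK : IsCompact (τ '' Metric.closedBall a r) :=
    (isCompact_closedBall a r).image_of_continuousOn hτc
  have hzc : Continuous fun x => X x 2 := by
    have := hX.smooth.continuous
    fun_prop
  obtain ⟨Z, hZ⟩ := (hK.bddAbove_image hzc.continuousOn)
  have hZb : ∀ x ∈ τ '' Metric.closedBall a r, X x 2 ≤ Z := fun x hx => hZ (mem_image_of_mem _ hx)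
  have haK : τ a ∈ τ '' Metric.closedBall a r :=
    mem_image_of_mem _ (Metric.mem_closedBall_self hr.le)
  have hZpos : 0 < Z := (hX.mem (τ a)).trans_le (hZb _ haK)
  have hO : IsOpen (τ '' Metric.ball a r) := h.isOpen_image Metric.isOpen_ball
    fun s hs => (hball (Metric.ball_subset_closedBall hs)).1
  refine ⟨ENNReal.ofReal (r / Z), ENNReal.ofReal_pos.2 (by positivity), fun y hy => ?_⟩
  by_contra hyV
  let := inducedENorm I X
  obtain ⟨γ, hγ0, hγ1, hγ, hlen⟩ := Manifold.exists_lt_of_riemannianEDist_lt (I := I) hy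
  have hS : IsCompact (Icc 0 1 ∩ γ ⁻¹' (τ '' Metric.ball a r)ᶜ) :=
    isCompact_Icc.of_isClosed_subset
      (hγ.continuousOn.preimage_isClosed_of_isClosed isClosed_Icc hO.isClosed_compl)
      inter_subset_left
  -- the first time at which the path leaves the graph over the disc
  obtain ⟨T, ⟨hT, hTO⟩, hTmin⟩ := hS.exists_isLeast ⟨1, ⟨zero_le_one, le_rfl⟩, fun h1 => by
    rw [hγ1] at h1
    obtain ⟨s, hs, rfl⟩ := h1
    exact hyV (hball (Metric.ball_subset_closedBall hs)).2⟩
  have hT0 : 0 < T := by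
    refine lt_of_le_of_ne hT.1 fun h0 => hTO ?_
    rw [← h0, hγ0]
    exact mem_image_of_mem _ (Metric.mem_ball_self hr)
  have hin : ∀ t ∈ Ico 0 T, γ t ∈ τ '' Metric.ball a r := by
    intro t ht
    by_contra hn
    exact absurd (hTmin ⟨⟨ht.1, ht.2.le.trans hT.2⟩, hn⟩) (not_le.2 ht.2)
  have hTK : γ T ∈ τ '' Metric.closedBall a r := by
    have h1 : γ T ∈ closure (τ '' Metric.ball a r) :=
      ((hγ.continuousOn T hT).mono (Ico_subset_Icc_self.trans
        (Icc_subset_Icc_right hT.2))).mem_closure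
        (by rw [closure_Ico hT0.ne]; exact ⟨hT0.le, le_rfl⟩) hin
    exact closure_minimal (image_mono Metric.ball_subset_closedBall) hK.isClosed h1
  obtain ⟨s', hs', hs'T⟩ := hTK
  have hs'n : r ≤ dist s' a := by
    by_contra! hlt
    exact hTO (hs'T ▸ mem_image_of_mem _ hlt)
  have hγT : ContMDiffOn 𝓘(ℝ, ℝ) I 1 γ (Icc 0 T) := hγ.mono (Icc_subset_Icc_right hT.2)
  have hXγ : ContDiffOn ℝ 1 (X ∘ γ) (Icc 0 T) :=
    contMDiffOn_iff_contDiffOn.1 ((hX.smooth.of_le (by simp)).comp_contMDiffOn hγT)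
  set g : ℝ → ℂ := fun t => frameProj b ((X ∘ γ) t) with hg
  have hgC : ContDiffOn ℝ 1 g (Icc 0 T) := (frameProj b).contDiff.comp_contDiffOn hXγ
  have hg0 : g 0 = a := by
    simp only [hg, Function.comp_apply, hγ0, h.eq_graph a ha, frameProj_graphMap]
  have hgT : g T = s' := by
    simp only [hg, Function.comp_apply, ← hs'T, h.eq_graph s' (hball hs').1, frameProj_graphMap]
  have hbound := enorm_sub_le_lintegral_deriv_of_contDiffOn_Icc hgC hT0.le
  have hlen' : ∫⁻ t in Icc 0 T, ‖deriv g t‖ₑ ≤ ENNReal.ofReal Z * Manifold.pathELength I γ 0 T := by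
    rw [Manifold.pathELength_eq_lintegral_mfderiv_Ioo,
      MeasureTheory.restrict_Ioo_eq_restrict_Icc.symm,
      ← MeasureTheory.lintegral_const_mul' _ _ ENNReal.ofReal_ne_top]
    refine MeasureTheory.setLIntegral_mono' measurableSet_Ioo fun t ht => ?_
    change _ ≤ ENNReal.ofReal Z * ENNReal.ofReal
      (hypNorm (X (γ t)) (dmap I X (γ t) (mfderiv 𝓘(ℝ, ℝ) I γ t (1 : ℝ))))
    rw [dmap_comp ((hX.smooth _).mdifferentiableAt (by simp))
      (mdifferentiableAt_of_contMDiffOn_Icc hγT ht), hypNorm_eq (hX.mem _),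
      ← ENNReal.ofReal_mul hZpos.le, ← ofReal_norm]
    refine ENNReal.ofReal_le_ofReal ?_
    have hd : DifferentiableAt ℝ (X ∘ γ) t :=
      ((hXγ t (Ioo_subset_Icc_self ht)).contDiffAt (Icc_mem_nhds ht.1 ht.2)).differentiableAt
        (by simp)
    have hdg : deriv g t = frameProj b (fderiv ℝ (X ∘ γ) t 1) :=
      congrArg (fun L : ℝ →L[ℝ] ℂ => L 1) ((frameProj b).hasFDerivAt.comp t hd.hasFDerivAt).fderiv
    rw [hdg]
    refine (norm_frameProj_le b _).trans ?_
    have hz : 0 < X (γ t) 2 := hX.mem _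
    have hzZ : X (γ t) 2 ≤ Z := hZb _
      (image_mono Metric.ball_subset_closedBall (hin t ⟨ht.1.le, ht.2⟩))
    rw [← mul_div_assoc, le_div_iff₀ hz, mul_comm Z]
    gcongr
  have hfin : ENNReal.ofReal r ≤ ENNReal.ofReal Z * Manifold.pathELength I γ 0 T := by
    refine le_trans ?_ (hbound.trans hlen')
    rw [hg0, hgT, ← ofReal_norm, ← dist_eq_norm]
    exact ENNReal.ofReal_le_ofReal hs'n
  have hlt : ENNReal.ofReal Z * Manifold.pathELength I γ 0 T < ENNReal.ofReal r := by
    have h1 : Manifold.pathELength I γ 0 T < ENNReal.ofReal (r / Z) :=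
      (Manifold.pathELength_mono le_rfl hT.2).trans_lt hlen
    rw [ENNReal.ofReal_div_of_pos hZpos,
      ENNReal.lt_div_iff_mul_lt (by simp [hZpos]) (by simp)] at h1
    rwa [mul_comm]
  exact absurd hfin (not_le.2 hlt)

end

end HypTranslator

namespace HypTranslator

/-! ### Continuation of the coincidence -/

theorem IsTranslatorGraph.mono {β : Fin 3 → ℝ} {u : ℂ → ℝ} {a b : ℂ} {ρ σ : ℝ}
    (h : IsTranslatorGraph β u a ρ) (hb : dist b a + σ ≤ ρ) : IsTranslatorGraph β u b σ := by
  have hsub : Metric.ball b σ ⊆ Metric.ball a ρ := Metric.ball_subset_ball' (by linarith)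
  exact ⟨h.smooth.mono hsub, fun s hs => h.height_pos s (hsub hs), fun s hs => h.eqn s (hsub hs)⟩

section

variable {H₁ : Type*} [TopologicalSpace H₁]
  {I₁ : ModelWithCorners ℝ (EuclideanSpace ℝ (Fin 2)) H₁}
  {M₁ : Type*} [TopologicalSpace M₁] [ChartedSpace H₁ M₁] [IsManifold I₁ ∞ M₁]
  [SecondCountableTopology M₁]
  {H₂ : Type*} [TopologicalSpace H₂]
  {I₂ : ModelWithCorners ℝ (EuclideanSpace ℝ (Fin 2)) H₂}
  {M₂ : Type*} [TopologicalSpace M₂] [ChartedSpace H₂ M₂] [IsManifold I₂ ∞ M₂]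
  [SecondCountableTopology M₂]

theorem IsTranslator.exists_isGraphParam {X : M₁ → E3} (hX : IsTranslator I₁ X) {x : M₁}
    (hx : I₁.IsInteriorPoint x) : ∃ b : OrthonormalBasis (Fin 3) ℝ E3, ∃ ρ > 0, ∃ u τ a,
      IsGraphParam I₁ X b u τ a ρ ∧ τ a = x := by
  obtain ⟨b, hb⟩ := hX.exists_frame x
  obtain ⟨-, hX', -⟩ := hX.exists_normal
  obtain ⟨ρ, hρ, u, τ, h⟩ := HypTranslator.exists_isGraphParam hX' hx b
    (injective_frameProj_dmap hX' b (fun _ => 0) rfl hb)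
  exact ⟨b, ρ, hρ, u, τ, _, h⟩

theorem IsTranslator.tendsto_of_inducedEDist [T2Space M₂] {X : M₂ → E3}
    (hX : IsTranslator I₂ X) {x : M₂} (hx : I₂.IsInteriorPoint x) {y : ℕ → M₂}
    (hy : Tendsto (fun n => inducedEDist I₂ X (y n) x) atTop (𝓝 0)) :
    Tendsto y atTop (𝓝 x) := by
  obtain ⟨b, ρ, hρ, u, τ, a, h, rfl⟩ := hX.exists_isGraphParam hx
  obtain ⟨-, hX', -⟩ := hX.exists_normal
  intro V hV
  obtain ⟨ε, hε, hεV⟩ := h.exists_inducedEDist_lt hX' hρ hV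
  refine (hy.eventually (gt_mem_nhds hε)).mono fun n hn => hεV _ ?_
  rwa [inducedEDist_comm]

/-- Coincidence of sheets is a closed condition along a graph: at a limit point the second surface
is tangent to the graph of the first one, hence a graph over the same plane, and the two functions
agree by unique continuation. -/
theorem sameSheet_of_tendsto {X₁ : M₁ → E3} {X₂ : M₂ → E3} (hX₁ : IsTranslator I₁ X₁)
    (hX₂ : IsTranslator I₂ X₂) {b : OrthonormalBasis (Fin 3) ℝ E3} {u : ℂ → ℝ} {τ : ℂ → M₁} {a : ℂ}
    {ρ : ℝ} (h₁ : IsGraphParam I₁ X₁ b u τ a ρ) {s : ℕ → ℂ} {s₀ : ℂ} (hs : Tendsto s atTop (𝓝 s₀))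
    (hs₀ : s₀ ∈ Metric.ball a ρ) {y : ℕ → M₂} {y₀ : M₂} (hy : Tendsto y atTop (𝓝 y₀))
    (hy₀ : I₂.IsInteriorPoint y₀) (h : ∀ᶠ n in atTop, SameSheet X₁ X₂ (τ (s n)) (y n)) :
    SameSheet X₁ X₂ (τ s₀) y₀ := by
  obtain ⟨-, hi₁, -⟩ := hX₁.exists_normal
  obtain ⟨-, hi₂, -⟩ := hX₂.exists_normal
  have c₁ := hi₁.smooth.continuous
  have c₂ := hi₂.smooth.continuous
  have hball : ∀ᶠ n in atTop, s n ∈ Metric.ball a ρ :=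
    hs.eventually (Metric.isOpen_ball.eventually_mem hs₀)
  have hpr : ∀ᶠ n in atTop, frameProj b (X₂ (y n)) = s n := by
    filter_upwards [h, hball] with n hn hm
    rw [← hn.apply_eq c₁.continuousAt c₂.continuousAt, h₁.eq_graph _ hm, frameProj_graphMap]
  have hp : frameProj b (X₂ y₀) = s₀ :=
    tendsto_nhds_unique (((frameProj b).continuous.comp c₂).continuousAt.tendsto.comp hy)
      (hs.congr' (hpr.mono fun n hn => hn.symm))
  have hfreq : ∃ᶠ z in 𝓝 y₀, ∀ᶠ w in 𝓝 z, inner ℝ (b 2) (X₂ w) = u (frameProj b (X₂ w)) := by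
    refine hy.frequently (Eventually.frequently ?_)
    filter_upwards [h, hball] with n hn hm
    have h2 : ∀ᶠ q in map X₁ (𝓝 (τ (s n))), inner ℝ (b 2) q = u (frameProj b q) := by
      rw [h₁.map_nhds_comp hm]
      exact eventually_map.2 <| Eventually.of_forall fun t => by
        rw [frameProj_graphMap]
        exact (inner_frame b t.re t.im (u t)).2.2
    rwa [show map X₁ (𝓝 (τ (s n))) = _ from hn, eventually_map] at h2
  obtain ⟨σ, hσ, v, τ₂, h₂, hτ₂⟩ := exists_isGraphParam_of_frequently hi₂ hy₀ b (u := u) (by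
    rw [hp]
    filter_upwards [Metric.isOpen_ball.mem_nhds hs₀] with t ht using
      h₁.smooth.contDiffAt (Metric.isOpen_ball.mem_nhds ht)) hfreq
  rw [hp] at h₂ hτ₂
  set κ := min σ (ρ - dist s₀ a) with hκ
  have hκ0 : 0 < κ := lt_min hσ (sub_pos.2 hs₀)
  have hκρ : dist s₀ a + κ ≤ ρ := by linarith [min_le_right σ (ρ - dist s₀ a)]
  have hκσ : κ / 2 ≤ σ := by linarith [min_le_left σ (ρ - dist s₀ a)]
  have hsub : Metric.ball s₀ (κ / 2) ⊆ Metric.ball s₀ σ := Metric.ball_subset_ball hκσ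
  have hmem₂ := Metric.mem_ball_self (x := s₀) hσ
  have hnear : ∀ᶠ n in atTop, y n ∈ τ₂ '' Metric.ball s₀ (κ / 2) := by
    refine hy.eventually ((h₂.isOpen_image Metric.isOpen_ball hsub).eventually_mem ?_)
    rw [← hτ₂]
    exact mem_image_of_mem _ (Metric.mem_ball_self (by positivity))
  obtain ⟨n, ⟨t, ht, hty⟩, hn, hnp, hnb⟩ := (hnear.and (h.and (hpr.and hball))).exists
  have hst : t = s n := by
    rw [← hnp, ← hty, h₂.eq_graph t (hsub ht), frameProj_graphMap]
  subst hst
  rw [← hty, sameSheet_iff h₁ h₂ hnb (hsub ht)] at hn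
  have q₁ : IsTranslatorGraph (fun j => b j 2) u s₀ κ := (h₁.isTranslatorGraph hX₁).mono hκρ
  have q₂ : IsTranslatorGraph (fun j => b j 2) v s₀ κ := (h₂.isTranslatorGraph hX₂).mono
    (by rw [dist_self, zero_add]; exact min_le_left _ _)
  have hd : dist (s n) s₀ < κ / 2 := ht
  have huc := ((q₁.isEllipticIneq_sub q₂).mono (b := s n) (σ := κ / 2)
    (by linarith)).unique_continuation (hn.mono fun z hz => sub_eq_zero.2 hz)
  rw [← hτ₂, sameSheet_iff h₁ h₂ hs₀ hmem₂]
  have h0 : s₀ ∈ Metric.ball (s n) (κ / 2) := by rwa [Metric.mem_ball, dist_comm]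
  filter_upwards [Metric.isOpen_ball.mem_nhds h0] with z hz using sub_eq_zero.1 (huc z hz)

/-- The coincidence of sheets propagates along a segment of a graph when the second surface is
complete: the lift of the segment to the second surface has finite length. -/
theorem exists_sameSheet_center [T2Space M₂] {X₁ : M₁ → E3} {X₂ : M₂ → E3}
    (hX₁ : IsTranslator I₁ X₁) (hX₂ : IsTranslator I₂ X₂) (hc₂ : IsCompleteSurface I₂ X₂)
    {b : OrthonormalBasis (Fin 3) ℝ E3} {u : ℂ → ℝ} {τ : ℂ → M₁} {a : ℂ}
    {ρ : ℝ} (h₁ : IsGraphParam I₁ X₁ b u τ a ρ) {s : ℂ} (hs : s ∈ Metric.ball a ρ) {y : M₂}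
    (h : SameSheet X₁ X₂ (τ s) y) : ∃ y', SameSheet X₁ X₂ (τ a) y' := by
  obtain ⟨-, hi₁, -⟩ := hX₁.exists_normal
  obtain ⟨-, hi₂, -⟩ := hX₂.exists_normal
  set c : ℝ → ℂ := fun t => s + t • (a - s) with hc
  have hcs : ContDiff ℝ ∞ c := by rw [hc]; fun_prop
  have hc0 : c 0 = s := by simp [hc]
  have hc1 : c 1 = a := by simp [hc]
  have hcb : ∀ t ∈ Icc (0 : ℝ) 1, c t ∈ Metric.ball a ρ := by
    intro t ht
    refine (convex_ball a ρ).add_smul_sub_mem hs (Metric.mem_ball_self ?_) ht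
    exact dist_nonneg.trans_lt hs
  have hO : IsOpen (c ⁻¹' Metric.ball a ρ) := Metric.isOpen_ball.preimage hcs.continuous
  set δ : ℝ → E3 := fun t => graphMap b u (c t) with hδ
  have hδs : ContDiffOn ℝ ∞ δ (c ⁻¹' Metric.ball a ρ) :=
    (contDiffOn_graphMap b h₁.smooth).comp hcs.contDiffOn fun t ht => ht
  have hδp : ∀ t ∈ c ⁻¹' Metric.ball a ρ, δ t ∈ upperHalfSpace := by
    intro t ht
    rw [hδ]
    simp only
    rw [← h₁.eq_graph _ ht]
    exact hi₁.mem _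
  obtain ⟨K, hK⟩ : ∃ K, ∀ t ∈ Icc (0 : ℝ) 1, hypNorm (δ t) (deriv δ t) ≤ K := by
    have h2 : ContinuousOn (fun t => ‖deriv δ t‖ / δ t 2) (Icc 0 1) := by
      have h3 : ContinuousOn (deriv δ) (c ⁻¹' Metric.ball a ρ) :=
        hδs.continuousOn_deriv_of_isOpen hO (by simp)
      have h4 : ContinuousOn (fun t => δ t 2) (c ⁻¹' Metric.ball a ρ) := by
        have := hδs.continuousOn
        fun_prop
      exact (h3.norm.div h4 fun t ht => (hδp t ht).ne').mono hcb
    obtain ⟨K, hK⟩ := isCompact_Icc.bddAbove_image h2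
    exact ⟨K, fun t ht => by rw [hypNorm_eq (hδp t (hcb t ht))]; exact hK (mem_image_of_mem _ ht)⟩
  have hK0 : 0 ≤ K := (Real.sqrt_nonneg _).trans (hK 0 ⟨le_rfl, zero_le_one⟩)
  -- times at which the segment has a lift, with the end point of the lift; they are compared by a
  -- Lipschitz estimate that replaces the gluing of paths
  let α := {q : ℝ × M₂ // q.1 ∈ Icc (0 : ℝ) 1 ∧ SameSheet X₁ X₂ (τ (c q.1)) q.2}
  let r : α → α → Prop := fun q q' => q.1.1 ≤ q'.1.1 ∧
    inducedEDist I₂ X₂ q.1.2 q'.1.2 ≤ ENNReal.ofReal (K * (q'.1.1 - q.1.1))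
  have hrefl : ∀ q, r q q := fun q => ⟨le_rfl, by rw [inducedEDist_self]; exact zero_le⟩
  have htrans : ∀ {q q' q''}, r q q' → r q' q'' → r q q'' := by
    intro q q' q'' h1 h2
    refine ⟨h1.1.trans h2.1, (inducedEDist_triangle X₂ _ q'.1.2 _).trans
      ((add_le_add h1.2 h2.2).trans ?_)⟩
    rw [← ENNReal.ofReal_add (mul_nonneg hK0 (sub_nonneg.2 h1.1))
      (mul_nonneg hK0 (sub_nonneg.2 h2.1))]
    exact ENNReal.ofReal_le_ofReal (by linarith)
  have hext : ∀ q : α, q.1.1 < 1 → ∃ q' : α, r q q' ∧ q.1.1 < q'.1.1 := by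
    rintro ⟨⟨t, z⟩, ht, hz⟩ ht1
    simp only at ht hz ht1
    obtain ⟨σ, hσ, v, τ₂, h₂, hτ₂⟩ := hz.exists_isGraphParam hi₁.smooth.continuous hi₂ h₁
      (hcb t ht) (hc₂.boundaryless z)
    rw [← hτ₂, sameSheet_iff h₁ h₂ (hcb t ht) (Metric.mem_ball_self hσ)] at hz
    have hev : ∀ᶠ t' in 𝓝 t, c t' ∈ Metric.ball a ρ ∧ c t' ∈ Metric.ball (c t) σ ∧
        u =ᶠ[𝓝 (c t')] v := by
      have h2 : Tendsto c (𝓝 t) (𝓝 (c t)) := hcs.continuous.continuousAt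
      exact h2.eventually ((Metric.isOpen_ball.eventually_mem (hcb t ht)).and
        ((Metric.isOpen_ball.eventually_mem (Metric.mem_ball_self hσ)).and hz.eventuallyEq_nhds))
    obtain ⟨ε, hε, hball⟩ := Metric.eventually_nhds_iff_ball.1 hev
    set t' := min 1 (t + ε / 2) with ht'
    have htt' : t < t' := lt_min ht1 (by linarith)
    have ht'1 : t' ≤ 1 := min_le_left _ _
    have hin : ∀ x ∈ Icc t t', x ∈ Metric.ball t ε := by
      intro x hx
      rw [Metric.mem_ball, Real.dist_eq, abs_of_nonneg (sub_nonneg.2 hx.1)]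
      linarith [hx.2, min_le_right 1 (t + ε / 2)]
    obtain ⟨e1, e2, e3⟩ := hball t' (hin t' ⟨htt'.le, le_rfl⟩)
    refine ⟨⟨(t', τ₂ (c t')), ⟨ht.1.trans htt'.le, ht'1⟩, (sameSheet_iff h₁ h₂ e1 e2).2 e3⟩,
      ⟨htt'.le, ?_⟩, htt'⟩
    have hγ : ContMDiffOn 𝓘(ℝ, ℝ) I₂ 1 (fun x => τ₂ (c x)) (Icc t t') :=
      (h₂.param_smooth.of_le (by simp)).comp
        (contMDiffOn_iff_contDiffOn.2 (hcs.of_le (by simp)).contDiffOn)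
        fun x hx => (hball x (hin x hx)).2.1
    have hle := inducedEDist_le hi₂.smooth htt'.le hγ (K := K) fun x hx => by
      have hx' := Ioo_subset_Icc_self hx
      have h5 : X₂ ∘ (fun x => τ₂ (c x)) =ᶠ[𝓝 x] δ := by
        filter_upwards [Metric.isOpen_ball.mem_nhds (hin x hx')] with w hw
        obtain ⟨f1, f2, f3⟩ := hball w hw
        simp only [Function.comp_apply, hδ]
        rw [h₂.eq_graph _ f2, graphMap, graphMap, f3.eq_of_nhds]
      rw [h5.deriv_eq]
      have h6 : X₂ (τ₂ (c x)) = δ x := h5.eq_of_nhds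
      rw [h6]
      exact hK x ⟨ht.1.trans hx'.1, hx'.2.trans ht'1⟩
    simp only [hτ₂] at hle
    exact hle
  have hchain : ∀ C : Set α, IsChain r C → ∃ ub, ∀ q ∈ C, r q ub := by
    intro C hC
    rcases C.eq_empty_or_nonempty with rfl | hne
    · exact ⟨⟨(0, y), ⟨le_rfl, zero_le_one⟩, by simpa only [hc0] using h⟩, by simp⟩
    have htot : ∀ q ∈ C, ∀ q' ∈ C, q.1.1 < q'.1.1 → r q q' := by
      intro q hq q' hq' hlt
      rcases hC hq hq' (by rintro rfl; exact lt_irrefl _ hlt) with h2 | h2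
      · exact h2
      · exact absurd h2.1 (not_le.2 hlt)
    set P : Set ℝ := (fun q : α => q.1.1) '' C with hP
    have hPb : BddAbove P := ⟨1, by rintro _ ⟨q, -, rfl⟩; exact q.2.1.2⟩
    have hPlub := isLUB_csSup (hne.image _) hPb
    set T := sSup P with hT
    by_cases hTP : T ∈ P
    · obtain ⟨q, hq, hqT⟩ := hTP
      refine ⟨q, fun q' hq' => ?_⟩
      rcases eq_or_ne q' q with rfl | hne'
      · exact hrefl _
      rcases hC hq' hq hne' with h2 | h2
      · exact h2
      · have h3 : q'.1.1 ≤ q.1.1 := (hPlub.1 (mem_image_of_mem _ hq')).trans hqT.ge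
        have h4 : q'.1.1 = q.1.1 := le_antisymm h3 h2.1
        refine ⟨h3, ?_⟩
        have h5 := h2.2
        rw [inducedEDist_comm, h4]
        rwa [h4] at h5
    · obtain ⟨w, hw, hwT, hwlim, hwP⟩ := hPlub.exists_seq_strictMono_tendsto_of_notMem hTP
        (hne.image _)
      choose q hqC hqw using hwP
      simp only at hqw
      have hTI : T ∈ Icc (0 : ℝ) 1 := by
        refine ⟨?_, csSup_le (hne.image _) (by rintro _ ⟨q, -, rfl⟩; exact q.2.1.2)⟩
        exact ((q 0).2.1.1.trans_eq (hqw 0)).trans (hwT 0).le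
      have hqr : ∀ m n, m < n → r (q m) (q n) := fun m n hmn =>
        htot _ (hqC m) _ (hqC n) (by rw [hqw, hqw]; exact hw hmn)
      have hqd : ∀ m n, m ≤ n → inducedEDist I₂ X₂ (q m).1.2 (q n).1.2 ≤
          ENNReal.ofReal (K * (T - w m)) := by
        intro m n hmn
        rcases hmn.eq_or_lt with rfl | hlt
        · rw [inducedEDist_self]; exact zero_le
        · refine (hqr m n hlt).2.trans (ENNReal.ofReal_le_ofReal ?_)
          rw [hqw, hqw]
          have := (hwT n).le
          gcongr
      have hlim0 : Tendsto (fun n => ENNReal.ofReal (K * (T - w n))) atTop (𝓝 0) := by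
        have := ENNReal.tendsto_ofReal ((hwlim.const_sub T).const_mul K)
        simpa using this
      obtain ⟨z, hz⟩ := hc₂.complete (fun n => (q n).1.2) fun ε hε => by
        obtain ⟨N, hN⟩ := eventually_atTop.1
          (hlim0.eventually (gt_mem_nhds (ENNReal.half_pos hε.ne')))
        refine ⟨N, fun m hm n hn => (inducedEDist_triangle X₂ _ (q N).1.2 _).trans_lt ?_⟩
        rw [← ENNReal.add_halves ε, inducedEDist_comm]
        exact ENNReal.add_lt_add ((hqd N m hm).trans_lt (hN N le_rfl))
          ((hqd N n hn).trans_lt (hN N le_rfl))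
      have hztop := hX₂.tendsto_of_inducedEDist (hc₂.boundaryless z) hz
      have hsheet : SameSheet X₁ X₂ (τ (c T)) z :=
        sameSheet_of_tendsto hX₁ hX₂ h₁ ((hcs.continuous.tendsto T).comp hwlim) (hcb T hTI) hztop
          (hc₂.boundaryless z) (Eventually.of_forall fun n => by
            have := (q n).2.2
            rw [hqw] at this
            exact this)
      have hub : ∀ n, r (q n) ⟨(T, z), hTI, hsheet⟩ := by
        intro n
        refine ⟨(hqw n).le.trans (hwT n).le, ?_⟩
        have h2 : Tendsto (fun m => ENNReal.ofReal (K * (T - w n)) +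
            inducedEDist I₂ X₂ (q m).1.2 z) atTop (𝓝 (ENNReal.ofReal (K * (T - w n)) + 0)) :=
          tendsto_const_nhds.add hz
        rw [add_zero] at h2
        rw [hqw]
        refine ge_of_tendsto h2 ?_
        filter_upwards [eventually_ge_atTop n] with m hm
        exact (inducedEDist_triangle X₂ _ (q m).1.2 _).trans (by gcongr; exact hqd n m hm)
      refine ⟨⟨(T, z), hTI, hsheet⟩, fun q' hq' => ?_⟩
      have hlt : q'.1.1 < T := lt_of_le_of_ne (hPlub.1 (mem_image_of_mem _ hq')) fun h2 =>
        hTP (h2 ▸ mem_image_of_mem _ hq')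
      obtain ⟨n, hn⟩ := (hwlim.eventually (lt_mem_nhds hlt)).exists
      exact htrans (htot _ hq' _ (hqC n) (by rwa [hqw])) (hub n)
  -- a maximal partial lift is defined up to the end of the segment
  obtain ⟨m, hm⟩ := exists_maximal_of_chains_bounded hchain htrans
  have hm1 : m.1.1 = 1 := by
    refine le_antisymm m.2.1.2 (not_lt.1 fun hlt => ?_)
    obtain ⟨q', h2, h3⟩ := hext m hlt
    exact absurd (hm q' h2).1 (not_le.2 h3)
  have := m.2.2
  rw [hm1, hc1] at this
  exact ⟨_, this⟩

/-- Two complete translators with a common germ of sheet: by connectedness, every sheet of the first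
one is a sheet of the second one. -/
theorem range_subset_of_sameSheet [ConnectedSpace M₁] [T2Space M₂] {X₁ : M₁ → E3} {X₂ : M₂ → E3}
    (hX₁ : IsTranslator I₁ X₁) (hX₂ : IsTranslator I₂ X₂)
    (hb₁ : ∀ x : M₁, I₁.IsInteriorPoint x) (hc₂ : IsCompleteSurface I₂ X₂) {x : M₁} {y : M₂}
    (h : SameSheet X₁ X₂ x y) : range X₁ ⊆ range X₂ := by
  obtain ⟨-, hi₁, -⟩ := hX₁.exists_normal
  obtain ⟨-, hi₂, -⟩ := hX₂.exists_normal
  set A : Set M₁ := {x | ∃ y, SameSheet X₁ X₂ x y} with hA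
  have hopen : IsOpen A := by
    rw [isOpen_iff_mem_nhds]
    rintro x ⟨y, hxy⟩
    obtain ⟨b, u, a, ρ, τ₁, τ₂, hρ, h₁, h₂, rfl, rfl⟩ :=
      hxy.exists_graph hX₁ hi₂ (hb₁ x) (hc₂.boundaryless y)
    refine mem_of_superset ((h₁.isOpen_image Metric.isOpen_ball Subset.rfl).mem_nhds
      (mem_image_of_mem _ (Metric.mem_ball_self hρ))) ?_
    rintro _ ⟨s, hs, rfl⟩
    exact ⟨τ₂ s, (sameSheet_iff h₁ h₂ hs hs).2 EventuallyEq.rfl⟩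
  have hclosed : IsClosed A := by
    refine isClosed_of_closure_subset fun x hx => ?_
    obtain ⟨b, ρ, hρ, u, τ, a, h₁, rfl⟩ := hX₁.exists_isGraphParam (hb₁ x)
    obtain ⟨_, ⟨s, hs, rfl⟩, y, hy⟩ := mem_closure_iff.1 hx _
      (h₁.isOpen_image Metric.isOpen_ball Subset.rfl)
      (mem_image_of_mem _ (Metric.mem_ball_self hρ))
    exact exists_sameSheet_center hX₁ hX₂ hc₂ h₁ hs hy
  have huniv : A = univ := IsClopen.eq_univ ⟨hclosed, hopen⟩ ⟨x, y, h⟩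
  rintro _ ⟨z, rfl⟩
  obtain ⟨w, hw⟩ : z ∈ A := huniv ▸ mem_univ z
  exact ⟨w, (hw.apply_eq hi₁.smooth.continuous.continuousAt
    hi₂.smooth.continuous.continuousAt).symm⟩

end

end HypTranslator

/-! ### The tangency principle -/

theorem mainTheorem1
    {H₁ : Type*} [TopologicalSpace H₁]
    (I₁ : ModelWithCorners ℝ (EuclideanSpace ℝ (Fin 2)) H₁)
    {M₁ : Type*} [TopologicalSpace M₁] [ChartedSpace H₁ M₁] [IsManifold I₁ ∞ M₁]
    [T2Space M₁] [SecondCountableTopology M₁]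
    {H₂ : Type*} [TopologicalSpace H₂]
    (I₂ : ModelWithCorners ℝ (EuclideanSpace ℝ (Fin 2)) H₂)
    {M₂ : Type*} [TopologicalSpace M₂] [ChartedSpace H₂ M₂] [IsManifold I₂ ∞ M₂]
    [T2Space M₂] [SecondCountableTopology M₂]
    (X₁ : M₁ → HypTranslator.E3) (X₂ : M₂ → HypTranslator.E3)
    (hX₁ : HypTranslator.IsTranslator I₁ X₁) (hX₂ : HypTranslator.IsTranslator I₂ X₂)
    (p₁ : M₁) (p₂ : M₂) (hp₁ : I₁.IsInteriorPoint p₁) (hp₂ : I₂.IsInteriorPoint p₂)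
    (hp : X₁ p₁ = X₂ p₂)
    (htangent : LinearMap.range (HypTranslator.dmap I₁ X₁ p₁) =
      LinearMap.range (HypTranslator.dmap I₂ X₂ p₂))
    (hside : HypTranslator.LiesOnOneSide X₁ p₁ X₂ p₂) :
    (∃ U₁ : Set M₁, ∃ U₂ : Set M₂, IsOpen U₁ ∧ IsOpen U₂ ∧ p₁ ∈ U₁ ∧ p₂ ∈ U₂ ∧
      X₁ '' U₁ = X₂ '' U₂) ∧
    (HypTranslator.IsCompleteSurface I₁ X₁ → HypTranslator.IsCompleteSurface I₂ X₂ →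
      ConnectedSpace M₁ → ConnectedSpace M₂ → range X₁ = range X₂) := by
  have h := HypTranslator.sameSheet_of_liesOnOneSide hX₁ hX₂ hp₁ hp₂ hp htangent hside
  obtain ⟨-, hi₂, -⟩ := hX₂.exists_normal
  refine ⟨?_, fun hc₁ hc₂ _ _ => Subset.antisymm ?_ ?_⟩
  · obtain ⟨b, u, a, ρ, τ₁, τ₂, hρ, h₁, h₂, rfl, rfl⟩ := h.exists_graph hX₁ hi₂ hp₁ hp₂
    have ha := Metric.mem_ball_self (x := a) hρ
    refine ⟨τ₁ '' Metric.ball a ρ, τ₂ '' Metric.ball a ρ,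
      h₁.isOpen_image Metric.isOpen_ball Subset.rfl, h₂.isOpen_image Metric.isOpen_ball Subset.rfl,
      mem_image_of_mem _ ha, mem_image_of_mem _ ha, ?_⟩
    rw [image_image, image_image]
    exact image_congr fun s hs => (h₁.eq_graph s hs).trans (h₂.eq_graph s hs).symm
  · exact HypTranslator.range_subset_of_sameSheet hX₁ hX₂ hc₁.boundaryless hc₂ h
  · exact HypTranslator.range_subset_of_sameSheet hX₂ hX₁ hc₂.boundaryless hc₁ h.symm
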